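/- **Algorithm.** DP-Winnow in dimension $n$ with parameters $(\hat\varepsilon,\eta,L,m,K)$ processes labelled examples $(z^{(t)},y^{(t)})\in\{-1,1\}^n\times\{-1,1\}$, $t=1,\dots,T$. It keeps a private weight vector $w$ and a released one $\tilde w$, both initially $(1/n,\dots,1/n)$. In round $t$ it outputs the hypothesis $z\mapsto\operatorname{sgn}\langle\tilde w,z\rangle$ (with $\operatorname{sgn}0=1$), given by the current vector $\tilde w^{(t)}=\tilde w$, then sees $y^{(t)}$, and tests with an AboveThreshold instance of threshold $L$ (noise $\mathrm{Lap}(2/\hat\varepsilon)$ on the threshold, fresh noise $\mathrm{Lap}(4/\hat\varepsilon)$ on each query) whether the number of prediction errors since the last update is above the threshold. If the test succeeds and fewer than $K$ updates have been made, it performs an update: with $(\hat z,\hat y)$ the first misclassified example since the last update it replaces $w_j$ by $w_je^{\eta\hat y\hat z_j}/\sum_k w_ke^{\eta\hat y\hat z_k}$ for all $j$ (and leaves $w$ unchanged if there is no such example), sets $\tilde w$ to the empirical frequencies of $m$ independent samples from $w$, resets the error count, and starts a new AboveThreshold instance. **Learner.** For examples $x\in\{-1,1\}^d$, DP-Winnow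 is run in dimension $n=2(d+1)$ on $z=(x,1,-x,-1)$. **Tuning.** For a margin parameter $\rho>0$ and a constant $c_m>0$, the parameters are *tuned* if $0<\eta<\rho$, $m=\lceil c_m\log(2T/\beta)/\rho^2\rceil$, $K=\dfrac{2\log n}{\eta\rho-\eta^2}$, $\hat\varepsilon=\dfrac{\varepsilon}{4\sqrt{2K\log(2/\delta)}}$, $\eta=\dfrac{\varepsilon}{8\sqrt{2mK\log(4K/\delta)}}$ and $L=\dfrac{8\log(2T/\beta)}{\hat\varepsilon}$. **Decision lists.** A length-$r$ monotone 1-decision list over $d$ variables is given by $(\ell_1,b_1),\dots,(\ell_{r-1},b_{r-1}),b_r$, where each $\ell_i$ is a variable and $b_i\in\{-1,1\}$; it computes "if $\ell_1$ then $b_1$, else if $\ell_2$ then $b_2$, …, else $b_r$" on $\{-1,1\}^d$, a variable being true when it equals $1$. It has (at most) $D$ alternations if $b_i\ne b_{i+1}$ for at most $D$ indices $i$. **Theorem.** There are absolute constants $c_\rho,c_m,C>0$ and $a\in\mathbb N$ such that for all integers $r,d,T\ge1$, $D\ge0$ and all $\varepsilon,\delta,\beta\in(0,1)$ tuned parameters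 for $\rho=c_\rho/r^D$ exist, and for any tuned parameters the learner has the following two properties. 1. (Privacy.) It is $(\varepsilon,\delta)$-differentially private: for any two sequences $S,S'$ of $T$ labelled examples in $\{-1,1\}^d\times\{-1,1\}$ that differ in at most one example, and any set $R$ of sequences of weight vectors, the output sequence $M(S)=(\tilde w^{(1)},\dots,\tilde w^{(T)})$ satisfies $\Pr[M(S)\in R]\le e^\varepsilon\Pr[M(S')\in R]+\delta$. 2. (Mistakes.) For every length-$r$ monotone 1-decision list $f$ over $d$ variables with at most $D$ alternations, and every sequence $x^{(1)},\dots,x^{(T)}\in\{-1,1\}^d$ fixed in advance and labelled by $f$, the number of prediction errors is, with probability at least $1-C\beta$, at most $C\,F\,\log^a(2+F)$, where $$F=\frac{r^{6D}\,\log^3(d+1)\,\log^{5/2}(T/\beta)\,\log^2(2/\delta)}{\varepsilon^4}.$$ In other words, it is $\tilde O\big(r^{6D}\log^3 d\,\log^{5/2}(T/\beta)\log^2(1/\delta)/\varepsilon^4\big)$. -/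

import Mathlib

open MeasureTheory

/-! ## Signs, decision lists -/

/-- The value set `{-1, 1}` is encoded by `Bool`, `true` standing for `1` (and for a true variable). -/
noncomputable def pmOne (b : Bool) : ℝ := if b then 1 else -1

/-- The sign of a real number in `{-1, 1}`, with `sgn 0 = 1`. -/
noncomputable def sgn (a : ℝ) : Bool := open Classical in decide (0 ≤ a)

/-- The prediction `sgn ⟨w, x⟩` of the halfspace with weight vector `w` at `x ∈ {-1, 1}ⁿ`. -/
noncomputable def halfspace {n : ℕ} (w : Fin n → ℝ) (x : Fin n → Bool) : Bool :=
  sgn (∑ j, w j * pmOne (x j))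

/-- A monotone 1-decision list over `d` variables: the rules `(ℓ₁, b₁), …, (ℓ_{r-1}, b_{r-1})`,
each `ℓᵢ` being a variable, and the default bit `b_r`. -/
structure MonotoneDecisionList (d : ℕ) where
  rules : List (Fin d × Bool)
  default : Bool

namespace MonotoneDecisionList

/-- The length `r` counts the default rule. -/
def length {d : ℕ} (c : MonotoneDecisionList d) : ℕ := c.rules.length + 1

/-- "if `ℓ₁` then `b₁`, else if `ℓ₂` then `b₂`, …, else `b_r`". -/
def eval {d : ℕ} (c : MonotoneDecisionList d) (x : Fin d → Bool) : Bool :=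
  c.rules.foldr (fun rule rest => if x rule.1 then rule.2 else rest) c.default

/-- The sequence of output bits `b₁, …, b_r`. -/
def bits {d : ℕ} (c : MonotoneDecisionList d) : List Bool := c.rules.map Prod.snd ++ [c.default]

end MonotoneDecisionList

/-- The number of indices `i` with `bᵢ ≠ bᵢ₊₁`. -/
def alternations : List Bool → ℕ
  | [] => 0
  | [_] => 0
  | a :: b :: l => (if a = b then 0 else 1) + alternations (b :: l)

/-! ## The random source -/

/-- The Laplace distribution centred at `0` with scale `b`. -/
noncomputable def laplace (b : ℝ) : Measure ℝ :=
  volume.withDensity fun x => ENNReal.ofReal (Real.exp (-|x| / b) / (2 * b))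

/-- The uniform distribution on `(0, 1]`. -/
noncomputable def uniform01 : Measure ℝ := volume.restrict (Set.Ioc 0 1)

/-- Inverse transform sampling from a probability vector `w`: the least index `j` with
`u ≤ w₁ + ⋯ + w_j`. For `u` uniform on `(0, 1]` the result is `j` with probability `w_j`. -/
noncomputable def sampleIndex {n : ℕ} [NeZero n] (w : Fin n → ℝ) (u : ℝ) : Fin n :=
  open Classical in
  if h : (Finset.univ.filter fun j : Fin n => u ≤ ∑ i ∈ Finset.Iic j, w i).Nonempty then
    (Finset.univ.filter fun j : Fin n => u ≤ ∑ i ∈ Finset.Iic j, w i).min' h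
  else 0

/-- Parameters of DP-Winnow: privacy parameter `epsHat` of each AboveThreshold instance,
learning rate `η`, threshold `L`, number of samples `m`, switching bound `K`. -/
structure WinnowParams where
  epsHat : ℝ
  η : ℝ
  L : ℝ
  m : ℕ
  K : ℝ

/-- The random source for `T` rounds: the threshold noise of the first AboveThreshold instance and,
for every round, a triple: the threshold noise of the AboveThreshold instance that is initialized at
the end of the round (if one is), the noise of the round's query, and the `m` uniform variables that
drive the round's sampling (if there is one). -/
abbrev Coins (m T : ℕ) : Type := ℝ × (Fin T → ℝ × ℝ × (Fin m → ℝ))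

/-- All coins are independent; AboveThreshold with privacy parameter `ε̂` uses `Lap(2/ε̂)` noise on
the threshold and fresh `Lap(4/ε̂)` noise on each query. -/
noncomputable def coinMeasure (p : WinnowParams) (T : ℕ) : Measure (Coins p.m T) :=
  (laplace (2 / p.epsHat)).prod
    (Measure.pi fun _ : Fin T =>
      (laplace (2 / p.epsHat)).prod
        ((laplace (4 / p.epsHat)).prod (Measure.pi fun _ : Fin p.m => uniform01)))

/-! ## DP-Winnow -/

/-- The state of DP-Winnow between two rounds. -/
structure WinnowState (n : ℕ) where
  /-- the private weight vector `w` -/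
  w : Fin n → ℝ
  /-- the released approximate weight vector -/
  wTilde : Fin n → ℝ
  /-- the first misclassified example since the last update, if there is one -/
  cache : Option ((Fin n → Bool) × Bool)
  /-- the number of prediction errors since the last update (the value of the last query) -/
  errs : ℕ
  /-- the number of updates so far -/
  k : ℕ
  /-- the noisy threshold of the current AboveThreshold instance -/
  noisyThr : ℝ

/-- Initially both weight vectors are uniform; `ξ` is the threshold noise of the first instance. -/
noncomputable def WinnowState.init (n : ℕ) (p : WinnowParams) (ξ : ℝ) : WinnowState n where
  w := fun _ => 1 / n
  wTilde := fun _ => 1 / n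
  cache := none
  errs := 0
  k := 0
  noisyThr := p.L + ξ

/-- The multiplicative weight update of `w` with learning rate `η` on the example `e`. -/
noncomputable def mwUpdate {n : ℕ} (η : ℝ) (w : Fin n → ℝ) (e : (Fin n → Bool) × Bool) :
    Fin n → ℝ := fun j =>
  Real.exp (η * pmOne e.2 * pmOne (e.1 j)) /
    (∑ i, w i * Real.exp (η * pmOne e.2 * pmOne (e.1 i))) * w j

/-- The empirical frequencies of `m` independent samples from `w`. -/
noncomputable def sampledWeights {n m : ℕ} [NeZero n] (w : Fin n → ℝ) (u : Fin m → ℝ) :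
    Fin n → ℝ := fun j =>
  (1 / m : ℝ) * ((Finset.univ.filter fun i : Fin m => sampleIndex w (u i) = j).card : ℝ)

/-- One round of DP-Winnow, after the current `wTilde` has been output: the labelled example `e` is
recorded if it was misclassified, the number of errors since the last update is tested by
AboveThreshold, and if the test succeeds and fewer than `K` updates were made, then the weights are
updated with the first cached example (they stay as they are if no example is cached), `wTilde` is
sampled afresh, and a new AboveThreshold instance is started. -/
noncomputable def winnowStep {n : ℕ} [NeZero n] (p : WinnowParams) (s : WinnowState n)
    (e : (Fin n → Bool) × Bool) (coins : ℝ × ℝ × (Fin p.m → ℝ)) : WinnowState n :=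
  open Classical in
  let err : Prop := halfspace s.wTilde e.1 ≠ e.2
  let cache := if err then s.cache.or (some e) else s.cache
  let errs := if err then s.errs + 1 else s.errs
  if s.noisyThr ≤ errs + coins.2.1 ∧ (s.k : ℝ) < p.K then
    let w := cache.elim s.w (mwUpdate p.η s.w)
    { w := w
      wTilde := sampledWeights w coins.2.2
      cache := none
      errs := 0
      k := s.k + 1
      noisyThr := p.L + coins.1 }
  else
    { s with cache := cache, errs := errs }

/-- The state of DP-Winnow after `t` rounds on the sequence `S` of labelled examples. -/
noncomputable def winnowState {n T : ℕ} [NeZero n] (p : WinnowParams)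
    (S : Fin T → (Fin n → Bool) × Bool) (ω : Coins p.m T) : ℕ → WinnowState n
  | 0 => WinnowState.init n p ω.1
  | t + 1 =>
    if h : t < T then winnowStep p (winnowState p S ω t) (S ⟨t, h⟩) (ω.2 ⟨t, h⟩)
    else winnowState p S ω t

/-- DP-Winnow: the sequence of weight vectors that it outputs in rounds `1, …, T`, as a function of
the sequence of labelled examples and of the coins. -/
noncomputable def dpWinnow {n T : ℕ} [NeZero n] (p : WinnowParams)
    (S : Fin T → (Fin n → Bool) × Bool) (ω : Coins p.m T) : Fin T → Fin n → ℝ :=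
  fun t => (winnowState p S ω t).wTilde

/-- The tuning of DP-Winnow in dimension `n` for margin `ρ`; `cm` is the constant in the number of
samples. -/
def IsWinnowTuning (cm : ℝ) (n T : ℕ) (ρ ε δ β : ℝ) (p : WinnowParams) : Prop :=
  0 < p.η ∧ p.η < ρ ∧
  p.m = ⌈cm * Real.log (2 * T / β) / ρ ^ 2⌉₊ ∧
  p.K = 2 * Real.log n / (p.η * ρ - p.η ^ 2) ∧
  p.epsHat = ε / (4 * √(2 * p.K * Real.log (2 / δ))) ∧
  p.η = ε / (8 * √(2 * p.m * p.K * Real.log (4 * p.K / δ))) ∧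
  p.L = 8 * Real.log (2 * T / β) / p.epsHat

/-! ## Private online learning -/

/-- `(ε, δ)`-differential privacy against an oblivious adversary of a randomized online learner `M`,
which maps a sequence of `T` labelled examples and random coins to a sequence of hypotheses. -/
def IsDPLearner {X H Ω : Type*} [MeasurableSpace Ω] {T : ℕ} (P : Measure Ω)
    (M : (Fin T → X × Bool) → Ω → Fin T → H) (ε δ : ℝ) : Prop :=
  ∀ S S' : Fin T → X × Bool, (∃ τ, ∀ t, t ≠ τ → S t = S' t) →
    ∀ R : Set (Fin T → H),
      P {ω | M S ω ∈ R} ≤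
        ENNReal.ofReal (Real.exp ε) * P {ω | M S' ω ∈ R} + ENNReal.ofReal δ

/-- `x ∈ {-1, 1}ᵈ` is extended by a constant coordinate `1`, and the coordinates are doubled:
`z = (x, 1, -x, -1)`. -/
def expand {d : ℕ} (x : Fin d → Bool) : Fin ((d + 1) + (d + 1)) → Bool :=
  Fin.append (Fin.snoc x true : Fin (d + 1) → Bool)
    (fun i => !(Fin.snoc x true : Fin (d + 1) → Bool) i)

/-- DP-Winnow as a learner over `{-1, 1}ᵈ`: it is run on the expanded examples. -/
noncomputable def listLearner {d T : ℕ} (p : WinnowParams) (S : Fin T → (Fin d → Bool) × Bool)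
    (ω : Coins p.m T) : Fin T → Fin ((d + 1) + (d + 1)) → ℝ :=
  dpWinnow p (fun t => (expand (S t).1, (S t).2)) ω

/-- The number of prediction errors of that learner: the hypothesis of round `t` is
`x ↦ sgn ⟨w̃⁽ᵗ⁾, expand x⟩`. -/
noncomputable def predictionErrors {d T : ℕ} (p : WinnowParams)
    (S : Fin T → (Fin d → Bool) × Bool) (ω : Coins p.m T) : ℕ :=
  (Finset.univ.filter fun t : Fin T =>
    halfspace (listLearner p S ω t) (expand (S t).1) ≠ (S t).2).card

/-- The leading term `r^{6D} log³ d · log^{5/2}(T/β) · log²(1/δ) / ε⁴` of the mistake bound, with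
`d + 1` and `2/δ` in the logarithms that would otherwise vanish for `d = 1` and `δ → 1`. -/
noncomputable def listRate (r D d T : ℕ) (ε δ β : ℝ) : ℝ :=
  (r : ℝ) ^ (6 * D) * Real.log (d + 1) ^ 3 * Real.log (T / β) ^ (5 / 2 : ℝ) *
    Real.log (2 / δ) ^ 2 / ε ^ 4

/-! ## The Laplace distribution -/

/-! A run is encoded by its transcript: for each round, either no update or the tuple of sampled
indices. Given the examples, the transcript determines the whole state except the noisy threshold
(`winnowState_eq`), and it occurs exactly when the AboveThreshold noise lies in one event and the
sampling coins lie in a box (`transcript_eq_iff`). These two families of coins are independent, so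
its probability is `noiseProb` times `samplingProb`, and neighbouring inputs are compared factor by
factor.

Privacy. The released vectors are functions of the transcript alone. Hence, for a fixed transcript,
the two runs have equal error counts and equal caches as soon as the epoch containing the differing
example is over: only one AboveThreshold instance is affected, and nothing has to be composed over
epochs. Raising its threshold noise by 1 and the query noise of its last round by 2 maps one noise
event into the other, at the price `e^{ε̂/2 + 2ε̂/4}` (`noiseProb_le`). Likewise at most one update
uses different examples, so the private weights stay `e^{4η}`-close in Hilbert's projective metric,
which common updates preserve (`near_nextWeights`). Each sample then multiplies the `α`-th moment of
the likelihood ratio by at most `exp((α+1/2)²(4η)²/2)` (`sum_mul_rpow_div_le`); there are `m`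
samples in each of fewer than `K + 1` updates, and a supermartingale along the transcript bounds the
total (`sum_likelihood_rpow_le`). Markov's inequality turns the moment into `(ε, δ)`
(`dpWinnow_measure_le`).

Mistakes. A decision list is turned into a halfspace from the last rule backwards; only a change of
the output bit forces a weight larger than the whole norm so far, so the margin is at least `1/(2
r^D)` (`exists_margin_weights`). If no Laplace variable is large and no sampled vector loses a
margin of `ρ`, every cached example has private margin at most `ρ`. Each update then raises the
potential `∑ w₀ log w` by at least `ηρ - η²`; it starts at `-log n` and is never positive, so there
are at most `K/2` updates and the cap `K` never blocks one. Concentration of the noise bounds the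
errors per epoch by `14λ/ε̂ + 1` with `λ = log(2T/β)` (`MistakeInvariant.cons`).

Tuning. The equation for `η` is implicit, since `K` depends on `η`; it is solved by the intermediate
value theorem (`exists_isWinnowTuning`). Eliminating `η` bounds `K` by a multiple of `log(4K/δ)`;
`log_four_mul_div_le` resolves this self-reference, and `Kλ√(K log(2/δ))/ε` becomes the stated rate.
-/

theorem laplace_Ioi {b a : ℝ} (hb : 0 < b) (ha : 0 ≤ a) :
    laplace b (Set.Ioi a) = ENNReal.ofReal (Real.exp (-a / b) / 2) := by
  have hneg : -(1 / b) < 0 := by simpa using hb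
  have hint := integrableOn_exp_mul_Ioi hneg a
  have hval := integral_exp_mul_Ioi hneg a
  rw [laplace, withDensity_apply _ measurableSet_Ioi]
  have h1 : ∫⁻ x in Set.Ioi a, ENNReal.ofReal (Real.exp (-|x| / b) / (2 * b)) =
      ∫⁻ x in Set.Ioi a, ENNReal.ofReal (Real.exp (-(1 / b) * x) / (2 * b)) := by
    refine setLIntegral_congr_fun measurableSet_Ioi fun x hx => ?_
    have hx' : 0 < x := lt_of_le_of_lt ha hx
    simp only [abs_of_pos hx']
    congr 3
    ring
  rw [h1, ← ofReal_integral_eq_lintegral_ofReal (hint.div_const _)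
    (Filter.Eventually.of_forall fun x => by positivity), integral_div, hval]
  congr 1
  have : -(1 / b) * a = -a / b := by ring
  rw [this]
  field_simp

theorem laplace_Iic {b a : ℝ} (hb : 0 < b) (ha : a ≤ 0) :
    laplace b (Set.Iic a) = ENNReal.ofReal (Real.exp (a / b) / 2) := by
  have hpos : 0 < 1 / b := by simpa using hb
  have hint := integrableOn_exp_mul_Iic hpos a
  have hval := integral_exp_mul_Iic hpos a
  rw [laplace, withDensity_apply _ measurableSet_Iic]
  have h1 : ∫⁻ x in Set.Iic a, ENNReal.ofReal (Real.exp (-|x| / b) / (2 * b)) =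
      ∫⁻ x in Set.Iic a, ENNReal.ofReal (Real.exp ((1 / b) * x) / (2 * b)) := by
    refine setLIntegral_congr_fun measurableSet_Iic fun x hx => ?_
    have hx' : x ≤ 0 := le_trans hx ha
    simp only [abs_of_nonpos hx']
    congr 3
    ring
  rw [h1, ← ofReal_integral_eq_lintegral_ofReal (hint.div_const _)
    (Filter.Eventually.of_forall fun x => by positivity), integral_div, hval]
  congr 1
  have : (1 / b) * a = a / b := by ring
  rw [this]
  field_simp

theorem isProbabilityMeasure_laplace {b : ℝ} (hb : 0 < b) : IsProbabilityMeasure (laplace b) := by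
  constructor
  rw [← Set.Iic_union_Ioi (a := (0 : ℝ)), measure_union (by
    rw [Set.disjoint_left]; intro x hx hx'; exact not_lt.2 (Set.mem_Iic.1 hx) hx') measurableSet_Ioi,
    laplace_Ioi hb le_rfl, laplace_Iic hb le_rfl, ← ENNReal.ofReal_add (by positivity) (by positivity)]
  norm_num

theorem laplace_abs_gt_le {b a : ℝ} (hb : 0 < b) (ha : 0 ≤ a) :
    laplace b {x | a < |x|} ≤ ENNReal.ofReal (Real.exp (-a / b)) := by
  have hsub : {x : ℝ | a < |x|} ⊆ Set.Iic (-a) ∪ Set.Ioi a := by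
    intro x hx
    rcases lt_abs.1 (show a < |x| from hx) with h | h
    · exact Or.inr h
    · exact Or.inl (by simp only [Set.mem_Iic]; linarith)
  refine (measure_mono hsub).trans ((measure_union_le _ _).trans ?_)
  rw [laplace_Ioi hb ha, laplace_Iic hb (by linarith), ← ENNReal.ofReal_add (by positivity)
    (by positivity)]
  apply le_of_eq
  congr 1
  ring

/-! ### Shifted Laplace noise and domination of product measures -/

theorem laplace_map_add_le {b : ℝ} (hb : 0 < b) (h : ℝ) :
    (laplace b).map (fun x => x + h) ≤ ENNReal.ofReal (Real.exp (|h| / b)) • laplace b := by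
  refine Measure.le_iff.2 fun s hs => ?_
  have hmeas : Measurable fun x : ℝ => ENNReal.ofReal (Real.exp (-|x| / b) / (2 * b)) := by fun_prop
  have hadd : Measurable fun x : ℝ => x + h := measurable_add_const h
  rw [Measure.map_apply hadd hs, Measure.smul_apply, smul_eq_mul, laplace,
    withDensity_apply _ (hadd hs), withDensity_apply _ hs, ← lintegral_indicator (hadd hs),
    ← lintegral_indicator hs,
    ← lintegral_const_mul _ (hmeas.indicator hs)]
  have hshift : ∫⁻ x, (((fun x : ℝ => x + h) ⁻¹' s).indicator
        fun x => ENNReal.ofReal (Real.exp (-|x| / b) / (2 * b))) x =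
      ∫⁻ x, (s.indicator fun x => ENNReal.ofReal (Real.exp (-|x - h| / b) / (2 * b))) x := by
    rw [← lintegral_add_right_eq_self (fun x => (s.indicator
      fun x => ENNReal.ofReal (Real.exp (-|x - h| / b) / (2 * b))) x) h]
    refine lintegral_congr fun x => ?_
    by_cases hx : x + h ∈ s
    · rw [Set.indicator_of_mem hx, Set.indicator_of_mem (show x ∈ _ from hx), add_sub_cancel_right]
    · rw [Set.indicator_of_notMem hx, Set.indicator_of_notMem (show x ∉ _ from hx)]
  rw [hshift]
  refine lintegral_mono fun x => ?_
  by_cases hx : x ∈ s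
  · simp only [Set.indicator_of_mem hx]
    rw [← ENNReal.ofReal_mul (Real.exp_pos _).le, ← mul_div_assoc, ← Real.exp_add]
    refine ENNReal.ofReal_le_ofReal ?_
    gcongr
    rw [← add_div]
    gcongr
    have := abs_sub_abs_le_abs_sub x (x - h)
    have h2 : x - (x - h) = h := by ring
    rw [h2] at this
    linarith
  · simp [Set.indicator_of_notMem hx]

/-- Comparison on boxes suffices, because the product measure comes from the largest outer measure
that is at most the product of the factors on every box. -/
theorem pi_le_smul_pi {ι : Type*} [Fintype ι] {X : ι → Type*} [∀ i, MeasurableSpace (X i)]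
    (μ ν : ∀ i, Measure (X i)) [∀ i, SigmaFinite (μ i)] [∀ i, IsFiniteMeasure (ν i)]
    (c : ι → ENNReal) (hc : ∀ i, c i ≠ ⊤) (h : ∀ i, μ i ≤ c i • ν i) :
    Measure.pi μ ≤ (∏ i, c i) • Measure.pi ν := by
  have hsf : ∀ i, IsFiniteMeasure (c i • ν i) := fun i => Measure.smul_finite _ (hc i)
  have hsmul : (∏ i, c i) • Measure.pi ν = Measure.pi fun i => c i • ν i := by
    refine (Measure.pi_eq fun s _ => ?_).symm
    simp [Finset.prod_mul_distrib]
  rw [hsmul]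
  have hle : (Measure.pi μ).toOuterMeasure ≤
      OuterMeasure.pi fun i => (c i • ν i).toOuterMeasure := by
    rw [OuterMeasure.le_pi]
    intro s _
    change Measure.pi μ (Set.pi Set.univ s) ≤ ∏ i, (c i • ν i) (s i)
    rw [Measure.pi_pi]
    exact Finset.prod_le_prod' fun i _ => h i (s i)
  refine Measure.le_iff.2 fun s hs => ?_
  refine (hle s).trans ?_
  rw [Measure.pi_def, toMeasure_apply _ _ hs]

theorem pi_laplace_map_add_le {ι : Type*} [Fintype ι] {b : ℝ} (hb : 0 < b) (h : ι → ℝ) :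
    (Measure.pi fun _ : ι => laplace b).map (fun x i => x i + h i) ≤
      ENNReal.ofReal (Real.exp ((∑ i, |h i|) / b)) • Measure.pi fun _ : ι => laplace b := by
  have := isProbabilityMeasure_laplace hb
  have hp : ∀ i, IsProbabilityMeasure ((laplace b).map fun x => x + h i) := fun i =>
    Measure.isProbabilityMeasure_map (measurable_add_const _).aemeasurable
  rw [Measure.pi_map_pi (f := fun i x => x + h i) fun i => (measurable_add_const _).aemeasurable]
  refine (pi_le_smul_pi _ _ (fun i => ENNReal.ofReal (Real.exp (|h i| / b)))
    (fun i => ENNReal.ofReal_ne_top) fun i => laplace_map_add_le hb (h i)).trans (le_of_eq ?_)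
  rw [← ENNReal.ofReal_prod_of_nonneg fun i _ => (Real.exp_pos _).le, ← Real.exp_sum,
    Finset.sum_div]

theorem prod_map_le_smul {X Y : Type*} [MeasurableSpace X] [MeasurableSpace Y] {μ : Measure X}
    {ν : Measure Y} [SFinite μ] [SFinite ν] {f : X → X} {g : Y → Y} (hf : Measurable f)
    (hg : Measurable g) {c c' : ENNReal} (h : μ.map f ≤ c • μ) (h' : ν.map g ≤ c' • ν) :
    (μ.prod ν).map (Prod.map f g) ≤ (c * c') • μ.prod ν := by
  rw [← Measure.map_prod_map _ _ hf hg]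
  refine (Measure.prod_mono h h').trans (le_of_eq ?_)
  rw [Measure.prod_smul_left, Measure.prod_smul_right, smul_smul]

/-! ## The coins of AboveThreshold and the coins of the sampling -/

/-- The noise of all AboveThreshold instances: the threshold noises, then the query noises. -/
abbrev Noise (T : ℕ) : Type := (ℝ × (Fin T → ℝ)) × (Fin T → ℝ)

noncomputable def noiseMeasure (e : ℝ) (T : ℕ) : Measure (Noise T) :=
  ((laplace (2 / e)).prod (Measure.pi fun _ : Fin T => laplace (2 / e))).prod
    (Measure.pi fun _ : Fin T => laplace (4 / e))

noncomputable def samplingMeasure (m T : ℕ) : Measure (Fin T → Fin m → ℝ) :=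
  Measure.pi fun _ : Fin T => Measure.pi fun _ : Fin m => uniform01

def Coins.noise {m T : ℕ} (ω : Coins m T) : Noise T :=
  ((ω.1, fun t => (ω.2 t).1), fun t => (ω.2 t).2.1)

def Coins.sampling {m T : ℕ} (ω : Coins m T) : Fin T → Fin m → ℝ := fun t => (ω.2 t).2.2

instance : IsProbabilityMeasure uniform01 := ⟨by simp [uniform01]⟩

instance (m T : ℕ) : IsProbabilityMeasure (samplingMeasure m T) := by
  unfold samplingMeasure; infer_instance

theorem isProbabilityMeasure_noiseMeasure {e : ℝ} (he : 0 < e) (T : ℕ) :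
    IsProbabilityMeasure (noiseMeasure e T) := by
  have := isProbabilityMeasure_laplace (b := 2 / e) (by positivity)
  have := isProbabilityMeasure_laplace (b := 4 / e) (by positivity)
  unfold noiseMeasure; infer_instance

/-- Regrouping the coins, from round by round to kind by kind, makes the independence of
AboveThreshold noise and sampling available as a product measure. -/
theorem measurePreserving_noise_sampling (p : WinnowParams) (he : 0 < p.epsHat) (T : ℕ) :
    MeasurePreserving (fun ω : Coins p.m T => (ω.noise, ω.sampling)) (coinMeasure p T)
      ((noiseMeasure p.epsHat T).prod (samplingMeasure p.m T)) := by
  have := isProbabilityMeasure_laplace (b := 2 / p.epsHat) (by positivity)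
  have := isProbabilityMeasure_laplace (b := 4 / p.epsHat) (by positivity)
  have h1 := measurePreserving_arrowProdEquivProdArrow ℝ (ℝ × (Fin p.m → ℝ)) (Fin T)
    (fun _ => laplace (2 / p.epsHat))
    (fun _ => (laplace (4 / p.epsHat)).prod (Measure.pi fun _ : Fin p.m => uniform01))
  have h2 := measurePreserving_arrowProdEquivProdArrow ℝ (Fin p.m → ℝ) (Fin T)
    (fun _ => laplace (4 / p.epsHat)) (fun _ => Measure.pi fun _ : Fin p.m => uniform01)
  have h3 := (MeasurePreserving.id (Measure.pi fun _ : Fin T => laplace (2 / p.epsHat))).prod h2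
  have h4 := (MeasurePreserving.id (laplace (2 / p.epsHat))).prod (h3.comp h1)
  have h5 := (measurePreserving_prodAssoc (laplace (2 / p.epsHat))
    (Measure.pi fun _ : Fin T => laplace (2 / p.epsHat))
    ((Measure.pi fun _ : Fin T => laplace (4 / p.epsHat)).prod (samplingMeasure p.m T))).symm
  have h6 := (measurePreserving_prodAssoc ((laplace (2 / p.epsHat)).prod
    (Measure.pi fun _ : Fin T => laplace (2 / p.epsHat)))
    (Measure.pi fun _ : Fin T => laplace (4 / p.epsHat)) (samplingMeasure p.m T)).symm
  exact h6.comp (h5.comp h4)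

theorem isProbabilityMeasure_coinMeasure (p : WinnowParams) (he : 0 < p.epsHat) (T : ℕ) :
    IsProbabilityMeasure (coinMeasure p T) := by
  have := isProbabilityMeasure_laplace (b := 2 / p.epsHat) (by positivity)
  have := isProbabilityMeasure_laplace (b := 4 / p.epsHat) (by positivity)
  unfold coinMeasure; infer_instance

theorem coinMeasure_noise_inter_sampling (p : WinnowParams) (he : 0 < p.epsHat) {T : ℕ}
    {A : Set (Noise T)} {V : Set (Fin T → Fin p.m → ℝ)} (hA : MeasurableSet A)
    (hV : MeasurableSet V) :
    coinMeasure p T {ω | ω.noise ∈ A ∧ ω.sampling ∈ V} =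
      noiseMeasure p.epsHat T A * samplingMeasure p.m T V := by
  have := isProbabilityMeasure_noiseMeasure he T
  rw [← Measure.prod_prod, ← (measurePreserving_noise_sampling p he T).measure_preimage
    (hA.prod hV).nullMeasurableSet]
  rfl

theorem coinMeasure_noise (p : WinnowParams) (he : 0 < p.epsHat) {T : ℕ}
    {A : Set (Noise T)} (hA : MeasurableSet A) :
    coinMeasure p T {ω | ω.noise ∈ A} = noiseMeasure p.epsHat T A := by
  simpa using coinMeasure_noise_inter_sampling p he hA MeasurableSet.univ

/-- Shifting the noise costs `e^{ε̂/2}` per unit of threshold and `e^{ε̂/4}` per unit of query. -/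
theorem noiseMeasure_preimage_add_le {e : ℝ} (he : 0 < e) {T : ℕ} (h : Noise T)
    {A : Set (Noise T)} (hA : MeasurableSet A) :
    noiseMeasure e T {x | x + h ∈ A} ≤
      ENNReal.ofReal (Real.exp (e * ((|h.1.1| + ∑ t, |h.1.2 t|) / 2 + (∑ t, |h.2 t|) / 4))) *
        noiseMeasure e T A := by
  have := isProbabilityMeasure_laplace (b := 2 / e) (by positivity)
  have := isProbabilityMeasure_laplace (b := 4 / e) (by positivity)
  have h1 := laplace_map_add_le (b := 2 / e) (by positivity) h.1.1
  have h2 := pi_laplace_map_add_le (b := 2 / e) (by positivity) h.1.2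
  have h3 := pi_laplace_map_add_le (b := 4 / e) (by positivity) h.2
  have hm : ∀ g : Fin T → ℝ, Measurable fun (x : Fin T → ℝ) i => x i + g i := fun g => by fun_prop
  have h4 := prod_map_le_smul ((measurable_add_const h.1.1).prodMap (hm _)) (hm _)
    (prod_map_le_smul (measurable_add_const h.1.1) (hm _) h1 h2) h3
  have h5 := h4 A
  rw [Measure.map_apply (((measurable_add_const h.1.1).prodMap (hm _)).prodMap (hm _)) hA,
    ← ENNReal.ofReal_mul (Real.exp_pos _).le, ← ENNReal.ofReal_mul (by positivity),
    ← Real.exp_add, ← Real.exp_add] at h5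
  refine le_trans (le_of_eq rfl) (h5.trans (le_of_eq ?_))
  rw [Measure.smul_apply, smul_eq_mul, noiseMeasure]
  congr 4
  field_simp

/-! ## Inverse transform sampling -/

theorem sampleIndex_eq_iff {n : ℕ} [NeZero n] (w : Fin n → ℝ) (u : ℝ) (j : Fin n) :
    sampleIndex w u = j ↔
      (u ≤ ∑ i ∈ Finset.Iic j, w i ∧ ∀ k < j, ∑ i ∈ Finset.Iic k, w i < u) ∨
        ((∀ k, ∑ i ∈ Finset.Iic k, w i < u) ∧ j = 0) := by
  unfold sampleIndex
  split_ifs with h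
  · have hne := h
    obtain ⟨i, hi⟩ := hne
    have hi' : u ≤ ∑ l ∈ Finset.Iic i, w l := by simpa using hi
    rw [Finset.min'_eq_iff]
    simp only [Finset.mem_filter, Finset.mem_univ, true_and]
    constructor
    · rintro ⟨h1, h2⟩
      exact Or.inl ⟨h1, fun k hk => lt_of_not_ge fun hle => absurd (h2 k hle) (not_le.2 hk)⟩
    · rintro (⟨h1, h2⟩ | ⟨h1, -⟩)
      · exact ⟨h1, fun k hk => not_lt.1 fun hlt => absurd (h2 k hlt) (not_lt.2 hk)⟩
      · exact absurd (h1 i) (not_lt.2 hi')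
  · have h' : ∀ k, ∑ i ∈ Finset.Iic k, w i < u := by
      simpa [Finset.not_nonempty_iff_eq_empty, Finset.filter_eq_empty_iff] using h
    constructor
    · intro hj
      exact Or.inr ⟨h', hj.symm⟩
    · rintro (⟨h1, -⟩ | ⟨-, h2⟩)
      · exact absurd (h' j) (not_lt.2 h1)
      · exact h2.symm

theorem measurableSet_sampleIndex {n : ℕ} [NeZero n] (w : Fin n → ℝ) (j : Fin n) :
    MeasurableSet {u | sampleIndex w u = j} := by
  simp only [sampleIndex_eq_iff]
  measurability

theorem uniform01_sampleIndex {n : ℕ} [NeZero n] {w : Fin n → ℝ} (hw : ∀ i, 0 ≤ w i)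
    (hsum : ∑ i, w i = 1) (j : Fin n) :
    uniform01 {u | sampleIndex w u = j} = ENNReal.ofReal (w j) := by
  have hmono : ∀ s t : Finset (Fin n), s ⊆ t → ∑ i ∈ s, w i ≤ ∑ i ∈ t, w i := fun s t hst =>
    Finset.sum_le_sum_of_subset_of_nonneg hst fun i _ _ => hw i
  have hset : {u | sampleIndex w u = j} ∩ Set.Ioc 0 1 =
      Set.Ioc (∑ i ∈ Finset.Iio j, w i) (∑ i ∈ Finset.Iic j, w i) := by
    ext u
    simp only [Set.mem_inter_iff, Set.mem_ofPred_eq, Set.mem_Ioc, sampleIndex_eq_iff]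
    constructor
    · rintro ⟨⟨h1, h2⟩ | ⟨h1, -⟩, h0, h3⟩
      · refine ⟨?_, h1⟩
        rcases (Finset.Iio j).eq_empty_or_nonempty with he | hne
        · simpa [he] using h0
        · have hk := (Finset.Iio j).max'_mem hne
          have : Finset.Iio j = Finset.Iic ((Finset.Iio j).max' hne) := by
            ext i
            simp only [Finset.mem_Iio, Finset.mem_Iic]
            constructor
            · intro hi
              exact Finset.le_max' _ _ (Finset.mem_Iio.2 hi)
            · intro hi
              exact lt_of_le_of_lt hi (Finset.mem_Iio.1 hk)
          rw [this]
          exact h2 _ (Finset.mem_Iio.1 hk)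
      -- The fallback value `0` of `sampleIndex` is never used on `(0, 1]`: the last partial sum is
      -- `1`.
      · have := h1 ⊤
        rw [Finset.Iic_top, hsum] at this
        exact absurd h3 (not_le.2 this)
    · rintro ⟨h1, h2⟩
      refine ⟨Or.inl ⟨h2, fun k hk => lt_of_le_of_lt (hmono _ _ ?_) h1⟩, lt_of_le_of_lt ?_ h1,
        h2.trans ?_⟩
      · intro i hi
        exact Finset.mem_Iio.2 (lt_of_le_of_lt (Finset.mem_Iic.1 hi) hk)
      · exact Finset.sum_nonneg fun i _ => hw i
      · rw [← hsum]
        exact hmono _ _ (Finset.subset_univ _)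
  rw [uniform01, Measure.restrict_apply' measurableSet_Ioc, hset, Real.volume_Ioc]
  congr 1
  have : Finset.Iic j = insert j (Finset.Iio j) := by
    ext i
    simp [le_iff_eq_or_lt]
  rw [this, Finset.sum_insert (by simp)]
  ring

/-! ## Multiplicative weights -/

/-- Positive probability vectors. -/
def IsPosProb {n : ℕ} (w : Fin n → ℝ) : Prop := (∀ i, 0 < w i) ∧ ∑ i, w i = 1

theorem isPosProb_uniform {n : ℕ} [NeZero n] : IsPosProb fun _ : Fin n => (1 / n : ℝ) := by
  have : (0 : ℝ) < n := Nat.cast_pos.2 (NeZero.pos n)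
  refine ⟨fun _ => by positivity, ?_⟩
  simp

theorem IsPosProb.le_one {n : ℕ} {w : Fin n → ℝ} (h : IsPosProb w) (i : Fin n) : w i ≤ 1 := by
  rw [← h.2]
  exact Finset.single_le_sum (fun i _ => (h.1 i).le) (Finset.mem_univ i)

theorem IsPosProb.sum_mul_exp_pos {n : ℕ} [NeZero n] {w : Fin n → ℝ} (h : IsPosProb w)
    (f : Fin n → ℝ) : 0 < ∑ i, w i * Real.exp (f i) :=
  Finset.sum_pos (fun i _ => mul_pos (h.1 i) (Real.exp_pos _)) Finset.univ_nonempty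

theorem IsPosProb.mwUpdate {n : ℕ} [NeZero n] {w : Fin n → ℝ} (h : IsPosProb w) (η : ℝ)
    (e : (Fin n → Bool) × Bool) : IsPosProb (mwUpdate η w e) := by
  have hZ := h.sum_mul_exp_pos fun i => η * pmOne e.2 * pmOne (e.1 i)
  refine ⟨fun i => mul_pos (div_pos (Real.exp_pos _) hZ) (h.1 i), ?_⟩
  unfold _root_.mwUpdate
  have : ∀ j, Real.exp (η * pmOne e.2 * pmOne (e.1 j)) /
      (∑ i, w i * Real.exp (η * pmOne e.2 * pmOne (e.1 i))) * w j =
      (w j * Real.exp (η * pmOne e.2 * pmOne (e.1 j))) /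
        (∑ i, w i * Real.exp (η * pmOne e.2 * pmOne (e.1 i))) := fun j => by ring
  simp_rw [this]
  rw [← Finset.sum_div, div_self hZ.ne']

/-! ## Transcripts -/

/-- What is observed in one round: no update, or an update with the given sampled indices. -/
abbrev Observation (m n : ℕ) : Type := Option (Fin m → Fin n)

/-- The empirical frequencies of a sequence of indices. -/
noncomputable def frequencies {m n : ℕ} (v : Fin m → Fin n) : Fin n → ℝ := fun j =>
  (1 / m : ℝ) * ((Finset.univ.filter fun i : Fin m => v i = j).card : ℝ)

theorem sampledWeights_eq {m n : ℕ} [NeZero n] (w : Fin n → ℝ) (u : Fin m → ℝ) :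
    sampledWeights w u = frequencies fun i => sampleIndex w (u i) := rfl

namespace WinnowState

/-- The state after the example `e` has been recorded if it was misclassified. -/
noncomputable def record {n : ℕ} (s : WinnowState n) (e : (Fin n → Bool) × Bool) : WinnowState n :=
  open Classical in
  { s with
    cache := if halfspace s.wTilde e.1 ≠ e.2 then s.cache.or (some e) else s.cache
    errs := if halfspace s.wTilde e.1 ≠ e.2 then s.errs + 1 else s.errs }

/-- The private weights after an update with the cached example. -/
noncomputable def nextWeights {n : ℕ} (η : ℝ) (s : WinnowState n) : Fin n → ℝ :=
  s.cache.elim s.w (mwUpdate η s.w)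

end WinnowState

theorem winnowStep_eq {n : ℕ} [NeZero n] (p : WinnowParams) (s : WinnowState n)
    (e : (Fin n → Bool) × Bool) (coins : ℝ × ℝ × (Fin p.m → ℝ)) :
    winnowStep p s e coins =
      open Classical in
      if s.noisyThr ≤ (s.record e).errs + coins.2.1 ∧ (s.k : ℝ) < p.K then
        { w := (s.record e).nextWeights p.η
          wTilde := sampledWeights ((s.record e).nextWeights p.η) coins.2.2
          cache := none
          errs := 0
          k := s.k + 1
          noisyThr := p.L + coins.1 }
      else s.record e := by
  rfl

section Transcript

variable {n : ℕ} (p : WinnowParams) (S : ℕ → (Fin n → Bool) × Bool)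

/-- The state of DP-Winnow as a function of the transcript, the newest observation coming first;
the threshold is the noise-free one. -/
noncomputable def detState : List (Observation p.m n) → WinnowState n
  | [] => WinnowState.init n p 0
  | none :: l => (detState l).record (S l.length)
  | some v :: l =>
    { w := ((detState l).record (S l.length)).nextWeights p.η
      wTilde := frequencies v
      cache := none
      errs := 0
      k := (detState l).k + 1
      noisyThr := p.L }

/-- The weights from which the next round samples if it performs an update. -/
noncomputable def nextWeights (l : List (Observation p.m n)) : Fin n → ℝ :=
  ((detState p S l).record (S l.length)).nextWeights p.η

/-- The index of the threshold noise in use after the transcript `l`. -/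
def thrIndex {m n : ℕ} : List (Observation m n) → Option ℕ
  | [] => none
  | none :: l => thrIndex l
  | some _ :: l => some l.length

namespace Noise

def thr {T : ℕ} (x : Noise T) : Option ℕ → ℝ
  | none => x.1.1
  | some s => if h : s < T then x.1.2 ⟨s, h⟩ else 0

def query {T : ℕ} (x : Noise T) (s : ℕ) : ℝ := if h : s < T then x.2 ⟨s, h⟩ else 0

theorem measurable_thr {T : ℕ} (i : Option ℕ) : Measurable fun x : Noise T => x.thr i := by
  rcases i with _ | s
  · exact measurable_fst.comp measurable_fst
  · by_cases h : s < T
    · simp only [thr, h, dite_true]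
      fun_prop
    · simp only [thr, h, dite_false]
      fun_prop

theorem measurable_query {T : ℕ} (s : ℕ) : Measurable fun x : Noise T => x.query s := by
  by_cases h : s < T
  · simp only [query, h, dite_true]
    fun_prop
  · simp only [query, h, dite_false]
    fun_prop

end Noise

/-- The round after the transcript `l` performs an update. -/
def Fires {T : ℕ} (l : List (Observation p.m n)) (x : Noise T) : Prop :=
  p.L + x.thr (thrIndex l) ≤ ((detState p S l).record (S l.length)).errs + x.query l.length ∧
    ((detState p S l).k : ℝ) < p.K

/-- The event that the noise is consistent with the transcript. -/
def noiseEvent (T : ℕ) : List (Observation p.m n) → Set (Noise T)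
  | [] => Set.univ
  | o :: l => {x | x ∈ noiseEvent T l ∧ (Fires p S l x ↔ o.isSome)}

/-- The sampling coins of round `s` that are consistent with the transcript. -/
def samplingBox [NeZero n] : List (Observation p.m n) → ℕ → Set (Fin p.m → ℝ)
  | [] => fun _ => Set.univ
  | none :: l => samplingBox l
  | some v :: l => Function.update (samplingBox l) l.length
      (Set.pi Set.univ fun i => {u | sampleIndex (nextWeights p S l) u = v i})

/-- The probability that the sampling is consistent with the transcript. -/
noncomputable def samplingProb : List (Observation p.m n) → ℝ
  | [] => 1
  | none :: l => samplingProb l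
  | some v :: l => (∏ i, nextWeights p S l (v i)) * samplingProb l

open Classical in
/-- The transcript of the first rounds. -/
noncomputable def transcript [NeZero n] {T : ℕ} (ω : Coins p.m T) : ℕ → List (Observation p.m n)
  | 0 => []
  | t + 1 =>
    (if Fires p S (transcript ω t) ω.noise then
      some fun i => sampleIndex (nextWeights p S (transcript ω t))
        (if h : t < T then ω.sampling ⟨t, h⟩ i else 0)
    else none) :: transcript ω t

@[simp] theorem length_transcript [NeZero n] {T : ℕ} (ω : Coins p.m T) (t : ℕ) :
    (transcript p S ω t).length = t := by
  induction t with
  | zero => rfl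
  | succ t ih => simp [transcript, ih]

/-- A finite sequence of examples, extended arbitrarily. -/
def extendSeq {T : ℕ} (S : Fin T → (Fin n → Bool) × Bool) (t : ℕ) : (Fin n → Bool) × Bool :=
  if h : t < T then S ⟨t, h⟩ else (fun _ => true, true)

theorem extendSeq_of_lt {T : ℕ} (S : Fin T → (Fin n → Bool) × Bool) {t : ℕ} (h : t < T) :
    extendSeq S t = S ⟨t, h⟩ := by simp [extendSeq, h]

/-- The coins enter the state only through the transcript, apart from the current noisy threshold,
which is read off the noise at `thrIndex`. This allows all later arguments to run by induction on
lists. -/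
theorem winnowState_eq [NeZero n] {T : ℕ} (S : Fin T → (Fin n → Bool) × Bool) (ω : Coins p.m T) {t : ℕ}
    (ht : t ≤ T) :
    winnowState p S ω t = { detState p (extendSeq S) (transcript p (extendSeq S) ω t) with
      noisyThr := p.L + ω.noise.thr (thrIndex (transcript p (extendSeq S) ω t)) } := by
  induction t with
  | zero => simp [winnowState, transcript, detState, thrIndex, WinnowState.init, Noise.thr,
      Coins.noise]
  | succ t ih =>
    have htT : t < T := ht
    have hlen := length_transcript p (extendSeq S) ω t
    rw [winnowState, dif_pos htT, ih htT.le, winnowStep_eq, transcript]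
    set l := transcript p (extendSeq S) ω t with hl
    have hquery : (ω.2 ⟨t, htT⟩).2.1 = ω.noise.query l.length := by
      simp [Noise.query, Coins.noise, hlen, htT]
    have hS : S ⟨t, htT⟩ = extendSeq S l.length := by rw [hlen, extendSeq_of_lt S htT]
    rw [hquery, hS]
    by_cases hf : Fires p (extendSeq S) l ω.noise
    · have hf' := hf
      rw [if_pos hf', if_pos (by simpa [Fires, WinnowState.record] using hf)]
      simp [detState, thrIndex, Noise.thr, Coins.noise, Coins.sampling, hlen, htT,
        sampledWeights_eq, nextWeights, WinnowState.record, WinnowState.nextWeights]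
    · rw [if_neg hf, if_neg (by simpa [Fires, WinnowState.record] using hf)]
      simp [detState, thrIndex, WinnowState.record]

theorem isPosProb_detState [NeZero n] (l : List (Observation p.m n)) : IsPosProb (detState p S l).w := by
  induction l with
  | nil => exact isPosProb_uniform
  | cons o l ih =>
    rcases o with _ | v
    · exact ih
    · simp only [detState, WinnowState.nextWeights]
      rcases ((detState p S l).record (S l.length)).cache with _ | e
      · exact ih
      · exact IsPosProb.mwUpdate (w := (detState p S l).w) ih _ _

theorem isPosProb_nextWeights [NeZero n] (l : List (Observation p.m n)) : IsPosProb (nextWeights p S l) := by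
  unfold nextWeights WinnowState.nextWeights
  rcases ((detState p S l).record (S l.length)).cache with _ | e
  · exact isPosProb_detState p S l
  · exact IsPosProb.mwUpdate (isPosProb_detState p S l) _ _

theorem samplingProb_pos [NeZero n] (l : List (Observation p.m n)) : 0 < samplingProb p S l := by
  induction l with
  | nil => exact one_pos
  | cons o l ih =>
    rcases o with _ | v
    · exact ih
    · exact mul_pos (Finset.prod_pos fun i _ => (isPosProb_nextWeights p S l).1 _) ih

theorem measurableSet_noiseEvent (T : ℕ) (l : List (Observation p.m n)) :
    MeasurableSet (noiseEvent p S T l) := by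
  induction l with
  | nil => exact MeasurableSet.univ
  | cons o l ih =>
    have hf : MeasurableSet {x : Noise T | Fires p S l x} :=
      (measurableSet_le ((Noise.measurable_thr _).const_add _)
        ((Noise.measurable_query _).const_add _)).inter (MeasurableSet.const _)
    have hcons : noiseEvent p S T (o :: l) =
        noiseEvent p S T l ∩ {x | Fires p S l x ↔ o.isSome} := rfl
    rw [hcons]
    refine ih.inter ?_
    rcases o with _ | v
    · have : {x : Noise T | Fires p S l x ↔ (none : Observation p.m n).isSome} =
          {x | Fires p S l x}ᶜ := by
        ext x; simp
      rw [this]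
      exact hf.compl
    · have : {x : Noise T | Fires p S l x ↔ (some v : Observation p.m n).isSome} =
          {x | Fires p S l x} := by
        ext x; simp
      rw [this]
      exact hf

theorem samplingBox_of_length_le [NeZero n] (l : List (Observation p.m n)) {s : ℕ} (hs : l.length ≤ s) :
    samplingBox p S l s = Set.univ := by
  induction l with
  | nil => rfl
  | cons o l ih =>
    have h1 : l.length < s := hs
    rcases o with _ | v
    · exact ih h1.le
    · rw [samplingBox, Function.update_of_ne h1.ne']
      exact ih h1.le

theorem measurableSet_samplingBox [NeZero n] (l : List (Observation p.m n)) (s : ℕ) :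
    MeasurableSet (samplingBox p S l s) := by
  induction l with
  | nil => exact MeasurableSet.univ
  | cons o l ih =>
    rcases o with _ | v
    · exact ih
    · by_cases h : s = l.length
      · subst h
        rw [samplingBox, Function.update_self]
        exact MeasurableSet.univ_pi fun i => measurableSet_sampleIndex _ _
      · rw [samplingBox, Function.update_of_ne h]
        exact ih

/-- The coins of round `l.length` are unconstrained by `l`, so a new observation changes exactly one
factor of the product, from `1` to the probability of drawing `v` from the weights that `l`
determines. -/
theorem samplingMeasure_samplingBox [NeZero n] {T : ℕ} (l : List (Observation p.m n)) (hl : l.length ≤ T) :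
    samplingMeasure p.m T (Set.pi Set.univ fun s : Fin T => samplingBox p S l s) =
      ENNReal.ofReal (samplingProb p S l) := by
  induction l with
  | nil => simp [samplingBox, samplingProb]
  | cons o l ih =>
    have hlT : l.length < T := hl
    rcases o with _ | v
    · exact ih hlT.le
    · have ih' := ih hlT.le
      rw [samplingMeasure, Measure.pi_pi] at ih' ⊢
      have hw := isPosProb_nextWeights p S l
      rw [← Finset.mul_prod_erase _ _ (Finset.mem_univ (⟨l.length, hlT⟩ : Fin T))] at ih' ⊢
      have hrest : ∏ s ∈ Finset.univ.erase (⟨l.length, hlT⟩ : Fin T),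
          (Measure.pi fun _ : Fin p.m => uniform01) (samplingBox p S (some v :: l) s) =
          ∏ s ∈ Finset.univ.erase (⟨l.length, hlT⟩ : Fin T),
          (Measure.pi fun _ : Fin p.m => uniform01) (samplingBox p S l s) := by
        refine Finset.prod_congr rfl fun s hs => ?_
        have : (s : ℕ) ≠ l.length := fun h => Finset.ne_of_mem_erase hs (Fin.ext h)
        rw [samplingBox, Function.update_of_ne this]
      rw [samplingBox_of_length_le p S l le_rfl, measure_univ, one_mul] at ih'
      rw [hrest, ih', samplingProb]
      simp only [samplingBox, Function.update_self]
      rw [Measure.pi_pi, ENNReal.ofReal_mul (Finset.prod_nonneg fun i _ => (hw.1 _).le),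
        ENNReal.ofReal_prod_of_nonneg fun i _ => (hw.1 _).le]
      congr 1
      exact Finset.prod_congr rfl fun i _ =>
        uniform01_sampleIndex (fun i => (hw.1 i).le) hw.2 (v i)

/-- The weights and counters depend adaptively on earlier coins, but along a fixed transcript they
are constants; the constraints therefore separate into one on the noise and one on the sampling. -/
theorem transcript_eq_iff [NeZero n] {T : ℕ} (ω : Coins p.m T) (l : List (Observation p.m n))
    (hl : l.length ≤ T) :
    transcript p S ω l.length = l ↔ ω.noise ∈ noiseEvent p S T l ∧
      ω.sampling ∈ Set.pi Set.univ fun s : Fin T => samplingBox p S l s := by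
  induction l with
  | nil => simp [transcript, noiseEvent, samplingBox]
  | cons o l ih =>
    have hlT : l.length < T := hl
    rw [List.length_cons, transcript, List.cons.injEq, ih hlT.le]
    have key : ω.noise ∈ noiseEvent p S T l ∧
        ω.sampling ∈ (Set.pi Set.univ fun s : Fin T => samplingBox p S l s) →
        transcript p S ω l.length = l := (ih hlT.le).2
    rcases o with _ | v
    · constructor
      · rintro ⟨h1, h2⟩
        rw [key h2] at h1
        refine ⟨⟨h2.1, ?_⟩, h2.2⟩
        by_cases hf : Fires p S l ω.noise
        · simp [hf] at h1
        · simp [hf]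
      · rintro ⟨⟨h1, h2⟩, h3⟩
        rw [key ⟨h1, h3⟩]
        refine ⟨?_, h1, h3⟩
        simp only [Option.isSome_none, Bool.false_eq_true, iff_false] at h2
        rw [if_neg h2]
    · have hbox : (ω.sampling ∈ Set.pi Set.univ fun s : Fin T => samplingBox p S (some v :: l) s) ↔
          (∀ i, sampleIndex (nextWeights p S l) (ω.sampling ⟨l.length, hlT⟩ i) = v i) ∧
          ω.sampling ∈ Set.pi Set.univ fun s : Fin T => samplingBox p S l s := by
        simp only [Set.mem_pi, Set.mem_univ, true_imp_iff]
        constructor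
        · intro h
          constructor
          · have := h ⟨l.length, hlT⟩
            simpa [samplingBox] using this
          · intro s
            by_cases hs : (s : ℕ) = l.length
            · rw [hs, samplingBox_of_length_le p S l le_rfl]
              trivial
            · have := h s
              rwa [samplingBox, Function.update_of_ne hs] at this
        · rintro ⟨h1, h2⟩ s
          by_cases hs : (s : ℕ) = l.length
          · obtain rfl : s = ⟨l.length, hlT⟩ := Fin.ext hs
            simpa [samplingBox] using h1
          · rw [samplingBox, Function.update_of_ne hs]
            exact h2 s
      rw [hbox]
      constructor
      · rintro ⟨h1, h2⟩
        rw [key h2] at h1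
        by_cases hf : Fires p S l ω.noise
        · rw [if_pos hf, Option.some.injEq] at h1
          refine ⟨⟨h2.1, by simp [hf]⟩, fun i => ?_, h2.2⟩
          have := congrFun h1 i
          simpa [hlT] using this
        · simp [hf] at h1
      · rintro ⟨⟨h1, h2⟩, h3, h4⟩
        rw [key ⟨h1, h4⟩]
        refine ⟨?_, h1, h4⟩
        simp only [Option.isSome_some, iff_true] at h2
        rw [if_pos h2]
        congr 1
        funext i
        simpa [hlT] using h3 i

/-- All transcripts of `t` rounds. -/
def transcripts (m n : ℕ) : ℕ → Finset (List (Observation m n))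
  | 0 => {[]}
  | t + 1 => (transcripts m n t ×ˢ Finset.univ).map
      ⟨fun x => x.2 :: x.1, fun x y h => by
        simp only [List.cons.injEq] at h
        exact Prod.ext h.2 h.1⟩

theorem mem_transcripts {m n t : ℕ} {l : List (Observation m n)} :
    l ∈ transcripts m n t ↔ l.length = t := by
  induction t generalizing l with
  | zero => simp [transcripts]
  | succ t ih =>
    rcases l with _ | ⟨o, l⟩
    · simp [transcripts]
    · simp only [transcripts, Finset.mem_map, Finset.mem_product, Finset.mem_univ, and_true, ih,
        List.length_cons, add_left_inj]
      exact ⟨fun ⟨x, hx, h⟩ => (List.cons.inj h).2 ▸ hx, fun h => ⟨(l, o), h, rfl⟩⟩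

theorem sum_transcripts_succ {m n t : ℕ} (f : List (Observation m n) → ℝ) :
    ∑ l ∈ transcripts m n (t + 1), f l =
      ∑ l ∈ transcripts m n t, (f (none :: l) + ∑ v, f (some v :: l)) := by
  rw [transcripts, Finset.sum_map, Finset.sum_product]
  refine Finset.sum_congr rfl fun l _ => ?_
  rw [Fintype.sum_option]
  rfl

/-- The probability that the noise is consistent with the transcript. -/
noncomputable def noiseProb (T : ℕ) (l : List (Observation p.m n)) : ℝ :=
  (noiseMeasure p.epsHat T).real (noiseEvent p S T l)

theorem noiseProb_nonneg (T : ℕ) (l : List (Observation p.m n)) : 0 ≤ noiseProb p S T l :=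
  measureReal_nonneg

theorem noiseProb_nil (he : 0 < p.epsHat) (T : ℕ) :
    noiseProb p S T ([] : List (Observation p.m n)) = 1 := by
  have := isProbabilityMeasure_noiseMeasure he T
  simp [noiseProb, noiseEvent]

theorem noiseProb_cons (he : 0 < p.epsHat) (T : ℕ) (l : List (Observation p.m n))
    (v : Fin p.m → Fin n) :
    noiseProb p S T (none :: l) + noiseProb p S T (some v :: l) = noiseProb p S T l := by
  have := isProbabilityMeasure_noiseMeasure he T
  unfold noiseProb
  rw [← measureReal_union _ (measurableSet_noiseEvent p S T _)]
  · congr 1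
    ext x
    simp only [noiseEvent, Option.isSome_none, Option.isSome_some, Set.mem_union,
      Set.mem_ofPred_eq, iff_true, Bool.false_eq_true, iff_false]
    tauto
  · rw [Set.disjoint_left]
    simp only [noiseEvent, Option.isSome_none, Option.isSome_some,
      Set.mem_ofPred_eq, iff_true, Bool.false_eq_true, iff_false]
    tauto

/-! ### Measurability and law of the transcript -/

theorem measurable_noise {m T : ℕ} : Measurable fun ω : Coins m T => ω.noise := by
  unfold Coins.noise
  fun_prop

theorem measurable_sampling {m T : ℕ} : Measurable fun ω : Coins m T => ω.sampling := by
  unfold Coins.sampling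
  fun_prop

theorem measurableSet_transcript_eq [NeZero n] {T t : ℕ} (ht : t ≤ T) {l : List (Observation p.m n)}
    (hl : l.length = t) : MeasurableSet {ω : Coins p.m T | transcript p S ω t = l} := by
  subst hl
  simp only [transcript_eq_iff p S _ l ht]
  exact (measurable_noise (measurableSet_noiseEvent p S T l)).inter
    (measurable_sampling (MeasurableSet.univ_pi fun s => measurableSet_samplingBox p S l s))

theorem coinMeasure_transcript_eq [NeZero n] (he : 0 < p.epsHat) {T t : ℕ} (ht : t ≤ T)
    {l : List (Observation p.m n)} (hl : l.length = t) :
    coinMeasure p T {ω : Coins p.m T | transcript p S ω t = l} =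
      ENNReal.ofReal (noiseProb p S T l * samplingProb p S l) := by
  subst hl
  have := isProbabilityMeasure_noiseMeasure he T
  simp only [transcript_eq_iff p S _ l ht]
  rw [coinMeasure_noise_inter_sampling p he (measurableSet_noiseEvent p S T l)
    (MeasurableSet.univ_pi fun s => measurableSet_samplingBox p S l s),
    samplingMeasure_samplingBox p S l ht, ENNReal.ofReal_mul (noiseProb_nonneg p S T l), noiseProb,
    ofReal_measureReal]

open Classical in
/-- The distribution of the transcript. -/
theorem coinMeasure_transcript_mem [NeZero n] (he : 0 < p.epsHat) {T t : ℕ} (ht : t ≤ T)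
    (R : Set (List (Observation p.m n))) :
    coinMeasure p T {ω : Coins p.m T | transcript p S ω t ∈ R} =
      ENNReal.ofReal (∑ l ∈ (transcripts p.m n t).filter (· ∈ R),
        noiseProb p S T l * samplingProb p S l) := by
  have hset : {ω : Coins p.m T | transcript p S ω t ∈ R} =
      ⋃ l ∈ (transcripts p.m n t).filter (· ∈ R), {ω | transcript p S ω t = l} := by
    ext ω
    simp [mem_transcripts]
  rw [hset, measure_biUnion_finset]
  · rw [ENNReal.ofReal_sum_of_nonneg fun l _ =>
      mul_nonneg (noiseProb_nonneg p S T l) (samplingProb_pos p S l).le]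
    refine Finset.sum_congr rfl fun l hl => ?_
    exact coinMeasure_transcript_eq p S he ht (mem_transcripts.1 (Finset.mem_filter.1 hl).1)
  · intro l _ l' _ hne
    rw [Function.onFun, Set.disjoint_left]
    intro ω h h'
    exact hne ((show _ = _ from h).symm.trans h')
  · intro l hl
    exact measurableSet_transcript_eq p S ht (mem_transcripts.1 (Finset.mem_filter.1 hl).1)

end Transcript

/-! ## Closeness of weight vectors -/

theorem pmOne_mul_self (b : Bool) : pmOne b * pmOne b = 1 := by
  cases b <;> simp [pmOne]

theorem abs_pmOne (b : Bool) : |pmOne b| = 1 := by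
  cases b <;> simp [pmOne]

/-- The projective (Hilbert metric) closeness of two weight vectors. -/
def Near {n : ℕ} (c : ℝ) (w w' : Fin n → ℝ) : Prop := ∀ i j, w i * w' j ≤ c * (w j * w' i)

theorem Near.symm {n : ℕ} {c : ℝ} {w w' : Fin n → ℝ} (h : Near c w w') : Near c w' w :=
  fun i j => by
    have := h j i
    linarith [mul_comm (w' i) (w j), mul_comm (w' j) (w i),
      mul_comm c (w i * w' j), mul_comm c (w' j * w i)]

/-- Summing the projective inequality over `j` removes the cross terms, because both vectors have
total mass `1`. -/
theorem Near.le_mul {n : ℕ} {c : ℝ} {w w' : Fin n → ℝ} (h : Near c w w') (hw : IsPosProb w)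
    (hw' : IsPosProb w') (i : Fin n) : w i ≤ c * w' i := by
  have := Finset.sum_le_sum fun j (_ : j ∈ Finset.univ) => h i j
  rw [← Finset.mul_sum, ← Finset.mul_sum, ← Finset.sum_mul, hw.2, hw'.2] at this
  linarith

/-- An update is a coordinatewise rescaling. The normaliser cancels in ratios of factors, and the
exponents lie in `[-η, η]`, whence `e^{2η}`; an empty cache is the rescaling by `1`. -/
theorem elim_mwUpdate_eq {n : ℕ} [NeZero n] {w : Fin n → ℝ} (hw : IsPosProb w) {η : ℝ}
    (hη : 0 ≤ η) (c : Option ((Fin n → Bool) × Bool)) :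
    ∃ g : Fin n → ℝ, (∀ i, 0 < g i) ∧ (∀ i j, g i ≤ Real.exp (2 * η) * g j) ∧
      c.elim w (mwUpdate η w) = fun i => g i * w i := by
  rcases c with _ | e
  · refine ⟨fun _ => 1, fun _ => one_pos, fun _ _ => ?_, by simp⟩
    rw [mul_one]
    exact Real.one_le_exp (by positivity)
  · have hZ := hw.sum_mul_exp_pos fun i => η * pmOne e.2 * pmOne (e.1 i)
    refine ⟨_, fun i => div_pos (Real.exp_pos (η * pmOne e.2 * pmOne (e.1 i))) hZ,
      fun i j => ?_, rfl⟩
    rw [← mul_div_assoc, ← Real.exp_add]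
    gcongr
    have hb : ∀ b b' : Bool, |η * pmOne b * pmOne b'| ≤ η := fun b b' => by
      rw [abs_mul, abs_mul, abs_pmOne, abs_pmOne, abs_of_nonneg hη, mul_one, mul_one]
    have h1 := abs_le.1 (hb e.2 (e.1 i))
    have h2 := abs_le.1 (hb e.2 (e.1 j))
    linarith

/-- The two runs may update equal weights with different examples, or only one of them with an
example; each side contributes `e^{2η}`. -/
theorem near_elim_mwUpdate_of_eq {n : ℕ} [NeZero n] {w w' : Fin n → ℝ} (hw : IsPosProb w)
    (hww : w = w') {η : ℝ} (hη : 0 ≤ η) (c c' : Option ((Fin n → Bool) × Bool)) :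
    Near (Real.exp (4 * η)) (c.elim w (mwUpdate η w)) (c'.elim w' (mwUpdate η w')) := by
  subst hww
  obtain ⟨g, hg, hgle, hge⟩ := elim_mwUpdate_eq hw hη c
  obtain ⟨g', hg', hgle', hge'⟩ := elim_mwUpdate_eq hw hη c'
  rw [hge, hge']
  intro i j
  have h := mul_le_mul (hgle i j) (hgle' j i) (hg' j).le
    (mul_nonneg (Real.exp_pos _).le (hg j).le)
  have hexp : Real.exp (4 * η) = Real.exp (2 * η) * Real.exp (2 * η) := by
    rw [← Real.exp_add]; ring_nf
  have hww : 0 ≤ w i * w j := mul_nonneg (hw.1 i).le (hw.1 j).le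
  have := mul_le_mul_of_nonneg_right h hww
  rw [hexp]
  calc g i * w i * (g' j * w j) = g i * g' j * (w i * w j) := by ring
    _ ≤ _ := this
    _ = _ := by ring

/-- A common rescaling, including the two different normalisers, cancels from both sides. This is
why closeness is measured projectively: later updates cause no growth. -/
theorem Near.mwUpdate {n : ℕ} [NeZero n] {c : ℝ} {w w' : Fin n → ℝ} (h : Near c w w')
    (hw : IsPosProb w) (hw' : IsPosProb w') (η : ℝ) (e : (Fin n → Bool) × Bool) :
    Near c (mwUpdate η w e) (mwUpdate η w' e) := by
  intro i j
  have hZ := hw.sum_mul_exp_pos fun i => η * pmOne e.2 * pmOne (e.1 i)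
  have hZ' := hw'.sum_mul_exp_pos fun i => η * pmOne e.2 * pmOne (e.1 i)
  unfold _root_.mwUpdate
  set Z := ∑ i, w i * Real.exp (η * pmOne e.2 * pmOne (e.1 i))
  set Z' := ∑ i, w' i * Real.exp (η * pmOne e.2 * pmOne (e.1 i))
  have hpos : 0 ≤ Real.exp (η * pmOne e.2 * pmOne (e.1 i)) / Z *
      (Real.exp (η * pmOne e.2 * pmOne (e.1 j)) / Z') := by positivity
  have := mul_le_mul_of_nonneg_left (h i j) hpos
  calc _ = Real.exp (η * pmOne e.2 * pmOne (e.1 i)) / Z *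
      (Real.exp (η * pmOne e.2 * pmOne (e.1 j)) / Z') * (w i * w' j) := by ring
    _ ≤ _ := this
    _ = _ := by ring

theorem Near.elim_mwUpdate {n : ℕ} [NeZero n] {c : ℝ} {w w' : Fin n → ℝ} (h : Near c w w')
    (hw : IsPosProb w) (hw' : IsPosProb w') (η : ℝ) (o : Option ((Fin n → Bool) × Bool)) :
    Near c (o.elim w (_root_.mwUpdate η w)) (o.elim w' (_root_.mwUpdate η w')) := by
  rcases o with _ | e
  · exact h
  · exact h.mwUpdate hw hw' η e

/-! ## Shifts of the noise -/

theorem lt_length_of_thrIndex {m n : ℕ} {l : List (Observation m n)} {s : ℕ}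
    (h : thrIndex l = some s) : s < l.length := by
  induction l with
  | nil => simp [thrIndex] at h
  | cons o l ih =>
    rcases o with _ | v
    · exact (ih h).trans (Nat.lt_succ_self _)
    · simp only [thrIndex, Option.some.injEq] at h
      simp [← h]

namespace Noise

/-- A shift of one threshold noise by `1`. -/
def unitThr (T : ℕ) (i : Option ℕ) : Noise T :=
  ((if i = none then 1 else 0, fun t => if i = some (t : ℕ) then 1 else 0), 0)

/-- A shift of one query noise by `2`. -/
def twoQuery (T j : ℕ) : Noise T := (0, fun t => if (t : ℕ) = j then 2 else 0)

theorem thr_add {T : ℕ} (x y : Noise T) (a : Option ℕ) : (x + y).thr a = x.thr a + y.thr a := by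
  rcases a with _ | s
  · rfl
  · by_cases h : s < T <;> simp [thr, h]

theorem query_add {T : ℕ} (x y : Noise T) (s : ℕ) : (x + y).query s = x.query s + y.query s := by
  by_cases h : s < T <;> simp [query, h]

theorem thr_unitThr_self {T : ℕ} {i : Option ℕ} (hi : ∀ s, i = some s → s < T) :
    (unitThr T i).thr i = 1 := by
  rcases i with _ | s
  · simp [thr, unitThr]
  · simp [thr, unitThr, hi s rfl]

theorem thr_unitThr_of_ne {T : ℕ} {i a : Option ℕ} (h : a ≠ i) : (unitThr T i).thr a = 0 := by
  rcases a with _ | s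
  · simp [thr, unitThr, h.symm]
  · simp [thr, unitThr, h.symm]

theorem query_unitThr {T : ℕ} (i : Option ℕ) (s : ℕ) : (unitThr T i).query s = 0 := by
  simp [query, unitThr]

theorem thr_twoQuery {T : ℕ} (j : ℕ) (a : Option ℕ) : (twoQuery T j).thr a = 0 := by
  rcases a with _ | s
  · simp [thr, twoQuery]
  · simp [thr, twoQuery]

theorem query_twoQuery_self {T j : ℕ} (hj : j < T) : (twoQuery T j).query j = 2 := by
  simp [query, twoQuery, hj]

theorem query_twoQuery_of_ne {T j s : ℕ} (h : s ≠ j) : (twoQuery T j).query s = 0 := by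
  simp [query, twoQuery, h]

theorem sum_abs_shift_le {T : ℕ} (i : Option ℕ) (j : ℕ) (h : Noise T)
    (hh : h = unitThr T i ∨ h = unitThr T i + twoQuery T j) :
    (|h.1.1| + ∑ t, |h.1.2 t|) / 2 + (∑ t, |h.2 t|) / 4 ≤ 1 := by
  have h1 : |(unitThr T i).1.1| + ∑ t, |(unitThr T i).1.2 t| ≤ 1 := by
    rcases i with _ | s
    · simp [unitThr]
    · have : ∀ t : Fin T, |(unitThr T (some s)).1.2 t| = if s = (t : ℕ) then 1 else 0 := fun t => by
        by_cases hs : s = t <;> simp [unitThr, hs]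
      simp only [this]
      by_cases hs : s < T
      · rw [Finset.sum_eq_single ⟨s, hs⟩ (fun t _ ht => if_neg fun h => ht (Fin.ext h.symm))
          (by simp)]
        simp [unitThr]
      · rw [Finset.sum_eq_zero fun (t : Fin T) _ => if_neg fun h : s = (t : ℕ) => hs (h ▸ t.2)]
        simp [unitThr]
  have h2 : ∑ t, |(twoQuery T j).2 t| ≤ 2 := by
    have : ∀ t : Fin T, |(twoQuery T j).2 t| = if (t : ℕ) = j then 2 else 0 := fun t => by
      by_cases hs : (t : ℕ) = j <;> simp [twoQuery, hs]
    simp only [this]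
    by_cases hs : j < T
    · rw [Finset.sum_eq_single ⟨j, hs⟩ (fun t _ ht => if_neg fun h => ht (Fin.ext h)) (by simp)]
      simp
    · rw [Finset.sum_eq_zero fun (t : Fin T) _ => if_neg fun h : (t : ℕ) = j => hs (h ▸ t.2)]
      norm_num
  rcases hh with rfl | rfl
  · have h3 : ∑ t, |(unitThr T i).2 t| = 0 := by simp [unitThr]
    rw [h3]
    linarith
  · have h3 : ∀ t, |(unitThr T i + twoQuery T j).2 t| = |(twoQuery T j).2 t| := fun t => by
      simp [unitThr]
    have h4 : |(unitThr T i + twoQuery T j).1.1| + ∑ t, |(unitThr T i + twoQuery T j).1.2 t| =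
        |(unitThr T i).1.1| + ∑ t, |(unitThr T i).1.2 t| := by
      simp [twoQuery]
    rw [h4]
    simp only [h3]
    linarith

end Noise

section Coupling

variable {n : ℕ} (p : WinnowParams) (S S' : ℕ → (Fin n → Bool) × Bool)

/-- The last test recorded in `l` takes place in round `l.length - 1`, and a threshold drawn at the
end of round `s` is first used in round `s + 1`; hence the bound `s + 1 < l.length`. -/
theorem noiseEvent_congr {T : ℕ} {x y : Noise T} (l : List (Observation p.m n))
    (ht : ∀ a : Option ℕ, (∀ s, a = some s → s + 1 < l.length) → x.thr a = y.thr a)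
    (hq : ∀ s < l.length, x.query s = y.query s) (hx : x ∈ noiseEvent p S T l) :
    y ∈ noiseEvent p S T l := by
  induction l with
  | nil => trivial
  | cons o l ih =>
    obtain ⟨h1, h2⟩ := hx
    refine ⟨ih (fun a ha => ht a fun s hs => (ha s hs).trans (Nat.lt_succ_self _))
      (fun s hs => hq s (hs.trans (Nat.lt_succ_self _))) h1, ?_⟩
    rw [← h2, Fires, Fires, ht _ fun s hs => Nat.succ_lt_succ (lt_length_of_thrIndex hs),
      hq _ (Nat.lt_succ_self _)]

/-- The transcript stays consistent when the current threshold is raised. -/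
theorem add_unitThr_mem_noiseEvent {T : ℕ} {x : Noise T} {l : List (Observation p.m n)}
    (hl : l.length ≤ T) (hx : x ∈ noiseEvent p S T l) :
    x + Noise.unitThr T (thrIndex l) ∈ noiseEvent p S T l := by
  induction l with
  | nil => trivial
  | cons o l ih =>
    have hlT : l.length < T := hl
    rcases o with _ | v
    · obtain ⟨h1, h2⟩ := hx
      refine ⟨ih hlT.le h1, ?_⟩
      simp only [Option.isSome_none, Bool.false_eq_true, iff_false] at h2 ⊢
      intro hf
      refine h2 ⟨?_, hf.2⟩
      have := hf.1
      rw [thrIndex, Noise.thr_add, Noise.query_add, Noise.query_unitThr, Noise.thr_unitThr_self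
        fun s hs => (lt_length_of_thrIndex hs).trans hlT] at this
      linarith
    · refine noiseEvent_congr p S _ (fun a ha => ?_) (fun s _ => ?_) hx
      · rw [Noise.thr_add, thrIndex, Noise.thr_unitThr_of_ne, add_zero]
        intro h
        exact absurd (ha _ h) (by simp)
      · rw [Noise.query_add, Noise.query_unitThr, add_zero]

/-- The output is a post-processing of the transcript. In particular two runs with the same
transcript make the same predictions on equal examples. -/
theorem detState_wTilde_eq (l : List (Observation p.m n)) :
    (detState p S l).wTilde = (detState p S' l).wTilde := by
  induction l with
  | nil => rfl
  | cons o l ih =>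
    rcases o with _ | v
    · exact ih
    · rfl

theorem detState_k_eq (l : List (Observation p.m n)) :
    (detState p S l).k = (detState p S' l).k := by
  induction l with
  | nil => rfl
  | cons o l ih =>
    rcases o with _ | v
    · exact ih
    · exact congrArg (· + 1) ih

variable {S S'} {σ : ℕ}

theorem detState_eq_of_length_le (hS : ∀ s, s ≠ σ → S s = S' s) (T : ℕ)
    {l : List (Observation p.m n)} (hl : l.length ≤ σ) :
    detState p S l = detState p S' l ∧ noiseEvent p S T l = noiseEvent p S' T l := by
  induction l with
  | nil => exact ⟨rfl, rfl⟩
  | cons o l ih =>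
    have hlσ : l.length < σ := hl
    obtain ⟨h1, h2⟩ := ih hlσ.le
    have h3 := hS _ hlσ.ne
    constructor
    · rcases o with _ | v <;> simp only [detState, h1, h3]
    · simp only [noiseEvent, Fires, h1, h2, h3]

/-- The runs on two neighbouring sequences in the part of an epoch that follows the round in which
the sequences differ. -/
structure SameEpoch (p : WinnowParams) (S S' : ℕ → (Fin n → Bool) × Bool) (T : ℕ)
    (l : List (Observation p.m n)) : Prop where
  w_eq : (detState p S l).w = (detState p S' l).w
  errs_le : ((detState p S l).record (S l.length)).errs ≤
    ((detState p S' l).record (S' l.length)).errs + 1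
  le_errs : ((detState p S' l).record (S' l.length)).errs ≤
    ((detState p S l).record (S l.length)).errs + 1
  shift : ∀ x ∈ noiseEvent p S T l, x + Noise.unitThr T (thrIndex l) ∈ noiseEvent p S' T l

/-- The runs on two neighbouring sequences after the epoch in which the sequences differ. -/
structure LaterEpoch (p : WinnowParams) (S S' : ℕ → (Fin n → Bool) × Bool) (T : ℕ)
    (l : List (Observation p.m n)) : Prop where
  errs_eq : (detState p S l).errs = (detState p S' l).errs
  cache_eq : (detState p S l).cache = (detState p S' l).cache
  near : Near (Real.exp (4 * p.η)) (detState p S l).w (detState p S' l).w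
  shift : ∃ (i : Option ℕ) (j : ℕ), (∀ s, i = some s → s < l.length) ∧ j < l.length ∧
    thrIndex l ≠ i ∧ ∀ x ∈ noiseEvent p S T l,
      x + (Noise.unitThr T i + Noise.twoQuery T j) ∈ noiseEvent p S' T l

/-- The error counts differ by at most one. While no update occurs, the threshold raised by 1
prevents the second run from firing. When an update occurs, 2 more on the query pays for the raised
threshold and for one missing error; it also empties both caches and counters, which starts the
later phase. -/
theorem SameEpoch.cons [NeZero n] (hη : 0 ≤ p.η) (hS : ∀ s, s ≠ σ → S s = S' s) {T : ℕ}
    {l : List (Observation p.m n)} (hl : l.length < T) (hσ : σ ≤ l.length)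
    (h : SameEpoch p S S' T l) (o : Observation p.m n) :
    SameEpoch p S S' T (o :: l) ∨ LaterEpoch p S S' T (o :: l) := by
  have hk := detState_k_eq p S S' l
  have e1 : (((detState p S l).record (S l.length)).errs : ℝ) ≤
      ((detState p S' l).record (S' l.length)).errs + 1 := by exact_mod_cast h.errs_le
  have e2 : (((detState p S' l).record (S' l.length)).errs : ℝ) ≤
      ((detState p S l).record (S l.length)).errs + 1 := by exact_mod_cast h.le_errs
  have hthr := Noise.thr_unitThr_self (T := T) (i := thrIndex l)
    fun s hs => (lt_length_of_thrIndex hs).trans hl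
  rcases o with _ | v
  · left
    have hrec : ∀ (s s' : WinnowState n) (e : (Fin n → Bool) × Bool), s.wTilde = s'.wTilde →
        s.errs ≤ s'.errs + 1 → (s.record e).errs ≤ (s'.record e).errs + 1 := by
      intro s s' e hw he
      unfold WinnowState.record
      by_cases hh : halfspace s'.wTilde e.1 ≠ e.2
      · simpa [hw, hh] using he
      · simpa [hw, hh] using he
    have hne : S (l.length + 1) = S' (l.length + 1) := hS _ (by omega)
    refine ⟨h.w_eq, ?_, ?_, fun x hx => ⟨h.shift x hx.1, ?_⟩⟩
    · simp only [List.length_cons, hne]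
      exact hrec _ _ _ (detState_wTilde_eq p S S' _) h.errs_le
    · simp only [List.length_cons, hne]
      exact hrec _ _ _ (detState_wTilde_eq p S' S _) h.le_errs
    · have h2 := hx.2
      simp only [Option.isSome_none, Bool.false_eq_true, iff_false] at h2 ⊢
      intro hf
      refine h2 ⟨?_, by rw [hk]; exact hf.2⟩
      have := hf.1
      rw [thrIndex, Noise.thr_add, Noise.query_add, Noise.query_unitThr, hthr] at this
      linarith
  · right
    refine ⟨rfl, rfl, ?_, thrIndex l, l.length, fun s hs => ?_, Nat.lt_succ_self _, fun hh => ?_,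
      fun x hx => ⟨?_, ?_⟩⟩
    · exact near_elim_mwUpdate_of_eq (isPosProb_detState p S l) h.w_eq hη _ _
    · exact (lt_length_of_thrIndex hs).trans (Nat.lt_succ_self _)
    · exact lt_irrefl _ (lt_length_of_thrIndex hh.symm)
    · refine noiseEvent_congr p S' l (fun a _ => ?_) (fun s hs => ?_) (h.shift x hx.1)
      · simp only [Noise.thr_add, Noise.thr_twoQuery, add_zero]
      · simp only [Noise.query_add, Noise.query_twoQuery_of_ne hs.ne, add_zero]
    · have h2 := hx.2
      simp only [Option.isSome_some, iff_true] at h2 ⊢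
      refine ⟨?_, by rw [← hk]; exact h2.2⟩
      have := h2.1
      rw [Noise.thr_add, Noise.thr_add, Noise.thr_twoQuery, hthr, Noise.query_add, Noise.query_add,
        Noise.query_unitThr, Noise.query_twoQuery_self hl]
      linarith

/-- The shifted coins belong to a finished instance, so the current test is unaffected, and the two
runs update with the same cached example. -/
theorem LaterEpoch.cons [NeZero n] (hS : ∀ s, s ≠ σ → S s = S' s) {T : ℕ}
    {l : List (Observation p.m n)} (hσ : σ < l.length)
    (h : LaterEpoch p S S' T l) (o : Observation p.m n) :
    LaterEpoch p S S' T (o :: l) := by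
  have hk := detState_k_eq p S S' l
  have hw := detState_wTilde_eq p S S' l
  have hSl : S l.length = S' l.length := hS _ hσ.ne'
  have hc : ((detState p S l).record (S l.length)).cache =
      ((detState p S' l).record (S' l.length)).cache := by
    simp only [WinnowState.record, h.cache_eq, hw, hSl]
  have he : ((detState p S l).record (S l.length)).errs =
      ((detState p S' l).record (S' l.length)).errs := by
    simp only [WinnowState.record, h.errs_eq, hw, hSl]
  obtain ⟨i, j, hi, hj, hij, hshift⟩ := h.shift
  have hfires : ∀ x : Noise T, Fires p S' l (x + (Noise.unitThr T i + Noise.twoQuery T j)) ↔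
      Fires p S l x := fun x => by
    rw [Fires, Fires, Noise.thr_add, Noise.thr_add, Noise.thr_twoQuery,
      Noise.thr_unitThr_of_ne hij, Noise.query_add, Noise.query_add, Noise.query_unitThr,
      Noise.query_twoQuery_of_ne hj.ne', hk, he]
    simp
  have hsh : ∃ (i : Option ℕ) (j : ℕ), (∀ s, i = some s → s < (o :: l).length) ∧
      j < (o :: l).length ∧ thrIndex (o :: l) ≠ i ∧ ∀ x ∈ noiseEvent p S T (o :: l),
      x + (Noise.unitThr T i + Noise.twoQuery T j) ∈ noiseEvent p S' T (o :: l) := by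
    refine ⟨i, j, fun s hs => (hi s hs).trans (Nat.lt_succ_self _), hj.trans (Nat.lt_succ_self _),
      ?_, fun x hx => ⟨hshift x hx.1, ?_⟩⟩
    · rcases o with _ | v
      · exact hij
      · intro hh
        exact lt_irrefl _ (hi _ hh.symm)
    · rw [hfires]
      exact hx.2
  rcases o with _ | v
  · exact ⟨he, hc, h.near, hsh⟩
  · refine ⟨rfl, rfl, ?_, hsh⟩
    simp only [detState, WinnowState.nextWeights]
    rw [hc]
    exact h.near.elim_mwUpdate (isPosProb_detState p S l) (isPosProb_detState p S' l) _ _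

/-- Up to this round the runs coincide, and the single differing example changes the count by at
most one. The threshold noise is already shifted here, so the earlier tests of the epoch, all
negative, must survive a higher threshold. -/
theorem sameEpoch_of_length_eq (hS : ∀ s, s ≠ σ → S s = S' s) {T : ℕ}
    {l : List (Observation p.m n)} (hl : l.length < T) (hσ : l.length = σ) :
    SameEpoch p S S' T l := by
  obtain ⟨h1, h2⟩ := detState_eq_of_length_le p hS T hσ.le
  have hrec : ∀ (s : WinnowState n) (e e' : (Fin n → Bool) × Bool),
      (s.record e).errs ≤ (s.record e').errs + 1 := by
    intro s e e'
    unfold WinnowState.record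
    simp only
    split_ifs <;> omega
  refine ⟨by rw [h1], by rw [h1]; exact hrec _ _ _, by rw [h1]; exact hrec _ _ _, fun x hx => ?_⟩
  rw [h2] at hx
  exact add_unitThr_mem_noiseEvent p S' hl.le hx

theorem sameEpoch_or_laterEpoch [NeZero n] (hη : 0 ≤ p.η) (hS : ∀ s, s ≠ σ → S s = S' s) {T : ℕ}
    {l : List (Observation p.m n)} (hl : l.length ≤ T) (hσ : σ < l.length) :
    SameEpoch p S S' T l ∨ LaterEpoch p S S' T l := by
  induction l with
  | nil => simp at hσ
  | cons o l ih =>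
    have hlT : l.length < T := hl
    rcases (Nat.lt_succ_iff.1 hσ : σ ≤ l.length).eq_or_lt with heq | hlt
    · exact (sameEpoch_of_length_eq p hS hlT heq.symm).cons p hη hS hlT heq.le o
    · rcases ih hlT.le hlt with h | h
      · exact h.cons p hη hS hlT hlt.le o
      · exact Or.inr (h.cons p hS hlt o)

theorem near_nextWeights [NeZero n] (hη : 0 ≤ p.η) (hS : ∀ s, s ≠ σ → S s = S' s) {T : ℕ}
    {l : List (Observation p.m n)} (hl : l.length < T) :
    Near (Real.exp (4 * p.η)) (nextWeights p S l) (nextWeights p S' l) := by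
  have hsame : SameEpoch p S S' T l →
      Near (Real.exp (4 * p.η)) (nextWeights p S l) (nextWeights p S' l) := fun h =>
    near_elim_mwUpdate_of_eq (isPosProb_detState p S l) h.w_eq hη _ _
  rcases lt_trichotomy l.length σ with h | h | h
  -- Before the differing round the weights are equal, and the factor `e^{4η} ≥ 1` is slack.
  · obtain ⟨h1, -⟩ := detState_eq_of_length_le p hS T h.le
    unfold nextWeights
    rw [h1, hS _ h.ne]
    intro i j
    have hw := isPosProb_nextWeights p S' l
    have := mul_pos (hw.1 i) (hw.1 j)
    have hone : 1 ≤ Real.exp (4 * p.η) := Real.one_le_exp (by positivity)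
    unfold nextWeights at this
    nlinarith
  · exact hsame (sameEpoch_of_length_eq p hS hl h)
  · rcases sameEpoch_or_laterEpoch p hη hS hl.le h with h' | h'
    · exact hsame h'
    · have hSl : S l.length = S' l.length := hS _ h.ne'
      have hc : ((detState p S l).record (S l.length)).cache =
          ((detState p S' l).record (S' l.length)).cache := by
        simp only [WinnowState.record, h'.cache_eq, detState_wTilde_eq p S S' l, hSl]
      unfold nextWeights WinnowState.nextWeights
      rw [hc]
      exact h'.near.elim_mwUpdate (isPosProb_detState p S l) (isPosProb_detState p S' l) _ _

theorem noiseProb_le_of_shift (he : 0 < p.epsHat) {T : ℕ} {l : List (Observation p.m n)}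
    (h : Noise T) (hc : (|h.1.1| + ∑ t, |h.1.2 t|) / 2 + (∑ t, |h.2 t|) / 4 ≤ 1)
    (hsub : ∀ x ∈ noiseEvent p S T l, x + h ∈ noiseEvent p S' T l) :
    noiseProb p S T l ≤ Real.exp p.epsHat * noiseProb p S' T l := by
  have := isProbabilityMeasure_noiseMeasure he T
  have h1 := (measure_mono (μ := noiseMeasure p.epsHat T)
    (show noiseEvent p S T l ⊆ {x | x + h ∈ noiseEvent p S' T l} from hsub)).trans
    (noiseMeasure_preimage_add_le he h (measurableSet_noiseEvent p S' T l))
  unfold noiseProb Measure.real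
  have h2 := ENNReal.toReal_mono (by finiteness) h1
  rw [ENNReal.toReal_mul, ENNReal.toReal_ofReal (Real.exp_pos _).le] at h2
  refine h2.trans ?_
  gcongr
  nlinarith

/-- The privacy of AboveThreshold: neighbouring sequences give close noise probabilities. -/
theorem noiseProb_le [NeZero n] (he : 0 < p.epsHat) (hη : 0 ≤ p.η)
    (hS : ∀ s, s ≠ σ → S s = S' s) {T : ℕ} {l : List (Observation p.m n)} (hl : l.length ≤ T) :
    noiseProb p S T l ≤ Real.exp p.epsHat * noiseProb p S' T l := by
  rcases le_or_gt l.length σ with h | h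
  · have h2 := (detState_eq_of_length_le p hS T h).2
    unfold noiseProb
    rw [h2]
    exact le_mul_of_one_le_left measureReal_nonneg (Real.one_le_exp he.le)
  · rcases sameEpoch_or_laterEpoch p hη hS hl h with h' | h'
    · exact noiseProb_le_of_shift p he _ (Noise.sum_abs_shift_le _ 0 _ (Or.inl rfl)) h'.shift
    · obtain ⟨i, j, -, -, -, hsh⟩ := h'.shift
      exact noiseProb_le_of_shift p he _ (Noise.sum_abs_shift_le i j _ (Or.inr rfl)) hsh

end Coupling

/-! ## Rényi divergence of the sampling -/

/-- The ratio `w/w'` lies in `[e^{-e}, e^{e}]` and has mean `1` under `w'`. By convexity of `r ↦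
r^{α+1}` the worst case is concentrated on the two endpoints, where the moment is `cosh((α+1/2)e) /
cosh(e/2)`. -/
theorem sum_mul_rpow_div_le {n : ℕ} {w w' : Fin n → ℝ} (hw : IsPosProb w) (hw' : IsPosProb w')
    {e α : ℝ} (he : 0 < e) (hα : 0 ≤ α) (h : ∀ i, w i ≤ Real.exp e * w' i)
    (h' : ∀ i, w' i ≤ Real.exp e * w i) :
    ∑ i, w i * (w i / w' i) ^ α ≤ Real.exp ((α + 1 / 2) ^ 2 * e ^ 2 / 2) := by
  set a := Real.exp (-e) with ha
  set b := Real.exp e with hb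
  have ha0 : 0 < a := Real.exp_pos _
  have hb0 : 0 < b := Real.exp_pos _
  have hab : a < b := Real.exp_lt_exp.2 (by linarith)
  have hba : 0 < b - a := sub_pos.2 hab
  have hterm : ∀ i, w i * (w i / w' i) ^ α ≤
      w' i * (((b - w i / w' i) / (b - a)) * a ^ (α + 1) +
        ((w i / w' i - a) / (b - a)) * b ^ (α + 1)) := by
    intro i
    have hi' := hw'.1 i
    have hi := hw.1 i
    have hr : 0 < w i / w' i := div_pos hi hi'
    have hrb : w i / w' i ≤ b := (div_le_iff₀ hi').2 (h i)
    have hra : a ≤ w i / w' i := by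
      rw [le_div_iff₀ hi', ha, Real.exp_neg, inv_mul_le_iff₀ hb0]
      exact h' i
    have hconv := @(convexOn_rpow (p := α + 1) (by linarith)).2 a ha0.le b hb0.le
      -- The weights that write the ratio as a convex combination of the endpoints `a` and `b`.
      ((b - w i / w' i) / (b - a)) ((w i / w' i - a) / (b - a))
      (div_nonneg (by linarith) hba.le) (div_nonneg (by linarith) hba.le) (by field_simp; ring)
    simp only [smul_eq_mul] at hconv
    have hcomb : (b - w i / w' i) / (b - a) * a + (w i / w' i - a) / (b - a) * b = w i / w' i := by
      field_simp
      ring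
    rw [hcomb, Real.rpow_add hr, Real.rpow_one] at hconv
    calc w i * (w i / w' i) ^ α = w' i * ((w i / w' i) ^ α * (w i / w' i)) := by field_simp
      _ ≤ _ := mul_le_mul_of_nonneg_left hconv hi'.le
  refine (Finset.sum_le_sum fun i _ => hterm i).trans ?_
  have hsum : ∑ i, w' i * (((b - w i / w' i) / (b - a)) * a ^ (α + 1) +
        ((w i / w' i - a) / (b - a)) * b ^ (α + 1)) =
      ((b - 1) * a ^ (α + 1) + (1 - a) * b ^ (α + 1)) / (b - a) := by
    have : ∀ i, w' i * (((b - w i / w' i) / (b - a)) * a ^ (α + 1) +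
        ((w i / w' i - a) / (b - a)) * b ^ (α + 1)) =
        w' i * ((b * a ^ (α + 1) - a * b ^ (α + 1)) / (b - a)) +
        w i * ((b ^ (α + 1) - a ^ (α + 1)) / (b - a)) := fun i => by
      have := (hw'.1 i).ne'
      field_simp
      ring
    simp only [this]
    rw [Finset.sum_add_distrib, ← Finset.sum_mul, ← Finset.sum_mul, hw.2, hw'.2]
    ring
  rw [hsum, div_le_iff₀ hba]
  have hcosh := Real.cosh_le_exp_half_sq ((α + 1 / 2) * e)
  have hrw : ((α + 1 / 2) * e) ^ 2 / 2 = (α + 1 / 2) ^ 2 * e ^ 2 / 2 := by ring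
  rw [hrw] at hcosh
  refine le_trans ?_ (mul_le_mul_of_nonneg_right hcosh hba.le)
  rw [Real.cosh_eq, ha, hb, ← Real.exp_mul, ← Real.exp_mul]
  -- In half exponents the chord value is `(u + v)(x - y) / (x² - y²) = (u + v) / (x + y)`, and `x +
  -- y ≥ 2`.
  set x := Real.exp (e / 2) with hx
  set y := Real.exp (-(e / 2)) with hy
  have hxy : x * y = 1 := by rw [hx, hy, ← Real.exp_add]; simp
  have hy0 : 0 < y := Real.exp_pos _
  have hyx : y ≤ x := Real.exp_le_exp.2 (by linarith)
  have hxx : Real.exp e = x * x := by rw [hx, ← Real.exp_add]; ring_nf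
  have hyy : Real.exp (-e) = y * y := by rw [hy, ← Real.exp_add]; ring_nf
  set u := Real.exp ((α + 1 / 2) * e) with hu
  set v := Real.exp (-((α + 1 / 2) * e)) with hv
  have h1 : Real.exp (-e * (α + 1)) = v * y := by rw [hv, hy, ← Real.exp_add]; ring_nf
  have h2 : Real.exp (e * (α + 1)) = u * x := by rw [hu, hx, ← Real.exp_add]; ring_nf
  have hu0 : 0 < u := Real.exp_pos _
  have hv0 : 0 < v := Real.exp_pos _
  rw [h1, h2, hxx, hyy]
  have hs : 2 ≤ x + y := by nlinarith [sq_nonneg (x - y), sq_nonneg (x + y - 2)]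
  have hl : (x * x - 1) * (v * y) + (1 - y * y) * (u * x) = (u + v) * (x - y) := by
    have e1 : (x * x - 1) * (v * y) = v * (x * (x * y) - y) := by ring
    have e2 : (1 - y * y) * (u * x) = u * (x - y * (x * y)) := by ring
    rw [e1, e2, hxy]
    ring
  rw [hl]
  have : 0 ≤ (u + v) * (x - y) := mul_nonneg (by positivity) (by linarith)
  nlinarith

/-! ## Supermartingales along the transcript -/

section Privacy

variable {n : ℕ} (p : WinnowParams)

theorem sum_prod_eq_one {m : ℕ} {w : Fin n → ℝ} (hw : IsPosProb w) :
    ∑ v : Fin m → Fin n, ∏ i, w (v i) = 1 := by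
  rw [← Fintype.sum_pow, hw.2, one_pow]

/-- Optional stopping in elementary form: `Y` need only be a supermartingale separately for no
update and for an update averaged over the samples. How the noise divides the mass between the two
cases is then irrelevant. -/
theorem sum_noiseProb_mul_samplingProb_mul_le [NeZero n] (S : ℕ → (Fin n → Bool) × Bool)
    (he : 0 < p.epsHat) {T : ℕ} (Y : List (Observation p.m n) → ℝ)
    (hnone : ∀ l, l.length < T → Y (none :: l) ≤ Y l)
    (hsome : ∀ l, l.length < T → ∑ v, (∏ i, nextWeights p S l (v i)) * Y (some v :: l) ≤ Y l)
    {t : ℕ} (ht : t ≤ T) :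
    ∑ l ∈ transcripts p.m n t, noiseProb p S T l * samplingProb p S l * Y l ≤ Y [] := by
  induction t with
  | zero => simp [transcripts, noiseProb_nil p S he, samplingProb]
  | succ t ih =>
    refine le_trans ?_ (ih (Nat.le_of_succ_le ht))
    rw [sum_transcripts_succ]
    refine Finset.sum_le_sum fun l hl => ?_
    have hlT : l.length < T := by rw [mem_transcripts.1 hl]; exact ht
    -- Whether the round fires does not depend on the sampled indices, so this factor comes out of
    -- the sum over `v`.
    have hq : ∀ v, noiseProb p S T (some v :: l) =
        noiseProb p S T l - noiseProb p S T (none :: l) := fun v => by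
      have := noiseProb_cons p S he T l v
      linarith
    have hB := samplingProb_pos p S l
    have hq0 := noiseProb_nonneg p S T (none :: l)
    have hq1 : 0 ≤ noiseProb p S T l - noiseProb p S T (none :: l) := by
      rw [← hq fun _ => 0]
      exact noiseProb_nonneg p S T _
    have hsum : ∑ v, noiseProb p S T (some v :: l) * samplingProb p S (some v :: l) *
        Y (some v :: l) = (noiseProb p S T l - noiseProb p S T (none :: l)) * samplingProb p S l *
          ∑ v, (∏ i, nextWeights p S l (v i)) * Y (some v :: l) := by
      rw [Finset.mul_sum]
      refine Finset.sum_congr rfl fun v _ => ?_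
      rw [hq, samplingProb]
      ring
    rw [hsum]
    have h1 := mul_le_mul_of_nonneg_left (hnone l hlT) (mul_nonneg hq0 hB.le)
    have h2 := mul_le_mul_of_nonneg_left (hsome l hlT) (mul_nonneg hq1 hB.le)
    have h3 : samplingProb p S (none :: l) = samplingProb p S l := rfl
    rw [h3]
    calc _ ≤ noiseProb p S T (none :: l) * samplingProb p S l * Y l +
        (noiseProb p S T l - noiseProb p S T (none :: l)) * samplingProb p S l * Y l :=
          add_le_add h1 h2
      _ = _ := by ring

/-! ### Moments of the likelihood ratio and approximate privacy -/

variable {p} {S S' : ℕ → (Fin n → Bool) × Bool} {σ : ℕ}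

/-- `K` is real and the last update required a previous count below `K`, so the count can exceed
`K`, but by less than one. -/
theorem detState_k_lt (hK : 0 < p.K) {T : ℕ} {l : List (Observation p.m n)} {x : Noise T}
    (hx : x ∈ noiseEvent p S T l) : ((detState p S l).k : ℝ) < p.K + 1 := by
  induction l with
  | nil => simp only [detState, WinnowState.init, Nat.cast_zero]; linarith
  | cons o l ih =>
    rcases o with _ | v
    · exact ih hx.1
    · have h := hx.2
      simp only [Option.isSome_some, iff_true] at h
      have := h.2
      simp only [detState, Nat.cast_add, Nat.cast_one]
      linarith

/-- The moment of the likelihood ratio of the sampling on neighbouring sequences. -/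
theorem sum_likelihood_rpow_le [NeZero n] (he : 0 < p.epsHat) (hη : 0 < p.η) (hK : 0 < p.K)
    (hS : ∀ s, s ≠ σ → S s = S' s) {α : ℝ} (hα : 0 ≤ α) (T : ℕ) :
    ∑ l ∈ transcripts p.m n T, noiseProb p S T l * samplingProb p S l *
        (samplingProb p S l / samplingProb p S' l) ^ α ≤
      Real.exp (p.m * ((α + 1 / 2) ^ 2 * (4 * p.η) ^ 2 / 2) * (p.K + 1)) := by
  set κ : ℝ := p.m * ((α + 1 / 2) ^ 2 * (4 * p.η) ^ 2 / 2) with hκ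
  have hκ0 : 0 ≤ κ := by positivity
  -- An update multiplies the moment by at most `e^κ`, which `exp(-κ k)` compensates; the bound on
  -- `k` is used only at the end.
  have key := sum_noiseProb_mul_samplingProb_mul_le p S he (T := T)
    (fun l => (samplingProb p S l / samplingProb p S' l) ^ α *
      Real.exp (-κ * (detState p S l).k)) (fun l _ => le_of_eq rfl) (fun l hl => ?_) le_rfl
  · have h0 : (samplingProb p S ([] : List (Observation p.m n)) / samplingProb p S' []) ^ α *
        Real.exp (-κ * (detState p S ([] : List (Observation p.m n))).k) = 1 := by
      simp [samplingProb, detState, WinnowState.init]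
    rw [h0] at key
    rw [← mul_one (Real.exp _)]
    refine le_trans ?_ (mul_le_mul_of_nonneg_left key (Real.exp_pos _).le)
    rw [Finset.mul_sum]
    refine Finset.sum_le_sum fun l _ => ?_
    have hB := samplingProb_pos p S l
    have hB' := samplingProb_pos p S' l
    have hr : 0 ≤ (samplingProb p S l / samplingProb p S' l) ^ α := by positivity
    -- Transcripts with too many updates have noise probability zero; for the others some noise
    -- witnesses the bound on `k`.
    rcases (noiseProb_nonneg p S T l).eq_or_lt with hq | hq
    · rw [← hq]; simp
    · obtain ⟨x, hx⟩ : (noiseEvent p S T l).Nonempty := by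
        by_contra hne
        rw [Set.not_nonempty_iff_eq_empty] at hne
        simp [noiseProb, hne] at hq
      have hk := detState_k_lt hK hx
      have hexp : 1 ≤ Real.exp (κ * (p.K + 1)) * Real.exp (-κ * (detState p S l).k) := by
        rw [← Real.exp_add]
        refine Real.one_le_exp ?_
        nlinarith
      have hnn : 0 ≤ noiseProb p S T l * samplingProb p S l *
        (samplingProb p S l / samplingProb p S' l) ^ α := by positivity
      calc _ ≤ noiseProb p S T l * samplingProb p S l *
            (samplingProb p S l / samplingProb p S' l) ^ α *
            (Real.exp (κ * (p.K + 1)) * Real.exp (-κ * (detState p S l).k)) :=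
            le_mul_of_one_le_right hnn hexp
        _ = _ := by ring
  · have hw := isPosProb_nextWeights p S l
    have hw' := isPosProb_nextWeights p S' l
    have hnear := near_nextWeights p hη.le hS hl
    have hB := samplingProb_pos p S l
    have hB' := samplingProb_pos p S' l
    have hmom := sum_mul_rpow_div_le hw hw' (e := 4 * p.η) (by positivity) hα
      (hnear.le_mul hw hw') (hnear.symm.le_mul hw' hw)
    have hnn : 0 ≤ ∑ i, nextWeights p S l i * (nextWeights p S l i / nextWeights p S' l i) ^ α :=
      Finset.sum_nonneg fun i _ => by
        have := hw.1 i
        have := hw'.1 i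
        positivity
    have hpow := pow_le_pow_left₀ hnn hmom p.m
    rw [Fintype.sum_pow, ← Real.exp_nat_mul] at hpow
    have hterm : ∀ v : Fin p.m → Fin n, (∏ i, nextWeights p S l (v i)) *
        ((samplingProb p S (some v :: l) / samplingProb p S' (some v :: l)) ^ α *
          Real.exp (-κ * (detState p S (some v :: l)).k)) =
        (samplingProb p S l / samplingProb p S' l) ^ α *
          Real.exp (-κ * (detState p S l).k) * Real.exp (-κ) *
          ∏ i, (nextWeights p S l (v i) *
            (nextWeights p S l (v i) / nextWeights p S' l (v i)) ^ α) := by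
      intro v
      have h1 : samplingProb p S (some v :: l) / samplingProb p S' (some v :: l) =
          (∏ i, nextWeights p S l (v i) / nextWeights p S' l (v i)) *
            (samplingProb p S l / samplingProb p S' l) := by
        rw [samplingProb, samplingProb, Finset.prod_div_distrib, mul_div_mul_comm]
      have h2 : Real.exp (-κ * (detState p S (some v :: l)).k) =
          Real.exp (-κ * (detState p S l).k) * Real.exp (-κ) := by
        rw [← Real.exp_add]
        congr 1
        simp only [detState, Nat.cast_add, Nat.cast_one]
        ring
      have hpos : ∀ i, 0 ≤ nextWeights p S l (v i) / nextWeights p S' l (v i) := fun i =>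
        (div_pos (hw.1 _) (hw'.1 _)).le
      rw [h1, h2, Real.mul_rpow (Finset.prod_nonneg fun i _ => hpos i) (div_pos hB hB').le,
        Finset.prod_mul_distrib, ← Real.finsetProd_rpow _ _ fun i _ => hpos i]
      ring
    simp only [hterm]
    rw [← Finset.mul_sum, mul_assoc]
    refine mul_le_of_le_one_right (by positivity) ?_
    calc _ ≤ Real.exp (-κ) * Real.exp (p.m * ((α + 1 / 2) ^ 2 * (4 * p.η) ^ 2 / 2)) :=
          mul_le_mul_of_nonneg_left hpow (Real.exp_pos _).le
      _ = 1 := by rw [← Real.exp_add, ← hκ]; simp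

theorem drop_transcript [NeZero n] (S : ℕ → (Fin n → Bool) × Bool) {T : ℕ} (ω : Coins p.m T) (t d : ℕ) :
    (transcript p S ω (t + d)).drop d = transcript p S ω t := by
  induction d with
  | zero => rfl
  | succ d ih => rw [← add_assoc, transcript, List.drop_succ_cons, ih]

theorem dpWinnow_eq [NeZero n] {T : ℕ} (S : Fin T → (Fin n → Bool) × Bool) (ω : Coins p.m T) :
    dpWinnow p S ω = fun t : Fin T =>
      (detState p (extendSeq S) ((transcript p (extendSeq S) ω T).drop (T - t))).wTilde := by
  funext t
  have h := drop_transcript (p := p) (extendSeq S) ω t (T - t)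
  rw [Nat.add_sub_cancel' t.2.le] at h
  rw [dpWinnow, winnowState_eq p S ω t.2.le, h]

/-- The privacy of DP-Winnow, with the Chernoff parameters `α` and `c` left free. -/
theorem dpWinnow_measure_le [NeZero n] (he : 0 < p.epsHat) (hη : 0 < p.η) (hK : 0 < p.K) {T : ℕ}
    {S S' : Fin T → (Fin n → Bool) × Bool} {τ : Fin T} (hS : ∀ t, t ≠ τ → S t = S' t)
    {α : ℝ} (hα : 0 ≤ α) (c : ℝ) (R : Set (Fin T → Fin n → ℝ)) :
    coinMeasure p T {ω | dpWinnow p S ω ∈ R} ≤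
      ENNReal.ofReal (Real.exp (p.epsHat + c)) * coinMeasure p T {ω | dpWinnow p S' ω ∈ R} +
        ENNReal.ofReal
          (Real.exp (p.m * ((α + 1 / 2) ^ 2 * (4 * p.η) ^ 2 / 2) * (p.K + 1) - α * c)) := by
  classical
  have hext : ∀ s, s ≠ (τ : ℕ) → extendSeq S s = extendSeq S' s := by
    intro s hs
    unfold extendSeq
    split_ifs with h
    · exact hS _ fun hh => hs (by rw [← hh])
    · rfl
  set Ŝ := extendSeq S
  set Ŝ' := extendSeq S'
  -- Both outputs are decoded with `Ŝ`, so `R` becomes the same set of transcripts for the two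
  -- inputs.
  have hout : ∀ S'' : Fin T → (Fin n → Bool) × Bool, {ω | dpWinnow p S'' ω ∈ R} =
      {ω : Coins p.m T | transcript p (extendSeq S'') ω T ∈
        {l | (fun t : Fin T => (detState p Ŝ (l.drop (T - t))).wTilde) ∈ R}} := by
    intro S''
    ext ω
    simp only [Set.mem_ofPred_eq, dpWinnow_eq]
    simp only [detState_wTilde_eq p (extendSeq S'') Ŝ]
  rw [hout S, hout S', coinMeasure_transcript_mem p _ he le_rfl,
    coinMeasure_transcript_mem p _ he le_rfl, ← ENNReal.ofReal_mul (Real.exp_pos _).le,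
    ← ENNReal.ofReal_add (mul_nonneg (Real.exp_pos _).le (Finset.sum_nonneg fun l _ =>
      mul_nonneg (noiseProb_nonneg p _ T l) (samplingProb_pos p _ l).le)) (Real.exp_pos _).le]
  refine ENNReal.ofReal_le_ofReal ?_
  have hmom := sum_likelihood_rpow_le he hη hK hext hα T
  -- Either the sampling ratio is at most `e^c`, and the first term suffices, or `e^{-αc}` times its
  -- `α`-th power is at least `1`, and the second does.
  have hterm : ∀ l ∈ transcripts p.m n T, noiseProb p Ŝ T l * samplingProb p Ŝ l ≤
      Real.exp (p.epsHat + c) * (noiseProb p Ŝ' T l * samplingProb p Ŝ' l) +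
        Real.exp (-(α * c)) * (noiseProb p Ŝ T l * samplingProb p Ŝ l *
        (samplingProb p Ŝ l / samplingProb p Ŝ' l) ^ α) := by
    intro l hl
    have hB := samplingProb_pos p Ŝ l
    have hB' := samplingProb_pos p Ŝ' l
    have hq := noiseProb_nonneg p Ŝ T l
    have hq' := noiseProb_nonneg p Ŝ' T l
    rcases le_or_gt (samplingProb p Ŝ l) (Real.exp c * samplingProb p Ŝ' l) with h | h
    · have h1 := noiseProb_le p he hη.le hext (mem_transcripts.1 hl).le
      have h2 := mul_le_mul h1 h hB.le (by positivity)
      have h3 : 0 ≤ Real.exp (-(α * c)) * (noiseProb p Ŝ T l * samplingProb p Ŝ l *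
        (samplingProb p Ŝ l / samplingProb p Ŝ' l) ^ α) := by positivity
      rw [Real.exp_add]
      calc _ ≤ _ := h2
        _ = Real.exp p.epsHat * Real.exp c * (noiseProb p Ŝ' T l * samplingProb p Ŝ' l) := by ring
        _ ≤ _ := le_add_of_nonneg_right h3
    · have h1 : Real.exp (α * c) ≤ (samplingProb p Ŝ l / samplingProb p Ŝ' l) ^ α := by
        rw [mul_comm, Real.exp_mul]
        exact Real.rpow_le_rpow (Real.exp_pos _).le ((le_div_iff₀ hB').2 h.le) hα
      have h2 : 1 ≤ Real.exp (-(α * c)) * (samplingProb p Ŝ l / samplingProb p Ŝ' l) ^ α := by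
        calc (1 : ℝ) = Real.exp (-(α * c)) * Real.exp (α * c) := by rw [← Real.exp_add]; simp
          _ ≤ _ := mul_le_mul_of_nonneg_left h1 (Real.exp_pos _).le
      have h3 : 0 ≤ noiseProb p Ŝ T l * samplingProb p Ŝ l := by positivity
      have h4 : 0 ≤ Real.exp (p.epsHat + c) * (noiseProb p Ŝ' T l * samplingProb p Ŝ' l) := by
        positivity
      nlinarith
  set F := (transcripts p.m n T).filter
    (· ∈ {l : List (Observation p.m n) |
      (fun t : Fin T => (detState p Ŝ (l.drop (T - t))).wTilde) ∈ R})
  calc ∑ l ∈ F, noiseProb p Ŝ T l * samplingProb p Ŝ l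
      ≤ ∑ l ∈ F, (Real.exp (p.epsHat + c) * (noiseProb p Ŝ' T l * samplingProb p Ŝ' l) +
        Real.exp (-(α * c)) * (noiseProb p Ŝ T l * samplingProb p Ŝ l *
        (samplingProb p Ŝ l / samplingProb p Ŝ' l) ^ α)) :=
        Finset.sum_le_sum fun l hl => hterm l (Finset.mem_filter.1 hl).1
    _ = Real.exp (p.epsHat + c) * ∑ l ∈ F, noiseProb p Ŝ' T l * samplingProb p Ŝ' l +
        Real.exp (-(α * c)) * ∑ l ∈ F, noiseProb p Ŝ T l * samplingProb p Ŝ l *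
        (samplingProb p Ŝ l / samplingProb p Ŝ' l) ^ α := by
        rw [Finset.sum_add_distrib, Finset.mul_sum, Finset.mul_sum]
    _ ≤ _ := by
        gcongr
        rw [sub_eq_neg_add, Real.exp_add]
        gcongr
        refine le_trans (Finset.sum_le_sum_of_subset_of_nonneg (Finset.filter_subset _ _) ?_) hmom
        intro l _ _
        have hB := samplingProb_pos p Ŝ l
        have hB' := samplingProb_pos p Ŝ' l
        have hq := noiseProb_nonneg p Ŝ T l
        positivity

end Privacy

/-! ## The margin of monotone decision lists -/

theorem abs_add_sum_mul_pmOne_le {d : ℕ} (u : Fin d → ℝ) (u₀ : ℝ) (x : Fin d → Bool) :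
    |u₀ + ∑ j, u j * pmOne (x j)| ≤ |u₀| + ∑ j, |u j| := by
  refine (abs_add_le _ _).trans (add_le_add le_rfl ((Finset.abs_sum_le_sum_abs _ _).trans
    (Finset.sum_le_sum fun j _ => ?_)))
  rw [abs_mul, abs_pmOne, mul_one]

theorem pmOne_not (b : Bool) : pmOne (!b) = -pmOne b := by
  cases b <;> simp [pmOne]

/-- The invariant of the construction of a halfspace for a decision list, rule by rule: `g` has
norm at most `W`, margin at least `1`, and `b g ≥ -(M - 1)` for the first output bit `b`. -/
theorem exists_margin_aux {d : ℕ} (rules : List (Fin d × Bool)) (b₀ : Bool) :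
    ∃ (u : Fin d → ℝ) (u₀ M W : ℝ) (b : Bool) (l : List Bool),
      rules.map Prod.snd ++ [b₀] = b :: l ∧ 0 ≤ M ∧ |u₀| + ∑ j, |u j| ≤ W ∧
      W + 1 ≤ 2 * ((rules.length + 1 : ℕ) : ℝ) ^ alternations (rules.map Prod.snd ++ [b₀]) ∧
      ((alternations (rules.map Prod.snd ++ [b₀]) = 0 ∧ M = 0) ∨
        ∃ D, alternations (rules.map Prod.snd ++ [b₀]) = D + 1 ∧
          M ≤ 2 * ((rules.length + 1 : ℕ) : ℝ) ^ D) ∧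
      ∀ x, 1 ≤ pmOne (MonotoneDecisionList.eval ⟨rules, b₀⟩ x) * (u₀ + ∑ j, u j * pmOne (x j)) ∧
        -(M - 1) ≤ pmOne b * (u₀ + ∑ j, u j * pmOne (x j)) := by
  classical
  induction rules with
  | nil =>
    refine ⟨0, pmOne b₀, 0, 1, b₀, [], rfl, le_rfl, ?_, ?_, Or.inl ⟨rfl, rfl⟩, fun x => ?_⟩
    · simp [abs_pmOne]
    · norm_num [alternations]
    · simp [MonotoneDecisionList.eval, pmOne_mul_self]
  | cons rule rules ih =>
    obtain ⟨u, u₀, M, W, b, l, hbits, hM, hnorm, hW, hD, hx⟩ := ih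
    obtain ⟨ℓ, b'⟩ := rule
    have heval : ∀ x, MonotoneDecisionList.eval ⟨(ℓ, b') :: rules, b₀⟩ x =
        if x ℓ then b' else MonotoneDecisionList.eval ⟨rules, b₀⟩ x := fun x => rfl
    -- The new rule contributes `b' M'` times the indicator of its variable, that is `b' M' (1 +
    -- x_ℓ) / 2`, of norm `M'`.
    have hadd : ∀ (M' : ℝ) (x : Fin d → Bool), u₀ + pmOne b' * M' / 2 +
        ∑ j, (u j + if j = ℓ then pmOne b' * M' / 2 else 0) * pmOne (x j) =
        u₀ + ∑ j, u j * pmOne (x j) + if x ℓ then pmOne b' * M' else 0 := by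
      intro M' x
      simp only [add_mul, Finset.sum_add_distrib, ite_mul, zero_mul, Finset.sum_ite_eq',
        Finset.mem_univ, if_true]
      cases x ℓ <;> simp [pmOne] <;> ring
    have hnorm' : ∀ M', 0 ≤ M' → |u₀ + pmOne b' * M' / 2| +
        ∑ j, |u j + if j = ℓ then pmOne b' * M' / 2 else 0| ≤ W + M' := by
      intro M' hM'
      have habs : |pmOne b' * M' / 2| = M' / 2 := by
        rw [abs_div, abs_mul, abs_pmOne, abs_of_nonneg hM', one_mul]
        norm_num
      have h1 := abs_add_le u₀ (pmOne b' * M' / 2)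
      have h2 : ∑ j, |u j + if j = ℓ then pmOne b' * M' / 2 else 0| ≤ ∑ j, |u j| + M' / 2 := by
        calc _ ≤ ∑ j, (|u j| + if j = ℓ then M' / 2 else 0) := by
              refine Finset.sum_le_sum fun j _ => ?_
              refine (abs_add_le _ _).trans (add_le_add le_rfl ?_)
              split_ifs
              · exact habs.le
              · simp
          _ = _ := by simp [Finset.sum_add_distrib]
      linarith
    have hlen : (((ℓ, b') :: rules).length + 1 : ℕ) = (rules.length + 1) + 1 := rfl
    set r : ℝ := ((rules.length + 1 : ℕ) : ℝ) with hr
    have hr1 : 1 ≤ r := by rw [hr]; exact_mod_cast Nat.le_add_left 1 _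
    have hr' : ((((ℓ, b') :: rules).length + 1 : ℕ) : ℝ) = r + 1 := by rw [hlen, hr]; push_cast; ring
    rw [hr']
    simp only [List.map_cons, List.cons_append, hbits] at hW hD ⊢
    by_cases hbb : b' = b
    · subst hbb
      have halt : alternations (b' :: b' :: l) = alternations (b' :: l) := by simp [alternations]
      rw [halt]
      -- With a repeated bit, `b' g ≥ -(M - 1)` is known, so adding `M` already gives margin `1`.
      refine ⟨_, _, M, W + M, b', _, rfl, hM, hnorm' M hM, ?_, ?_, fun x => ?_⟩
      · rcases hD with ⟨hD0, hM0⟩ | ⟨D, hD, hMD⟩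
        · rw [hD0] at hW ⊢
          rw [hM0]
          simpa using hW
        · rw [hD, pow_succ] at hW ⊢
          have h1 : r ^ D ≤ (r + 1) ^ D := pow_le_pow_left₀ (by linarith) (by linarith) D
          nlinarith
      · rcases hD with ⟨hD0, hM0⟩ | ⟨D, hD, hMD⟩
        · exact Or.inl ⟨hD0, hM0⟩
        · refine Or.inr ⟨D, hD, hMD.trans ?_⟩
          gcongr
          linarith
      · rw [hadd, heval]
        have h1 := (hx x).1
        have h2 := (hx x).2
        have h3 := pmOne_mul_self b'
        cases x ℓ
        · simpa using ⟨h1, by linarith⟩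
        · simp only [if_true, mul_add, ← mul_assoc, h3] at h2 ⊢
          constructor <;> linarith
    · have halt : alternations (b' :: b :: l) = alternations (b :: l) + 1 := by
        simp [alternations, hbb, add_comm]
      rw [halt]
      have hW0 : 0 ≤ W := le_trans (by positivity) hnorm
      -- With a changed bit only `|g| ≤ W` is available, so the rule must outweigh the full norm.
      -- The doubling of `W + 1` is covered by `2 ≤ r + 1`.
      refine ⟨_, _, 1 + W, W + (1 + W), b', _, rfl, by linarith, hnorm' (1 + W) (by linarith), ?_,
        Or.inr ⟨_, rfl, ?_⟩, fun x => ?_⟩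
      · have h1 : r ^ alternations (b :: l) ≤ (r + 1) ^ alternations (b :: l) :=
          pow_le_pow_left₀ (by linarith) (by linarith) _
        have h2 : 0 < (r + 1) ^ alternations (b :: l) := by positivity
        rw [pow_succ]
        nlinarith
      · have h1 : r ^ alternations (b :: l) ≤ (r + 1) ^ alternations (b :: l) :=
          pow_le_pow_left₀ (by linarith) (by linarith) _
        linarith
      · rw [hadd, heval]
        have h1 := (hx x).1
        have h2 : |pmOne b' * (u₀ + ∑ j, u j * pmOne (x j))| ≤ W := by
          rw [abs_mul, abs_pmOne, one_mul]
          exact (abs_add_sum_mul_pmOne_le u u₀ x).trans hnorm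
        have h2' := (abs_le.1 h2).1
        have h3 := pmOne_mul_self b'
        cases x ℓ
        · simpa using ⟨h1, by linarith⟩
        · simp only [if_true, mul_add, ← mul_assoc, h3] at h2' ⊢
          constructor <;> linarith

/-- The signed margin of a weight vector on a labelled example. -/
noncomputable def margin {n : ℕ} (w : Fin n → ℝ) (e : (Fin n → Bool) × Bool) : ℝ :=
  pmOne e.2 * ∑ j, w j * pmOne (e.1 j)

/-- A length-`r` decision list with at most `D` alternations has margin `1 / (2 r ^ D)`. -/
theorem exists_margin_weights {d r D : ℕ} (c : MonotoneDecisionList d) (hr : c.length = r)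
    (hD : alternations c.bits ≤ D) :
    ∃ w : Fin ((d + 1) + (d + 1)) → ℝ, (∀ j, 0 ≤ w j) ∧ ∑ j, w j = 1 ∧
      ∀ x : Fin d → Bool, 2 * (1 / 4 / (r : ℝ) ^ D) ≤ margin w (expand x, c.eval x) := by
  obtain ⟨u, u₀, _, W, _, _, _, _, hnorm, hW, _, hx⟩ := exists_margin_aux c.rules c.default
  have hlen : c.rules.length + 1 = r := hr
  rw [hlen] at hW
  have hr1 : (1 : ℝ) ≤ r := by rw [← hlen]; exact_mod_cast Nat.le_add_left 1 _
  set U : Fin (d + 1) → ℝ := Fin.snoc u u₀ with hU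
  set N : ℝ := ∑ i, |U i| with hN
  have hN' : N = |u₀| + ∑ j, |u j| := by
    rw [hN, Fin.sum_univ_castSucc]
    simp [hU, add_comm]
  have hUx : ∀ x : Fin d → Bool, ∑ i, U i * pmOne ((Fin.snoc x true : Fin (d + 1) → Bool) i) =
      u₀ + ∑ j, u j * pmOne (x j) := fun x => by
    rw [Fin.sum_univ_castSucc]
    simp [hU, pmOne, add_comm]
  have hNle : N ≤ 2 * (r : ℝ) ^ D := by
    have h1 : (r : ℝ) ^ alternations c.bits ≤ (r : ℝ) ^ D := pow_le_pow_right₀ hr1 hD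
    have h2 : alternations (c.rules.map Prod.snd ++ [c.default]) = alternations c.bits := rfl
    rw [h2] at hW
    linarith
  have hN1 : 1 ≤ N := by
    have h1 := (hx fun _ => true).1
    have h2 := abs_add_sum_mul_pmOne_le u u₀ fun _ => true
    have h3 := le_abs_self (pmOne (MonotoneDecisionList.eval ⟨c.rules, c.default⟩ fun _ => true) *
      (u₀ + ∑ j, u j * pmOne true))
    rw [abs_mul, abs_pmOne, one_mul] at h3
    linarith
  have hN0 : 0 < N := by linarith
  -- Positive and negative parts go to the two copies of the coordinates, and division by the norm
  -- gives a probability vector.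
  refine ⟨Fin.append (fun i => (|U i| + U i) / 2 / N) (fun i => (|U i| - U i) / 2 / N), ?_, ?_, ?_⟩
  · intro j
    refine Fin.addCases (fun i => ?_) (fun i => ?_) j
    · rw [Fin.append_left]
      have := neg_abs_le (U i)
      exact div_nonneg (by linarith) hN0.le
    · rw [Fin.append_right]
      have := le_abs_self (U i)
      exact div_nonneg (by linarith) hN0.le
  · rw [Fin.sum_univ_add]
    simp only [Fin.append_left, Fin.append_right]
    rw [← Finset.sum_add_distrib]
    have : ∀ i, (|U i| + U i) / 2 / N + (|U i| - U i) / 2 / N = |U i| / N := fun i => by ring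
    simp only [this]
    rw [← Finset.sum_div, ← hN, div_self hN0.ne']
  · intro x
    have hsum : ∑ j, (Fin.append (fun i => (|U i| + U i) / 2 / N) (fun i => (|U i| - U i) / 2 / N) :
        Fin ((d + 1) + (d + 1)) → ℝ) j * pmOne (expand x j) =
        (u₀ + ∑ j, u j * pmOne (x j)) / N := by
      rw [Fin.sum_univ_add]
      simp only [Fin.append_left, Fin.append_right, expand, pmOne_not]
      rw [← Finset.sum_add_distrib, ← hUx, Finset.sum_div]
      exact Finset.sum_congr rfl fun i _ => by ring
    have h1 := (hx x).1
    rw [margin]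
    simp only [hsum]
    rw [← mul_div_assoc (pmOne _), le_div_iff₀ hN0]
    refine le_trans ?_ h1
    have hrD : 0 < (r : ℝ) ^ D := by positivity
    rw [show 2 * (1 / 4 / (r : ℝ) ^ D) * N = N / (2 * (r : ℝ) ^ D) by field_simp; ring,
      div_le_one (by positivity)]
    exact hNle

/-! ## Exponential moments -/

/-- From `e^y ≤ 1 + y + y²` for `|y| ≤ 1`. It serves both the normaliser of an update and the
Chernoff bound for the samples. -/
theorem sum_mul_exp_le {n : ℕ} {w a : Fin n → ℝ} (hw : IsPosProb w) (ha : ∀ j, |a j| ≤ 1) {t : ℝ}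
    (ht : |t| ≤ 1) : ∑ j, w j * Real.exp (t * a j) ≤ Real.exp (t * (∑ j, w j * a j) + t ^ 2) := by
  have hterm : ∀ j, Real.exp (t * a j) ≤ 1 + t * a j + t ^ 2 := fun j => by
    have h1 : |t * a j| ≤ 1 := by
      rw [abs_mul]
      exact mul_le_one₀ ht (abs_nonneg _) (ha j)
    have h2 := (abs_le.1 (Real.abs_exp_sub_one_sub_id_le h1)).2
    have h3 : (t * a j) ^ 2 ≤ t ^ 2 := by
      rw [mul_pow]
      exact mul_le_of_le_one_right (sq_nonneg _) ((sq_le_one_iff_abs_le_one _).2 (ha j))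
    linarith
  calc ∑ j, w j * Real.exp (t * a j) ≤ ∑ j, w j * (1 + t * a j + t ^ 2) :=
        Finset.sum_le_sum fun j _ => mul_le_mul_of_nonneg_left (hterm j) (hw.1 j).le
    _ = (∑ j, w j) + t * (∑ j, w j * a j) + (∑ j, w j) * t ^ 2 := by
        simp only [mul_add, Finset.sum_add_distrib, Finset.mul_sum, Finset.sum_mul, mul_one]
        congr 2
        exact Finset.sum_congr rfl fun j _ => by ring
    _ = (t * (∑ j, w j * a j) + t ^ 2) + 1 := by rw [hw.2]; ring
    _ ≤ _ := Real.add_one_le_exp _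

theorem margin_eq {n : ℕ} (w : Fin n → ℝ) (e : (Fin n → Bool) × Bool) :
    margin w e = ∑ j, w j * (pmOne e.2 * pmOne (e.1 j)) := by
  rw [margin, Finset.mul_sum]
  exact Finset.sum_congr rfl fun j _ => by ring

theorem abs_pmOne_mul_pmOne (b b' : Bool) : |pmOne b * pmOne b'| ≤ 1 := by
  rw [abs_mul, abs_pmOne, abs_pmOne, mul_one]

theorem margin_nonpos_of_halfspace_ne {n : ℕ} {w : Fin n → ℝ} {e : (Fin n → Bool) × Bool}
    (h : halfspace w e.1 ≠ e.2) : margin w e ≤ 0 := by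
  rw [halfspace, sgn] at h
  rw [margin]
  rcases hb : e.2 with _ | _
  · simp only [hb, ne_eq, decide_eq_false_iff_not, not_not] at h
    simpa [pmOne] using h
  · simp only [hb, ne_eq, decide_eq_true_eq, not_le] at h
    simpa [pmOne] using h.le

/-- The progress of one multiplicative weight update towards a weight vector with large margin. -/
theorem sum_mul_log_mwUpdate_ge {n : ℕ} [NeZero n] {w w₀ : Fin n → ℝ} (hw : IsPosProb w)
    (h₀1 : ∑ j, w₀ j = 1) {η ρ : ℝ} (hη : 0 ≤ η) (hη1 : η ≤ 1)
    {e : (Fin n → Bool) × Bool} (he₀ : 2 * ρ ≤ margin w₀ e) (he : margin w e ≤ ρ) :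
    ∑ j, w₀ j * Real.log (w j) + (η * ρ - η ^ 2) ≤
      ∑ j, w₀ j * Real.log (mwUpdate η w e j) := by
  have hZ := hw.sum_mul_exp_pos fun i => η * pmOne e.2 * pmOne (e.1 i)
  -- The normaliser costs at most `ηρ + η²`, while the comparison vector gains `2ηρ` from its
  -- margin.
  have hlog : Real.log (∑ i, w i * Real.exp (η * pmOne e.2 * pmOne (e.1 i))) ≤
      η * ρ + η ^ 2 := by
    have h1 := sum_mul_exp_le hw (fun j => abs_pmOne_mul_pmOne e.2 (e.1 j)) (t := η)
      (by rwa [abs_of_nonneg hη])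
    simp only [← mul_assoc] at h1
    rw [Real.log_le_iff_le_exp hZ]
    refine h1.trans (Real.exp_le_exp.2 ?_)
    have h2 := margin_eq w e
    simp only [← mul_assoc] at h2
    rw [← h2]
    have := mul_le_mul_of_nonneg_left he hη
    linarith
  set Z := ∑ i, w i * Real.exp (η * pmOne e.2 * pmOne (e.1 i)) with hZdef
  have hterm : ∀ j, w₀ j * Real.log (mwUpdate η w e j) = w₀ j * Real.log (w j) +
      η * (w₀ j * (pmOne e.2 * pmOne (e.1 j))) - w₀ j * Real.log Z := fun j => by
    rw [mwUpdate, ← hZdef, Real.log_mul (div_pos (Real.exp_pos _) hZ).ne' (hw.1 j).ne',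
      Real.log_div (Real.exp_pos _).ne' hZ.ne', Real.log_exp]
    ring
  simp only [hterm]
  rw [Finset.sum_sub_distrib, Finset.sum_add_distrib, ← Finset.mul_sum, ← Finset.sum_mul, h₀1,
    ← margin_eq]
  have := mul_le_mul_of_nonneg_left he₀ hη
  linarith

theorem sum_frequencies_mul {m n : ℕ} (v : Fin m → Fin n) (a : Fin n → ℝ) :
    ∑ j, frequencies v j * a j = (1 / m : ℝ) * ∑ i, a (v i) := by
  have h : ∑ i, a (v i) = ∑ j, ((Finset.univ.filter fun i => v i = j).card : ℝ) * a j := by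
    rw [← Finset.sum_fiberwise Finset.univ v fun i => a (v i)]
    refine Finset.sum_congr rfl fun j _ => ?_
    rw [Finset.sum_congr rfl fun i hi => by rw [(Finset.mem_filter.1 hi).2], Finset.sum_const,
      nsmul_eq_mul]
  rw [h, Finset.mul_sum]
  exact Finset.sum_congr rfl fun j _ => by rw [frequencies]; ring

open Classical in
/-- Chernoff bound: sampling rarely loses a margin of `ρ`. -/
theorem sum_prod_margin_frequencies_le {m n : ℕ} {w : Fin n → ℝ} (hw : IsPosProb w) {ρ : ℝ}
    (hρ : 0 ≤ ρ) (hρ1 : ρ ≤ 1) {e : (Fin n → Bool) × Bool} (he : ρ ≤ margin w e) :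
    ∑ v : Fin m → Fin n, (∏ i, w (v i)) * (if margin (frequencies v) e ≤ 0 then 1 else 0) ≤
      Real.exp (-(m * ρ ^ 2 / 4)) := by
  set a : Fin n → ℝ := fun j => pmOne e.2 * pmOne (e.1 j) with ha
  -- The tilt `ρ/2` minimises `-tρ + t²`, which gives `-ρ²/4` per sample.
  have hterm : ∀ v : Fin m → Fin n, (∏ i, w (v i)) *
      (if margin (frequencies v) e ≤ 0 then 1 else 0) ≤
      ∏ i, (w (v i) * Real.exp (-(ρ / 2) * a (v i))) := by
    intro v
    have hp : 0 ≤ ∏ i, w (v i) := Finset.prod_nonneg fun i _ => (hw.1 _).le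
    rw [Finset.prod_mul_distrib]
    refine mul_le_mul_of_nonneg_left ?_ hp
    split_ifs with h
    · rw [← Real.exp_sum, ← Finset.mul_sum]
      refine Real.one_le_exp ?_
      rw [margin_eq, sum_frequencies_mul] at h
      rcases Nat.eq_zero_or_pos m with hm | hm
      · subst hm; simp
      · have hm' : (0 : ℝ) < 1 / m := by positivity
        have h' : ∑ i, a (v i) ≤ 0 := by
          by_contra hc
          exact absurd h (not_le.2 (mul_pos hm' (not_le.1 hc)))
        nlinarith
    · exact Finset.prod_nonneg fun i _ => (Real.exp_pos _).le
  refine (Finset.sum_le_sum fun v _ => hterm v).trans ?_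
  rw [← Fintype.sum_pow fun j => w j * Real.exp (-(ρ / 2) * a j)]
  have h1 := sum_mul_exp_le hw (fun j => abs_pmOne_mul_pmOne e.2 (e.1 j)) (t := -(ρ / 2))
    (by rw [abs_neg, abs_of_nonneg (by linarith)]; linarith)
  have h0 : 0 ≤ ∑ j, w j * Real.exp (-(ρ / 2) * a j) :=
    Finset.sum_nonneg fun j _ => mul_nonneg (hw.1 j).le (Real.exp_pos _).le
  refine (pow_le_pow_left₀ h0 h1 m).trans ?_
  rw [← Real.exp_nat_mul, ← margin_eq]
  refine Real.exp_le_exp.2 ?_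
  have : -(ρ / 2) * margin w e + (-(ρ / 2)) ^ 2 ≤ -(ρ ^ 2 / 4) := by nlinarith
  have := mul_le_mul_of_nonneg_left this (Nat.cast_nonneg (α := ℝ) m)
  linarith

/-! ## Good events -/

section Mistakes

variable {n : ℕ} (p : WinnowParams) (S : ℕ → (Fin n → Bool) × Bool) (ρ : ℝ)

/-- The sampled weights lose the margin `ρ` on one of the first `T` examples. -/
def BadSample (T : ℕ) (l : List (Observation p.m n)) (v : Fin p.m → Fin n) : Prop :=
  ∃ t < T, ρ ≤ margin (nextWeights p S l) (S t) ∧ margin (frequencies v) (S t) ≤ 0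

/-- One of the samples in the transcript is bad. -/
def HasBadSample (T : ℕ) : List (Observation p.m n) → Prop
  | [] => False
  | none :: l => HasBadSample T l
  | some v :: l => HasBadSample T l ∨ BadSample p S ρ T l v

open Classical in
theorem sum_prod_badSample_le [NeZero n] (hρ : 0 ≤ ρ) (hρ1 : ρ ≤ 1) (T : ℕ)
    (l : List (Observation p.m n)) :
    ∑ v, (∏ i, nextWeights p S l (v i)) * (if BadSample p S ρ T l v then 1 else 0) ≤
      T * Real.exp (-(p.m * ρ ^ 2 / 4)) := by
  have hw := isPosProb_nextWeights p S l
  have hterm : ∀ v : Fin p.m → Fin n,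
      (∏ i, nextWeights p S l (v i)) * (if BadSample p S ρ T l v then 1 else 0) ≤
      ∑ t ∈ Finset.range T, if ρ ≤ margin (nextWeights p S l) (S t) then
        (∏ i, nextWeights p S l (v i)) * (if margin (frequencies v) (S t) ≤ 0 then 1 else 0)
        else 0 := by
    intro v
    have hp : 0 ≤ ∏ i, nextWeights p S l (v i) := Finset.prod_nonneg fun i _ => (hw.1 _).le
    have hnn : ∀ t ∈ Finset.range T, 0 ≤ if ρ ≤ margin (nextWeights p S l) (S t) then
        (∏ i, nextWeights p S l (v i)) * (if margin (frequencies v) (S t) ≤ 0 then 1 else 0)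
        else (0 : ℝ) := fun t _ => by
      split_ifs <;> simp [hp]
    split_ifs with h
    · obtain ⟨t, ht, h1, h2⟩ := h
      refine le_trans (le_of_eq ?_) (Finset.single_le_sum hnn (Finset.mem_range.2 ht))
      simp only [h1, h2, if_true]
    · rw [mul_zero]
      exact Finset.sum_nonneg hnn
  refine (Finset.sum_le_sum fun v _ => hterm v).trans ?_
  rw [Finset.sum_comm]
  refine (Finset.sum_le_card_nsmul _ _ (Real.exp (-(p.m * ρ ^ 2 / 4))) fun t _ => ?_).trans ?_
  · by_cases h : ρ ≤ margin (nextWeights p S l) (S t)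
    · simp only [h, if_true]
      exact sum_prod_margin_frequencies_le hw hρ hρ1 h
    · simp only [h, if_false, Finset.sum_const_zero]
      exact (Real.exp_pos _).le
  · rw [Finset.card_range, nsmul_eq_mul]

theorem coinMeasure_hasBadSample_le [NeZero n] (he : 0 < p.epsHat) (hρ : 0 ≤ ρ) (hρ1 : ρ ≤ 1)
    (T : ℕ) :
    coinMeasure p T {ω | HasBadSample p S ρ T (transcript p S ω T)} ≤
      ENNReal.ofReal (T ^ 2 * Real.exp (-(p.m * ρ ^ 2 / 4))) := by
  classical
  have hP : 0 ≤ Real.exp (-(p.m * ρ ^ 2 / 4)) := (Real.exp_pos _).le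
  set P := Real.exp (-(p.m * ρ ^ 2 / 4)) with hPdef
  -- The failure indicator plus a union-bound budget of `T P` for each remaining round: one update
  -- fails on one of `T` examples with probability at most `T P`.
  set Y : List (Observation p.m n) → ℝ := fun l =>
    (if HasBadSample p S ρ T l then 1 else 0) + ((T : ℝ) - l.length) * (T * P) with hY
  have hTP : 0 ≤ T * P := by positivity
  have key := sum_noiseProb_mul_samplingProb_mul_le p S he (T := T) Y (fun l _ => ?_)
    (fun l _ => ?_) le_rfl
  · have h := coinMeasure_transcript_mem p S he (le_refl T) {l | HasBadSample p S ρ T l}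
    refine (le_of_eq h).trans (ENNReal.ofReal_le_ofReal ?_)
    rw [Finset.sum_filter]
    refine le_trans (le_of_eq (Finset.sum_congr rfl fun l hl => ?_)) (key.trans (le_of_eq ?_))
    · have hlen := mem_transcripts.1 hl
      simp only [hY, hlen, sub_self, zero_mul, add_zero]
      by_cases hb : HasBadSample p S ρ T l <;> simp [hb]
    · have hnil : ¬HasBadSample p S ρ T ([] : List (Observation p.m n)) := id
      simp only [hY, if_neg hnil, List.length_nil, Nat.cast_zero]
      ring
  · have : HasBadSample p S ρ T (none :: l) = HasBadSample p S ρ T l := rfl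
    simp only [hY, this, List.length_cons, Nat.cast_add, Nat.cast_one]
    nlinarith
  · have hw := isPosProb_nextWeights p S l
    have hterm : ∀ v, (∏ i, nextWeights p S l (v i)) * Y (some v :: l) ≤
        (∏ i, nextWeights p S l (v i)) * ((if HasBadSample p S ρ T l then 1 else 0) +
          ((T : ℝ) - l.length - 1) * (T * P)) +
        (∏ i, nextWeights p S l (v i)) * (if BadSample p S ρ T l v then 1 else 0) := by
      intro v
      rw [← mul_add]
      refine mul_le_mul_of_nonneg_left ?_ (Finset.prod_nonneg fun i _ => (hw.1 _).le)
      simp only [hY, HasBadSample, List.length_cons, Nat.cast_add, Nat.cast_one]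
      by_cases h1 : HasBadSample p S ρ T l <;> by_cases h2 : BadSample p S ρ T l v <;>
        simp only [h1, h2, or_true, true_or, or_self, if_true, if_false] <;> linarith
    refine (Finset.sum_le_sum fun v _ => hterm v).trans ?_
    rw [Finset.sum_add_distrib, ← Finset.sum_mul, sum_prod_eq_one hw, one_mul]
    have := sum_prod_badSample_le p S ρ hρ hρ1 T l
    simp only [hY]
    rw [← hPdef] at this
    linarith

/-- All noises are within `lam` scales. -/
def GoodNoise (e lam : ℝ) {T : ℕ} (x : Noise T) : Prop :=
  |x.1.1| ≤ 2 / e * lam ∧ ∀ t, |x.1.2 t| ≤ 2 / e * lam ∧ |x.2 t| ≤ 4 / e * lam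

/-- Union bound over `2T + 1` Laplace variables, each exceeding `lam` scales with probability at
most `e^{-lam}`. -/
theorem noiseMeasure_not_goodNoise_le {e lam : ℝ} (he : 0 < e) (hlam : 0 ≤ lam) (T : ℕ) :
    noiseMeasure e T {x | ¬GoodNoise e lam x} ≤
      ENNReal.ofReal ((2 * T + 1) * Real.exp (-lam)) := by
  have := isProbabilityMeasure_laplace (b := 2 / e) (by positivity)
  have := isProbabilityMeasure_laplace (b := 4 / e) (by positivity)
  have hmeas : ∀ a : ℝ, MeasurableSet {y : ℝ | a < |y|} := fun a =>
    measurableSet_lt measurable_const (by fun_prop)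
  have hlap : ∀ b : ℝ, 0 < b → laplace b {y | b * lam < |y|} ≤ ENNReal.ofReal (Real.exp (-lam)) :=
    fun b hb => (laplace_abs_gt_le hb (mul_nonneg hb.le hlam)).trans (le_of_eq (by
      congr 2; field_simp))
  have h1 : noiseMeasure e T {x | 2 / e * lam < |x.1.1|} ≤ ENNReal.ofReal (Real.exp (-lam)) := by
    have hmp : MeasurePreserving (fun x : Noise T => x.1.1) (noiseMeasure e T) (laplace (2 / e)) :=
      measurePreserving_fst.comp measurePreserving_fst
    exact (hmp.measure_preimage (hmeas _).nullMeasurableSet).le.trans (hlap _ (by positivity))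
  have h2 : ∀ t : Fin T, noiseMeasure e T {x | 2 / e * lam < |x.1.2 t|} ≤
      ENNReal.ofReal (Real.exp (-lam)) := fun t => by
    have hmp : MeasurePreserving (fun x : Noise T => x.1.2 t) (noiseMeasure e T)
        (laplace (2 / e)) :=
      (measurePreserving_eval (fun _ : Fin T => laplace (2 / e)) t).comp
        (measurePreserving_snd.comp measurePreserving_fst)
    exact (hmp.measure_preimage (hmeas _).nullMeasurableSet).le.trans (hlap _ (by positivity))
  have h3 : ∀ t : Fin T, noiseMeasure e T {x | 4 / e * lam < |x.2 t|} ≤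
      ENNReal.ofReal (Real.exp (-lam)) := fun t => by
    have hmp : MeasurePreserving (fun x : Noise T => x.2 t) (noiseMeasure e T)
        (laplace (4 / e)) :=
      (measurePreserving_eval (fun _ : Fin T => laplace (4 / e)) t).comp measurePreserving_snd
    exact (hmp.measure_preimage (hmeas _).nullMeasurableSet).le.trans (hlap _ (by positivity))
  have hsub : {x : Noise T | ¬GoodNoise e lam x} ⊆ {x | 2 / e * lam < |x.1.1|} ∪
      ((⋃ t : Fin T, {x | 2 / e * lam < |x.1.2 t|}) ∪ ⋃ t : Fin T, {x | 4 / e * lam < |x.2 t|}) := by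
    intro x hx
    by_contra hc
    simp only [Set.mem_union, Set.mem_iUnion, Set.mem_ofPred_eq, not_or, not_exists, not_lt] at hc
    exact hx ⟨hc.1, fun t => ⟨hc.2.1 t, hc.2.2 t⟩⟩
  have hU : ∀ A : Fin T → Set (Noise T), (∀ t, noiseMeasure e T (A t) ≤
      ENNReal.ofReal (Real.exp (-lam))) →
      noiseMeasure e T (⋃ t, A t) ≤ ENNReal.ofReal (T * Real.exp (-lam)) := by
    intro A hA
    refine (measure_iUnion_fintype_le _ _).trans ((Finset.sum_le_sum fun t _ => hA t).trans ?_)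
    rw [Finset.sum_const, Finset.card_univ, Fintype.card_fin, nsmul_eq_mul,
      ENNReal.ofReal_mul (Nat.cast_nonneg T), ENNReal.ofReal_natCast]
  have hexp := (Real.exp_pos (-lam)).le
  refine (measure_mono hsub).trans ((measure_union_le _ _).trans ?_)
  refine (add_le_add h1 ((measure_union_le _ _).trans (add_le_add (hU _ h2) (hU _ h3)))).trans ?_
  rw [← ENNReal.ofReal_add (by positivity) (by positivity),
    ← ENNReal.ofReal_add (by positivity) (by positivity)]
  exact ENNReal.ofReal_le_ofReal (by linarith)

theorem GoodNoise.abs_thr_le {e lam : ℝ} {T : ℕ} {x : Noise T} (h : GoodNoise e lam x)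
    {i : Option ℕ} (hi : ∀ s, i = some s → s < T) : |x.thr i| ≤ 2 / e * lam := by
  rcases i with _ | s
  · exact h.1
  · rw [Noise.thr, dif_pos (hi s rfl)]
    exact (h.2 _).1

theorem GoodNoise.abs_query_le {e lam : ℝ} {T : ℕ} {x : Noise T} (h : GoodNoise e lam x)
    {s : ℕ} (hs : s < T) : |x.query s| ≤ 4 / e * lam := by
  rw [Noise.query, dif_pos hs]
  exact (h.2 _).2

/-! ## The mistake bound -/

open Classical in
/-- The number of prediction errors along the transcript. -/
noncomputable def errorCount : List (Observation p.m n) → ℕ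
  | [] => 0
  | _ :: l => errorCount l +
      if halfspace (detState p S l).wTilde (S l.length).1 ≠ (S l.length).2 then 1 else 0

theorem record_errs (s : WinnowState n) (e : (Fin n → Bool) × Bool) :
    (s.record e).errs = s.errs + open Classical in
      if halfspace s.wTilde e.1 ≠ e.2 then 1 else 0 := by
  unfold WinnowState.record
  simp only
  split_ifs <;> rfl

/-- The invariants of DP-Winnow on the good events. -/
structure MistakeInvariant (w₀ : Fin n → ℝ) (A : ℝ) (T : ℕ) (l : List (Observation p.m n)) :
    Prop where
  cache_ne : (detState p S l).errs ≠ 0 → (detState p S l).cache ≠ none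
  cache_margin : ∀ e, (detState p S l).cache = some e →
    2 * ρ ≤ margin w₀ e ∧ margin (detState p S l).w e ≤ ρ
  margin_le : ∀ t < T, margin (detState p S l).wTilde (S t) ≤ 0 →
    margin (detState p S l).w (S t) ≤ ρ
  potential : -Real.log n + (detState p S l).k * (p.η * ρ - p.η ^ 2) ≤
    ∑ j, w₀ j * Real.log ((detState p S l).w j)
  errs_le : ((detState p S l).errs : ℝ) ≤ A
  errorCount_le : (errorCount p S l : ℝ) ≤ (detState p S l).k * (A + 1) + (detState p S l).errs

variable {p S ρ}

/-- The potential is never positive, because all weights are at most `1`. -/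
theorem MistakeInvariant.k_mul_le [NeZero n] {w₀ : Fin n → ℝ} {A : ℝ} {T : ℕ}
    {l : List (Observation p.m n)} (h : MistakeInvariant p S ρ w₀ A T l) (h₀ : ∀ j, 0 ≤ w₀ j) :
    (detState p S l).k * (p.η * ρ - p.η ^ 2) ≤ Real.log n := by
  have hw := isPosProb_detState p S l
  have : ∑ j, w₀ j * Real.log ((detState p S l).w j) ≤ 0 :=
    Finset.sum_nonpos fun j _ => mul_nonpos_of_nonneg_of_nonpos (h₀ j)
      (Real.log_nonpos (hw.1 j).le (hw.le_one j))
  have := h.potential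
  linarith

theorem mistakeInvariant_nil [NeZero n] {w₀ : Fin n → ℝ} (h₀1 : ∑ j, w₀ j = 1) {A : ℝ}
    (hA : 0 ≤ A) (hρ : 0 ≤ ρ) (T : ℕ) : MistakeInvariant p S ρ w₀ A T [] := by
  refine ⟨fun h => absurd rfl h, fun e he => ?_, fun t _ h => h.trans hρ, ?_, ?_, ?_⟩
  · simp [detState, WinnowState.init] at he
  · have : ∑ j, w₀ j * Real.log ((detState p S ([] : List (Observation p.m n))).w j) =
        -Real.log n := by
      simp only [detState, WinnowState.init, ← Finset.sum_mul, h₀1]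
      simp
    rw [this]
    simp [detState, WinnowState.init]
  · simpa [detState, WinnowState.init] using hA
  · simp [errorCount, detState, WinnowState.init]

/-- In units of `lam / epsHat` the threshold is 8 and the two noises are at most 2 and 4. A silent
test thus bounds the errors by 14, and a successful one means at least 2, so that an example is
cached and the update makes progress. -/
theorem MistakeInvariant.cons [NeZero n] {w₀ : Fin n → ℝ} (h₀ : ∀ j, 0 ≤ w₀ j)
    (h₀1 : ∑ j, w₀ j = 1) {lam : ℝ} {T : ℕ} {l : List (Observation p.m n)} {x : Noise T}
    (hη : 0 ≤ p.η) (hη1 : p.η ≤ 1) (hgap : 0 < p.η * ρ - p.η ^ 2) (hn : 1 < n)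
    (hK : p.K = 2 * Real.log n / (p.η * ρ - p.η ^ 2)) (he : 0 < p.epsHat) (hlam : 0 < lam)
    (hL : p.L = 8 * lam / p.epsHat) (hmargin : ∀ t < T, 2 * ρ ≤ margin w₀ (S t))
    (h : MistakeInvariant p S ρ w₀ (14 * lam / p.epsHat) T l) (hl : l.length < T)
    (hx : GoodNoise p.epsHat lam x) {o : Observation p.m n} (ho : Fires p S l x ↔ o.isSome)
    (hbad : ¬HasBadSample p S ρ T (o :: l)) :
    MistakeInvariant p S ρ w₀ (14 * lam / p.epsHat) T (o :: l) := by
  classical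
  have hthr := abs_le.1 (hx.abs_thr_le (i := thrIndex l)
    fun s hs => (lt_length_of_thrIndex hs).trans hl)
  have hquery := abs_le.1 (hx.abs_query_le hl)
  have hu : 0 < lam / p.epsHat := div_pos hlam he
  have e1 : 2 / p.epsHat * lam = 2 * (lam / p.epsHat) := by ring
  have e2 : 4 / p.epsHat * lam = 4 * (lam / p.epsHat) := by ring
  have e3 : 14 * lam / p.epsHat = 14 * (lam / p.epsHat) := by ring
  have e4 : 8 * lam / p.epsHat = 8 * (lam / p.epsHat) := by ring
  rw [e3] at h ⊢
  rw [e1] at hthr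
  rw [e2] at hquery
  rw [e4] at hL
  set u := lam / p.epsHat
  -- The potential allows only `K/2` updates, so a silent round is always due to the noisy test and
  -- not to the cap.
  have hk : ((detState p S l).k : ℝ) < p.K := by
    have h1 := h.k_mul_le h₀
    have h2 : 0 < Real.log n := Real.log_pos (by exact_mod_cast hn)
    rw [hK, lt_div_iff₀ hgap]
    linarith
  set s := detState p S l with hs
  set e := S l.length with hedef
  have hcount : ((s.record e).errs : ℝ) - s.errs =
      (errorCount p S (o :: l) : ℝ) - errorCount p S l := by
    rw [record_errs, errorCount]
    push_cast
    ring
  have hrec1 : ((s.record e).errs : ℝ) ≤ s.errs + 1 := by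
    rw [record_errs]
    push_cast
    split_ifs <;> linarith
  have hcne : (s.record e).errs ≠ 0 → (s.record e).cache ≠ none := by
    intro hne
    by_cases hh : halfspace s.wTilde e.1 ≠ e.2
    · simp only [WinnowState.record, if_pos hh]
      rcases s.cache with _ | e' <;> simp
    · simp only [WinnowState.record, if_neg hh] at hne ⊢
      exact h.cache_ne hne
  have hcm : ∀ e', (s.record e).cache = some e' → 2 * ρ ≤ margin w₀ e' ∧ margin s.w e' ≤ ρ := by
    intro e' he'
    by_cases hh : halfspace s.wTilde e.1 ≠ e.2
    · simp only [WinnowState.record, if_pos hh] at he'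
      rcases hc : s.cache with _ | e''
      · rw [hc, Option.none_or, Option.some.injEq] at he'
        rw [← he']
        exact ⟨hmargin _ hl, h.margin_le _ hl (margin_nonpos_of_halfspace_ne hh)⟩
      · rw [hc, Option.some_or] at he'
        exact h.cache_margin e' (hc.trans he')
    · simp only [WinnowState.record, if_neg hh] at he'
      exact h.cache_margin e' he'
  rcases o with _ | v
  · refine ⟨hcne, hcm, h.margin_le, h.potential, ?_, ?_⟩
    · simp only [Option.isSome_none, Bool.false_eq_true, iff_false, Fires, not_and_or, not_le,
        not_lt] at ho
      rcases ho with ho | ho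
      · change ((s.record e).errs : ℝ) ≤ _
        rw [hL] at ho
        linarith
      · exact absurd hk (not_lt.2 ho)
    · have h1 := h.errorCount_le
      change (errorCount p S (none :: l) : ℝ) ≤ s.k * (14 * u + 1) + (s.record e).errs
      linarith
  · have hf : Fires p S l x := by simpa using ho
    obtain ⟨hb1, hb2⟩ := not_or.1 hbad
    have herr : (s.record e).errs ≠ 0 := by
      intro h0
      have h1 := hf.1
      rw [← hs, ← hedef, h0, hL, Nat.cast_zero] at h1
      linarith
    obtain ⟨e', he'⟩ := Option.ne_none_iff_exists'.1 (hcne herr)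
    have hw' : (detState p S (some v :: l)).w = mwUpdate p.η s.w e' := by
      change (s.record e).cache.elim s.w (mwUpdate p.η s.w) = _
      rw [he']
      rfl
    obtain ⟨hm1, hm2⟩ := hcm e' he'
    refine ⟨fun h0 => absurd rfl h0, fun e'' h0 => ?_, fun t ht h0 => ?_, ?_, ?_, ?_⟩
    · simp [detState] at h0
    -- A private margin above `ρ` lost by the new sample would be a bad sample.
    · by_contra hc
      exact hb2 ⟨t, ht, (not_le.1 hc).le, h0⟩
    · have h1 := sum_mul_log_mwUpdate_ge (isPosProb_detState p S l) h₀1 hη hη1 hm1 hm2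
      have h2 := h.potential
      rw [hw']
      change -Real.log n + ((s.k + 1 : ℕ) : ℝ) * (p.η * ρ - p.η ^ 2) ≤ _
      push_cast
      rw [← hs] at h1
      linarith
    · change ((0 : ℕ) : ℝ) ≤ _
      push_cast
      positivity
    -- The invariant bounds the errors before the firing round; the extra `1` per update is an error
    -- in that round.
    · have h1 := h.errorCount_le
      have h2 := h.errs_le
      change (errorCount p S (some v :: l) : ℝ) ≤ ((s.k + 1 : ℕ) : ℝ) * (14 * u + 1) + ((0 : ℕ) : ℝ)
      push_cast
      linarith

theorem HasBadSample.cons {T : ℕ} {l : List (Observation p.m n)}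
    {o : Observation p.m n} (h : HasBadSample p S ρ T l) : HasBadSample p S ρ T (o :: l) := by
  rcases o with _ | v
  · exact h
  · exact Or.inl h

theorem mistakeInvariant_transcript [NeZero n] {w₀ : Fin n → ℝ} (h₀ : ∀ j, 0 ≤ w₀ j)
    (h₀1 : ∑ j, w₀ j = 1) {lam : ℝ} {T : ℕ} {ω : Coins p.m T} (hρ : 0 ≤ ρ)
    (hη : 0 ≤ p.η) (hη1 : p.η ≤ 1) (hgap : 0 < p.η * ρ - p.η ^ 2) (hn : 1 < n)
    (hK : p.K = 2 * Real.log n / (p.η * ρ - p.η ^ 2)) (he : 0 < p.epsHat) (hlam : 0 < lam)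
    (hL : p.L = 8 * lam / p.epsHat) (hmargin : ∀ t < T, 2 * ρ ≤ margin w₀ (S t))
    (hx : GoodNoise p.epsHat lam ω.noise) {t : ℕ} (ht : t ≤ T)
    (hbad : ¬HasBadSample p S ρ T (transcript p S ω t)) :
    MistakeInvariant p S ρ w₀ (14 * lam / p.epsHat) T (transcript p S ω t) := by
  induction t with
  | zero => exact mistakeInvariant_nil h₀1 (by positivity) hρ T
  | succ t ih =>
    rw [transcript] at hbad ⊢
    refine (ih (Nat.le_of_succ_le ht) fun hb => hbad (HasBadSample.cons hb)).cons h₀ h₀1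
      hη hη1 hgap hn hK he hlam hL hmargin (by simpa using ht) hx ?_ hbad
    split_ifs with hf <;> simp [hf]

open Classical in
theorem errorCount_transcript [NeZero n] {T : ℕ} (S : Fin T → (Fin n → Bool) × Bool)
    (ω : Coins p.m T) {t : ℕ} (ht : t ≤ T) :
    errorCount p (extendSeq S) (transcript p (extendSeq S) ω t) =
      ∑ s : Fin T, if (s : ℕ) < t ∧ halfspace (dpWinnow p S ω s) (S s).1 ≠ (S s).2 then 1 else 0 := by
  induction t with
  | zero => simp [transcript, errorCount]
  | succ t ih =>
    have htT : t < T := ht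
    rw [transcript, errorCount, ih htT.le, length_transcript, extendSeq_of_lt S htT]
    have hd : (detState p (extendSeq S) (transcript p (extendSeq S) ω t)).wTilde =
        dpWinnow p S ω ⟨t, htT⟩ := by
      rw [dpWinnow, winnowState_eq p S ω htT.le]
    rw [hd, ← Finset.add_sum_erase _ _ (Finset.mem_univ (⟨t, htT⟩ : Fin T)),
      ← Finset.add_sum_erase _ (fun s : Fin T => if (s : ℕ) < t + 1 ∧ _ then 1 else 0)
        (Finset.mem_univ (⟨t, htT⟩ : Fin T))]
    have hrest : ∀ s ∈ Finset.univ.erase (⟨t, htT⟩ : Fin T), ((s : ℕ) < t ↔ (s : ℕ) < t + 1) := by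
      intro s hs
      have : (s : ℕ) ≠ t := fun h => Finset.ne_of_mem_erase hs (Fin.ext h)
      omega
    have hcongr : ∑ s ∈ Finset.univ.erase (⟨t, htT⟩ : Fin T),
        (if (s : ℕ) < t ∧ halfspace (dpWinnow p S ω s) (S s).1 ≠ (S s).2 then 1 else 0) =
        ∑ s ∈ Finset.univ.erase (⟨t, htT⟩ : Fin T),
        if (s : ℕ) < t + 1 ∧ halfspace (dpWinnow p S ω s) (S s).1 ≠ (S s).2 then 1 else 0 :=
      Finset.sum_congr rfl fun s hs => by simp only [hrest s hs]
    rw [hcongr]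
    simp only [lt_irrefl, false_and, if_false, Nat.lt_succ_self, true_and]
    ring

/-- The mistake bound of DP-Winnow for examples with margin `2 ρ`. -/
theorem dpWinnow_mistakes [NeZero n] {w₀ : Fin n → ℝ} (h₀ : ∀ j, 0 ≤ w₀ j)
    (h₀1 : ∑ j, w₀ j = 1) {lam : ℝ} {T : ℕ} (hρ : 0 ≤ ρ) (hρ1 : ρ ≤ 1)
    (hη : 0 ≤ p.η) (hη1 : p.η ≤ 1) (hgap : 0 < p.η * ρ - p.η ^ 2) (hn : 1 < n)
    (hK : p.K = 2 * Real.log n / (p.η * ρ - p.η ^ 2)) (he : 0 < p.epsHat) (hlam : 0 < lam)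
    (hL : p.L = 8 * lam / p.epsHat) (S : Fin T → (Fin n → Bool) × Bool)
    (hmargin : ∀ t, 2 * ρ ≤ margin w₀ (S t)) :
    ENNReal.ofReal (1 - ((2 * T + 1) * Real.exp (-lam) +
        T ^ 2 * Real.exp (-(p.m * ρ ^ 2 / 4)))) ≤
      coinMeasure p T {ω |
        ((Finset.univ.filter fun t : Fin T =>
          halfspace (dpWinnow p S ω t) (S t).1 ≠ (S t).2).card : ℝ) ≤
        (p.K / 2 + 1) * (14 * lam / p.epsHat + 1)} := by
  have := isProbabilityMeasure_coinMeasure p he T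
  set G : Set (Coins p.m T) := {ω |
        ((Finset.univ.filter fun t : Fin T =>
          halfspace (dpWinnow p S ω t) (S t).1 ≠ (S t).2).card : ℝ) ≤
        (p.K / 2 + 1) * (14 * lam / p.epsHat + 1)} with hG
  -- Covering the whole space and using subadditivity avoids any measurability claim about `G`.
  have hsub : (Set.univ : Set (Coins p.m T)) ⊆ G ∪ ({ω | ω.noise ∈ {x | ¬GoodNoise p.epsHat lam x}} ∪
      {ω | HasBadSample p (extendSeq S) ρ T (transcript p (extendSeq S) ω T)}) := by
    intro ω _
    by_contra hc
    simp only [Set.mem_union, Set.mem_ofPred_eq, not_or, not_not] at hc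
    obtain ⟨hc1, hc2, hc3⟩ := hc
    refine hc1 ?_
    have hinv := mistakeInvariant_transcript (S := extendSeq S) h₀ h₀1 hρ hη hη1 hgap hn hK he hlam
      hL (fun t ht => by rw [extendSeq_of_lt S ht]; exact hmargin _) hc2 le_rfl hc3
    have h1 := hinv.errorCount_le
    have h2 := hinv.errs_le
    have h3 := hinv.k_mul_le h₀
    rw [errorCount_transcript S ω le_rfl] at h1
    have h4 : ((detState p (extendSeq S) (transcript p (extendSeq S) ω T)).k : ℝ) ≤ p.K / 2 := by
      rw [hK, div_div, mul_comm _ (2 : ℝ), mul_div_mul_left _ _ two_ne_zero, le_div_iff₀ hgap]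
      exact h3
    have hA : 0 ≤ 14 * lam / p.epsHat := by positivity
    have h5 := mul_le_mul_of_nonneg_right h4 (by linarith : 0 ≤ 14 * lam / p.epsHat + 1)
    rw [hG, Set.mem_ofPred_eq, Finset.card_filter]
    simp only [Fin.is_lt, true_and] at h1
    refine le_trans (le_of_eq ?_) (h1.trans ?_)
    · congr 1
    · linarith
  have h1 : (1 : ENNReal) ≤ coinMeasure p T G + ENNReal.ofReal ((2 * T + 1) * Real.exp (-lam) +
        T ^ 2 * Real.exp (-(p.m * ρ ^ 2 / 4))) := by
    rw [← measure_univ (μ := coinMeasure p T), ENNReal.ofReal_add (by positivity) (by positivity)]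
    refine (measure_mono hsub).trans ((measure_union_le _ _).trans ?_)
    gcongr
    refine (measure_union_le _ _).trans (add_le_add ?_ ?_)
    · have hmeas : MeasurableSet {x : Noise T | ¬GoodNoise p.epsHat lam x} := by
        unfold GoodNoise
        measurability
      rw [coinMeasure_noise p he hmeas]
      exact noiseMeasure_not_goodNoise_le he hlam.le T
    · exact coinMeasure_hasBadSample_le p (extendSeq S) ρ he hρ hρ1 T
  rw [ENNReal.ofReal_sub _ (by positivity), ENNReal.ofReal_one]
  exact tsub_le_iff_right.2 h1

end Mistakes

/-! ## Tuned parameters -/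

theorem half_lt_log_two : (1 / 2 : ℝ) < Real.log 2 := by
  have := Real.log_two_gt_d9
  linarith

theorem log_le_two_mul_sqrt {x : ℝ} (hx : 0 < x) : Real.log x ≤ 2 * √x := by
  have h1 := Real.log_le_sub_one_of_pos (Real.sqrt_pos.2 hx)
  rw [Real.log_sqrt hx.le] at h1
  linarith

theorem one_lt_log_of_four_le {n : ℕ} (hn : 4 ≤ n) : 1 < Real.log n := by
  have h1 : Real.log 4 ≤ Real.log n := Real.log_le_log (by norm_num) (by exact_mod_cast hn)
  have h2 : Real.log 4 = 2 * Real.log 2 := by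
    rw [show (4 : ℝ) = 2 ^ 2 by norm_num, Real.log_pow]
    norm_num
  have := half_lt_log_two
  linarith

theorem half_lt_log_two_mul_div {T : ℕ} {β : ℝ} (hT : 1 ≤ T) (hβ : 0 < β) (hβ1 : β < 1) :
    1 / 2 < Real.log (2 * T / β) := by
  have hT' : (1 : ℝ) ≤ T := by exact_mod_cast hT
  refine half_lt_log_two.trans_le (Real.log_le_log two_pos ?_)
  rw [le_div_iff₀ hβ]
  nlinarith

theorem half_lt_log_two_div {δ : ℝ} (hδ : 0 < δ) (hδ1 : δ < 1) : 1 / 2 < Real.log (2 / δ) := by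
  refine half_lt_log_two.trans_le (Real.log_le_log two_pos ?_)
  rw [le_div_iff₀ hδ]
  linarith

theorem one_lt_log_four_mul_div {K δ : ℝ} (hK : 1 ≤ K) (hδ : 0 < δ) (hδ1 : δ < 1) :
    1 < Real.log (4 * K / δ) := by
  have h1 : Real.log 4 ≤ Real.log (4 * K / δ) := by
    refine Real.log_le_log (by norm_num) ?_
    rw [le_div_iff₀ hδ]
    nlinarith
  have h2 := one_lt_log_of_four_le le_rfl
  push_cast at h2
  linarith

theorem sq_eq_of_eq_div_sqrt {η ε x : ℝ} (hx : 0 < x) (h : η = ε / (8 * √x)) :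
    η ^ 2 * (64 * x) = ε ^ 2 := by
  rw [h, div_pow, mul_pow, Real.sq_sqrt hx.le]
  field_simp
  norm_num

/-- The consequences of the tuning that are used for privacy and for the mistake bound. -/
structure TuningFacts (n T : ℕ) (ρ ε δ β : ℝ) (p : WinnowParams) : Prop where
  η_pos : 0 < p.η
  η_le : p.η ≤ ρ / 2
  le_m : 8 * Real.log (2 * T / β) / ρ ^ 2 ≤ p.m
  m_le : (p.m : ℝ) ≤ 16 * Real.log (2 * T / β) / ρ ^ 2
  K_eq : p.K = 2 * Real.log n / (p.η * ρ - p.η ^ 2)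
  le_K : 128 ≤ p.K
  K_mul_le : p.K * (p.η * ρ) ≤ 4 * Real.log n
  η_sq : p.η ^ 2 * (128 * p.m * p.K * Real.log (4 * p.K / δ)) = ε ^ 2
  epsHat_pos : 0 < p.epsHat
  epsHat_le : p.epsHat ≤ ε / 16
  epsHat_eq : p.epsHat = ε / (4 * √(2 * p.K * Real.log (2 / δ)))
  L_eq : p.L = 8 * Real.log (2 * T / β) / p.epsHat

theorem le_natCeil_tuning {ρ lam : ℝ} (hρ : 0 < ρ) (hρ1 : ρ ≤ 1 / 4) (hlam : 1 / 2 < lam) :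
    8 * lam / ρ ^ 2 ≤ (⌈8 * lam / ρ ^ 2⌉₊ : ℝ) ∧
      (⌈8 * lam / ρ ^ 2⌉₊ : ℝ) ≤ 16 * lam / ρ ^ 2 ∧ 1 ≤ (⌈8 * lam / ρ ^ 2⌉₊ : ℝ) := by
  have hρ2 : 0 < ρ ^ 2 := by positivity
  have h1 : 1 ≤ 8 * lam / ρ ^ 2 := by
    rw [le_div_iff₀ hρ2]
    nlinarith
  have h2 := Nat.le_ceil (8 * lam / ρ ^ 2)
  have h3 := Nat.ceil_lt_add_one (by linarith : 0 ≤ 8 * lam / ρ ^ 2)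
  refine ⟨h2, ?_, h1.trans h2⟩
  have h4 : 16 * lam / ρ ^ 2 = 8 * lam / ρ ^ 2 + 8 * lam / ρ ^ 2 := by ring
  linarith

theorem IsWinnowTuning.facts {n T : ℕ} {ρ ε δ β : ℝ} {p : WinnowParams} (hn : 4 ≤ n)
    (hT : 1 ≤ T) (hρ : 0 < ρ) (hρ1 : ρ ≤ 1 / 4) (hε : 0 < ε) (hε1 : ε < 1) (hδ : 0 < δ)
    (hδ1 : δ < 1) (hβ : 0 < β) (hβ1 : β < 1) (h : IsWinnowTuning 8 n T ρ ε δ β p) :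
    TuningFacts n T ρ ε δ β p := by
  obtain ⟨hη, hηρ, hm, hK, heps, hηeq, hL⟩ := h
  have hlam := half_lt_log_two_mul_div hT hβ hβ1
  have hs := half_lt_log_two_div hδ hδ1
  have hlogn := one_lt_log_of_four_le hn
  obtain ⟨hm1, hm2, hm3⟩ := le_natCeil_tuning hρ hρ1 hlam
  rw [← hm] at hm1 hm2 hm3
  have hgap : 0 < p.η * ρ - p.η ^ 2 := by
    have := mul_pos hη (sub_pos.2 hηρ)
    linarith
  have hKgap : p.K * (p.η * ρ - p.η ^ 2) = 2 * Real.log n := by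
    rw [hK, div_mul_cancel₀ _ hgap.ne']
  -- The gap is at most `ρ²/4 ≤ 1/64`, and `log n > 1`.
  have hK128 : 128 ≤ p.K := by
    rw [hK, le_div_iff₀ hgap]
    have h1 := sq_nonneg (p.η - ρ / 2)
    have h2 : ρ ^ 2 ≤ (1 / 4) ^ 2 := pow_le_pow_left₀ hρ.le hρ1 2
    linarith
  have hK0 : 0 ≤ p.K := by linarith
  have hℓ := one_lt_log_four_mul_div (by linarith : 1 ≤ p.K) hδ hδ1
  have hx : 0 < 2 * p.m * p.K * Real.log (4 * p.K / δ) := by positivity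
  have hsq : p.η ^ 2 * (128 * p.m * p.K * Real.log (4 * p.K / δ)) = ε ^ 2 := by
    rw [← sq_eq_of_eq_div_sqrt hx hηeq]; ring
  -- Beyond `ρ/2` the gap is at most `η²`, so `K η² ≥ 2 log n`, and the equation for `η` would force
  -- `ε ≥ 1`.
  have hη2 : p.η ≤ ρ / 2 := by
    by_contra hc
    rw [not_le] at hc
    have h1 : p.η * ρ - p.η ^ 2 ≤ p.η ^ 2 := by
      have := mul_pos hη (sub_pos.2 hc)
      linarith
    have h2 : 2 * Real.log n ≤ p.K * p.η ^ 2 := by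
      rw [← hKgap]
      exact mul_le_mul_of_nonneg_left h1 hK0
    have h3 : 1 ≤ p.m * Real.log (4 * p.K / δ) := one_le_mul_of_one_le_of_one_le hm3 hℓ.le
    have h4 : p.η ^ 2 * (128 * p.m * p.K * Real.log (4 * p.K / δ)) =
        128 * (p.K * p.η ^ 2) * (p.m * Real.log (4 * p.K / δ)) := by ring
    have h5 : 1 ≤ 128 * (p.K * p.η ^ 2) := by linarith
    have h6 := one_le_mul_of_one_le_of_one_le h5 h3
    have h7 : ε ^ 2 < 1 := pow_lt_one₀ hε.le hε1 two_ne_zero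
    linarith
  have hy : (4 : ℝ) ≤ √(2 * p.K * Real.log (2 / δ)) := by
    refine Real.le_sqrt_of_sq_le ?_
    have := mul_le_mul hK128 hs.le (by norm_num) hK0
    linarith
  refine ⟨hη, hη2, hm1, hm2, hK, hK128, ?_, hsq, ?_, ?_, heps, hL⟩
  · have h1 : p.η * ρ ≤ 2 * (p.η * ρ - p.η ^ 2) := by
      have := mul_nonneg hη.le (sub_nonneg.2 hη2)
      linarith
    have h2 := mul_le_mul_of_nonneg_left h1 hK0
    linarith
  · rw [heps]
    positivity
  · rw [heps]
    gcongr
    linarith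

/-- With `K` viewed as a function of `η`, the tuning is the scalar equation `g η = ε²` on `(0,
ρ/2]`: `g` vanishes at `0` because `K` grows only like `1/η`, and it exceeds `ε²` at `ρ/2`. -/
theorem exists_isWinnowTuning {n T : ℕ} {ρ ε δ β : ℝ} (hn : 4 ≤ n)
    (hT : 1 ≤ T) (hρ : 0 < ρ) (hρ1 : ρ ≤ 1 / 4) (hε : 0 < ε) (hε1 : ε < 1) (hδ : 0 < δ)
    (hδ1 : δ < 1) (hβ : 0 < β) (hβ1 : β < 1) :
    ∃ p : WinnowParams, IsWinnowTuning 8 n T ρ ε δ β p := by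
  have hlam := half_lt_log_two_mul_div hT hβ hβ1
  have hlogn := one_lt_log_of_four_le hn
  obtain ⟨-, -, hm3⟩ := le_natCeil_tuning hρ hρ1 hlam
  set m := ⌈8 * Real.log (2 * T / β) / ρ ^ 2⌉₊ with hm
  set K : ℝ → ℝ := fun η => 2 * Real.log n / (η * ρ - η ^ 2) with hK
  set g : ℝ → ℝ := fun η => η ^ 2 * (128 * m * K η * Real.log (4 * K η / δ)) with hg
  have hKpos : ∀ η, 0 < η → η ≤ ρ / 2 → 1 ≤ K η := fun η h1 h2 => by
    have hgap : 0 < η * ρ - η ^ 2 := by nlinarith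
    simp only [hK]
    rw [le_div_iff₀ hgap]
    nlinarith [sq_nonneg (η - ρ / 2)]
  have hKle : ∀ η, 0 < η → η ≤ ρ / 2 → K η ≤ 4 * Real.log n / (η * ρ) := fun η h1 h2 => by
    have hgap : 0 < η * ρ - η ^ 2 := by nlinarith
    simp only [hK]
    rw [div_le_div_iff₀ hgap (by positivity)]
    have h3 : η * ρ ≤ 2 * (η * ρ - η ^ 2) := by nlinarith
    have h4 := mul_le_mul_of_nonneg_left h3 (by linarith : 0 ≤ 2 * Real.log n)
    linarith
  -- near `0` the function `g` is at most `B √η`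
  set B : ℝ := 1024 * m * Real.log n / ρ * (4 * √(Real.log n / (ρ * δ))) with hB
  have hBpos : 0 < B := by positivity
  have hgle : ∀ η, 0 < η → η ≤ ρ / 2 → g η ≤ B * √η := fun η h1 h2 => by
    have hK1 := hKpos η h1 h2
    have hK2 := hKle η h1 h2
    have hlog : Real.log (4 * K η / δ) ≤ 2 * (4 * √(Real.log n / (ρ * δ)) / √η) := by
      refine (log_le_two_mul_sqrt (by positivity)).trans ?_
      refine mul_le_mul_of_nonneg_left ?_ two_pos.le
      have h4 : (4 : ℝ) = √16 := by
        rw [show (16 : ℝ) = 4 ^ 2 by norm_num, Real.sqrt_sq (by norm_num)]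
      calc √(4 * K η / δ) ≤ √(4 * (4 * Real.log n / (η * ρ)) / δ) := by gcongr
        _ = √(16 * (Real.log n / (ρ * δ)) / η) := by congr 1; field_simp; norm_num
        _ = _ := by rw [Real.sqrt_div (by positivity), Real.sqrt_mul (by norm_num), ← h4]
    have hℓ : 0 ≤ Real.log (4 * K η / δ) := (one_lt_log_four_mul_div hK1 hδ hδ1).le.trans' zero_le_one
    have hsη : 0 < √η := Real.sqrt_pos.2 h1
    have hηη : √η * √η = η := Real.mul_self_sqrt h1.le
    calc g η ≤ η ^ 2 * (128 * m * (4 * Real.log n / (η * ρ)) *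
          (2 * (4 * √(Real.log n / (ρ * δ)) / √η))) := by
          simp only [hg]
          gcongr
      _ = B * (η / √η) := by
          rw [hB]
          field_simp
          norm_num
      _ = B * √η := by rw [Real.div_sqrt]
  have hghalf : ε ^ 2 ≤ g (ρ / 2) := by
    have hK1 := hKpos (ρ / 2) (by positivity) le_rfl
    have hℓ := one_lt_log_four_mul_div hK1 hδ hδ1
    have h1 : (ρ / 2) ^ 2 * K (ρ / 2) = 2 * Real.log n := by
      simp only [hK]
      have : ρ / 2 * ρ - (ρ / 2) ^ 2 = ρ ^ 2 / 4 := by ring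
      rw [this]
      field_simp
      norm_num
    have h2 : g (ρ / 2) = 128 * ((ρ / 2) ^ 2 * K (ρ / 2)) * (m * Real.log (4 * K (ρ / 2) / δ)) := by
      simp only [hg]
      ring
    have h3 : 1 ≤ m * Real.log (4 * K (ρ / 2) / δ) := by nlinarith
    rw [h2, h1]
    nlinarith
  set η₀ : ℝ := min (ρ / 2) ((ε ^ 2 / B) ^ 2) with hη₀
  have hη₀pos : 0 < η₀ := lt_min (by positivity) (by positivity)
  have hη₀le : η₀ ≤ ρ / 2 := min_le_left _ _
  have hgη₀ : g η₀ ≤ ε ^ 2 := by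
    refine (hgle η₀ hη₀pos hη₀le).trans ?_
    have : √η₀ ≤ ε ^ 2 / B := by
      rw [Real.sqrt_le_left (by positivity)]
      exact min_le_right _ _
    calc B * √η₀ ≤ B * (ε ^ 2 / B) := by gcongr
      _ = ε ^ 2 := by field_simp
  have hcont : ContinuousOn g (Set.Icc η₀ (ρ / 2)) := by
    have hKc : ContinuousOn K (Set.Icc η₀ (ρ / 2)) := by
      refine ContinuousOn.div (by fun_prop) (by fun_prop) fun η hη => ?_
      have h1 : 0 < η := hη₀pos.trans_le hη.1
      have h2 := hη.2
      nlinarith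
    have hlogc : ContinuousOn (fun η => Real.log (4 * K η / δ)) (Set.Icc η₀ (ρ / 2)) := by
      refine ContinuousOn.log ((continuousOn_const.mul hKc).div_const δ) fun η hη => ?_
      have := hKpos η (hη₀pos.trans_le hη.1) hη.2
      positivity
    exact (continuousOn_id.pow 2).mul ((continuousOn_const.mul hKc).mul hlogc)
  obtain ⟨η, hη, hgη⟩ := intermediate_value_Icc hη₀le hcont ⟨hgη₀, hghalf⟩
  have hηpos : 0 < η := hη₀pos.trans_le hη.1
  have hK1 := hKpos η hηpos hη.2
  have hℓ := one_lt_log_four_mul_div hK1 hδ hδ1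
  refine ⟨⟨ε / (4 * √(2 * K η * Real.log (2 / δ))), η,
    8 * Real.log (2 * T / β) / (ε / (4 * √(2 * K η * Real.log (2 / δ)))), m, K η⟩,
    hηpos, by linarith [hη.2], rfl, rfl, rfl, ?_, rfl⟩
  have hx : 0 < 2 * m * K η * Real.log (4 * K η / δ) := by positivity
  change η = ε / (8 * √(2 * m * K η * Real.log (4 * K η / δ)))
  rw [eq_div_iff (by positivity)]
  have h1 : (η * (8 * √(2 * m * K η * Real.log (4 * K η / δ)))) ^ 2 = ε ^ 2 := by
    rw [mul_pow, mul_pow, Real.sq_sqrt hx.le, ← hgη]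
    simp only [hg]
    ring
  exact (pow_left_inj₀ (by positivity) hε.le two_ne_zero).1 h1

/-! ## The privacy of the tuned learner -/

theorem TuningFacts.isDPLearner {d T : ℕ} {ρ ε δ β : ℝ} {p : WinnowParams}
    (hε : 0 < ε) (hε1 : ε < 1) (hδ : 0 < δ) (hδ1 : δ < 1)
    (h : TuningFacts ((d + 1) + (d + 1)) T ρ ε δ β p) :
    IsDPLearner (coinMeasure p T)
      (listLearner p : (Fin T → (Fin d → Bool) × Bool) → _) ε δ := by
  rintro S S' ⟨τ, hS⟩ R
  have hK := h.le_K
  have hK0 : 0 < p.K := by linarith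
  set ℓ := Real.log (4 * p.K / δ) with hℓdef
  have hℓ : 1 < ℓ := one_lt_log_four_mul_div (by linarith) hδ hδ1
  -- AboveThreshold uses at most `ε/16`, leaving `c = 15ε/16` for the sampling. This `α` minimises
  -- the Chernoff exponent once `m η² (K + 1) ℓ` is replaced by its bound `ε²/64`.
  have hα : 0 ≤ 15 * ℓ / (4 * ε) - 1 / 2 := by
    rw [sub_nonneg, le_div_iff₀ (by positivity)]
    linarith
  have key := dpWinnow_measure_le h.epsHat_pos h.η_pos hK0
    (S := fun t => (expand (S t).1, (S t).2)) (S' := fun t => (expand (S' t).1, (S' t).2)) (τ := τ)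
    (fun t ht => by rw [hS t ht]) hα (15 * ε / 16) R
  refine key.trans (add_le_add (mul_le_mul' (ENNReal.ofReal_le_ofReal (Real.exp_le_exp.2 ?_)) le_rfl)
    (ENNReal.ofReal_le_ofReal ?_))
  · have := h.epsHat_le
    linarith
  · have hV : p.m * p.η ^ 2 * (p.K + 1) * ℓ ≤ ε ^ 2 / 64 := by
      have h1 := h.η_sq
      have h2 : p.m * p.η ^ 2 * (p.K + 1) * ℓ ≤ p.m * p.η ^ 2 * (2 * p.K) * ℓ := by
        gcongr
        linarith
      rw [← h1]
      linarith
    have hexp : p.m * ((15 * ℓ / (4 * ε) - 1 / 2 + 1 / 2) ^ 2 * (4 * p.η) ^ 2 / 2) * (p.K + 1) ≤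
        225 / 128 * ℓ := by
      have h1 : p.m * ((15 * ℓ / (4 * ε) - 1 / 2 + 1 / 2) ^ 2 * (4 * p.η) ^ 2 / 2) * (p.K + 1) =
          225 / 2 * ℓ / ε ^ 2 * (p.m * p.η ^ 2 * (p.K + 1) * ℓ) := by
        field_simp
        ring
      rw [h1]
      calc _ ≤ 225 / 2 * ℓ / ε ^ 2 * (ε ^ 2 / 64) := by gcongr
        _ = _ := by field_simp; norm_num
    have hαc : (15 * ℓ / (4 * ε) - 1 / 2) * (15 * ε / 16) = 225 / 64 * ℓ - 15 * ε / 32 := by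
      field_simp
      ring
    rw [hαc]
    calc _ ≤ Real.exp (-ℓ) := Real.exp_le_exp.2 (by linarith)
      _ = δ / (4 * p.K) := by
          rw [Real.exp_neg, hℓdef, Real.exp_log (by positivity), inv_div]
      _ ≤ δ := div_le_self hδ.le (by linarith)

/-! ## The mistake rate of the tuned learner -/

/-- The number of updates is at most of the order of `L² λ ℓ / (ρ⁴ ε²)`. -/
theorem TuningFacts.K_le {n T : ℕ} {ρ ε δ β : ℝ} {p : WinnowParams} (hρ : 0 < ρ) (hε : 0 < ε)
    (hδ : 0 < δ) (hδ1 : δ < 1) (h : TuningFacts n T ρ ε δ β p) :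
    p.K ≤ 2 ^ 15 * Real.log n ^ 2 * Real.log (2 * T / β) * Real.log (4 * p.K / δ) /
      (ρ ^ 4 * ε ^ 2) := by
  have hK0 : 0 < p.K := by linarith [h.le_K]
  have hℓ : 1 < Real.log (4 * p.K / δ) := one_lt_log_four_mul_div (by linarith [h.le_K]) hδ hδ1
  set ℓ := Real.log (4 * p.K / δ)
  have hη := h.η_pos
  have h1 : (p.K * (p.η * ρ)) ^ 2 ≤ (4 * Real.log n) ^ 2 :=
    pow_le_pow_left₀ (by positivity) h.K_mul_le 2
  -- Squaring brings in `η²`, which the tuning equation eliminates, leaving one power of `K`.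
  have h2 : (p.K * (p.η * ρ)) ^ 2 * (128 * p.m * ℓ) = p.K * ρ ^ 2 * ε ^ 2 := by
    rw [← h.η_sq]; ring
  have h3 : p.K * ρ ^ 2 * ε ^ 2 ≤ (4 * Real.log n) ^ 2 *
      (128 * (16 * Real.log (2 * T / β) / ρ ^ 2) * ℓ) := by
    rw [← h2]
    have := h.m_le
    gcongr
  rw [le_div_iff₀ (by positivity)]
  calc p.K * (ρ ^ 4 * ε ^ 2) = p.K * ρ ^ 2 * ε ^ 2 * ρ ^ 2 := by ring
    _ ≤ (4 * Real.log n) ^ 2 * (128 * (16 * Real.log (2 * T / β) / ρ ^ 2) * ℓ) * ρ ^ 2 := by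
        gcongr
    _ = _ := by field_simp; ring

/-- The number of mistakes in terms of the number of updates. -/
theorem TuningFacts.mistakes_le {n T : ℕ} {ρ ε δ β : ℝ} {p : WinnowParams} (hε : 0 < ε)
    (hε1 : ε < 1) (hlam : 1 / 2 < Real.log (2 * T / β)) (hδ : 0 < δ) (hδ1 : δ < 1)
    (h : TuningFacts n T ρ ε δ β p) :
    ((p.K / 2 + 1) * (14 * Real.log (2 * T / β) / p.epsHat + 1)) ^ 2 ≤
      2 ^ 13 * p.K ^ 3 * Real.log (2 * T / β) ^ 2 * Real.log (2 / δ) / ε ^ 2 := by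
  set lam := Real.log (2 * T / β)
  have hs := half_lt_log_two_div hδ hδ1
  have hK := h.le_K
  have he := h.epsHat_pos
  have h1 : 1 ≤ 2 * lam / p.epsHat := by
    rw [le_div_iff₀ he]
    linarith [h.epsHat_le]
  have h2 : (p.K / 2 + 1) * (14 * lam / p.epsHat + 1) ≤ p.K * (16 * lam / p.epsHat) := by
    have e1 : 16 * lam / p.epsHat = 14 * lam / p.epsHat + 2 * lam / p.epsHat := by ring
    have e2 : 0 < 14 * lam / p.epsHat := by positivity
    rw [e1]
    exact mul_le_mul (by linarith) (by linarith) (by linarith) (by linarith)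
  have h3 : (p.K * (16 * lam / p.epsHat)) ^ 2 =
      2 ^ 13 * p.K ^ 3 * lam ^ 2 * Real.log (2 / δ) / ε ^ 2 := by
    rw [h.epsHat_eq, mul_pow, div_pow, div_pow, mul_pow 4, Real.sq_sqrt (by positivity)]
    field_simp
    norm_num
  rw [← h3]
  exact pow_le_pow_left₀ (by positivity) h2 2

/-- The elementary inequality behind the rate: `Q` collects the factors of the bound on the number
`K` of updates, and `F` is the rate. -/
theorem log_four_mul_div_le {K Q F s δ : ℝ} (hδ : 0 < δ) (hs : s = Real.log (2 / δ))
    (hs1 : 1 / 2 < s) (hK : 1 ≤ K) (hQ : 0 < Q) (hKQ : K ≤ 2 ^ 26 * Q * Real.log (4 * K / δ))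
    (hF : Q * s ≤ 4 * F) : Real.log (4 * K / δ) ≤ 2 ^ 8 * s * Real.log (2 + F) := by
  have hF0 : 0 < F := by nlinarith
  set Λ := Real.log (2 + F) with hΛ
  have hΛ2 : Real.log 2 ≤ Λ := Real.log_le_log two_pos (by linarith)
  have hlog2 := half_lt_log_two
  have hsplit : Real.log (4 * K / δ) = Real.log (2 * K) + s := by
    rw [hs, ← Real.log_mul (by positivity) (by positivity)]
    congr 1
    field_simp
    norm_num
  have hlogK : Real.log (2 * K) ≤ 66 * Λ := by
    -- Bounding the logarithm by a multiple of `k` makes the self-referential inequality quadratic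
    -- in `k`; cancelling one `k` bounds `K` by a polynomial in `F`, which is enough inside a
    -- logarithm.
    set k := √(2 * K) with hk
    have hk1 : 1 ≤ k := Real.one_le_sqrt.2 (by linarith)
    have hkk : k * k = 2 * K := Real.mul_self_sqrt (by linarith)
    have h1 : Real.log (2 * K) ≤ 2 * k := log_le_two_mul_sqrt (by linarith)
    have h2 : Real.log (4 * K / δ) ≤ 6 * s * k := by
      rw [hsplit]
      nlinarith
    have h3 : k * k ≤ 2 ^ 30 * Q * s * k := by
      rw [hkk]
      have := mul_le_mul_of_nonneg_left h2 (by positivity : 0 ≤ 2 ^ 26 * Q)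
      have h4 : 0 ≤ Q * s * k := by positivity
      nlinarith
    have h4 : k ≤ 2 ^ 30 * Q * s := le_of_mul_le_mul_right h3 (by linarith)
    have h5 : 2 * K ≤ (2 ^ 32 * (2 + F)) ^ 2 := by
      rw [← hkk, ← sq]
      refine pow_le_pow_left₀ (by linarith) ?_ 2
      nlinarith
    calc Real.log (2 * K) ≤ Real.log ((2 ^ 32 * (2 + F)) ^ 2) :=
          Real.log_le_log (by linarith) h5
      _ = 2 * (32 * Real.log 2 + Λ) := by
          rw [Real.log_pow, Real.log_mul (by positivity) (by positivity), Real.log_pow]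
          push_cast
          ring
      _ ≤ _ := by linarith
  rw [hsplit]
  nlinarith

/-- Squares avoid the half-integer powers coming from `K^{3/2}`. Rounding `Λ³` up to `2Λ⁴` yields an
integer power of the logarithm. -/
theorem rate_arithmetic {K R Ld τ s ε Λ F ℓ lam : ℝ} (hK0 : 0 ≤ K) (hτ : 0 ≤ τ) (hs : 0 < s) (hε : 0 < ε) (hΛ : 1 / 2 ≤ Λ) (hlam0 : 0 ≤ lam) (hlam : lam ≤ 2 * τ)
    (hℓ : ℓ ≤ 2 ^ 8 * s * Λ) (hK : K ≤ 2 ^ 26 * (R ^ 4 * Ld ^ 2 * τ / ε ^ 2) * ℓ)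
    (hF : F ^ 2 = R ^ 12 * Ld ^ 6 * τ ^ 5 * s ^ 4 / ε ^ 8) :
    2 ^ 13 * K ^ 3 * lam ^ 2 * s / ε ^ 2 ≤ (2 ^ 60 * (F * Λ ^ 2)) ^ 2 := by
  have h1 : K ≤ 2 ^ 34 * (R ^ 4 * Ld ^ 2 * τ / ε ^ 2) * (s * Λ) := by
    refine hK.trans ?_
    have := mul_le_mul_of_nonneg_left hℓ
      (by positivity : 0 ≤ 2 ^ 26 * (R ^ 4 * Ld ^ 2 * τ / ε ^ 2))
    refine this.trans (le_of_eq ?_)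
    ring
  have h2 : 2 ^ 13 * K ^ 3 * lam ^ 2 * s / ε ^ 2 ≤
      2 ^ 13 * (2 ^ 34 * (R ^ 4 * Ld ^ 2 * τ / ε ^ 2) * (s * Λ)) ^ 3 * (2 * τ) ^ 2 * s / ε ^ 2 := by
    gcongr
  have h3 : 2 ^ 13 * (2 ^ 34 * (R ^ 4 * Ld ^ 2 * τ / ε ^ 2) * (s * Λ)) ^ 3 * (2 * τ) ^ 2 * s /
      ε ^ 2 = 2 ^ 117 * F ^ 2 * Λ ^ 3 := by
    rw [hF]
    field_simp
  have h4 : Λ ^ 3 ≤ 2 * Λ ^ 4 := by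
    have : 0 ≤ Λ ^ 3 := by positivity
    nlinarith
  rw [h3] at h2
  refine h2.trans ?_
  have h5 := mul_le_mul_of_nonneg_left h4
    (mul_nonneg (pow_nonneg zero_le_two 117) (sq_nonneg F))
  calc 2 ^ 117 * F ^ 2 * Λ ^ 3 ≤ 2 ^ 117 * F ^ 2 * (2 * Λ ^ 4) := h5
    _ = 2 ^ 118 * (F ^ 2 * Λ ^ 4) := by ring
    _ ≤ 2 ^ 120 * (F ^ 2 * Λ ^ 4) :=
        mul_le_mul_of_nonneg_right (pow_le_pow_right₀ one_le_two (by norm_num)) (by positivity)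
    _ = _ := by ring

theorem TuningFacts.mistakes_le_listRate {r D d T : ℕ} {ε δ β : ℝ} {p : WinnowParams}
    (hr : 1 ≤ r) (hd : 1 ≤ d) (hT : 1 ≤ T) (hε : 0 < ε) (hε1 : ε < 1) (hδ : 0 < δ) (hδ1 : δ < 1)
    (hβ : 0 < β) (hβ1 : β < 1) (hβ2 : 2 ^ 60 * β < 1)
    (h : TuningFacts ((d + 1) + (d + 1)) T (1 / 4 / (r : ℝ) ^ D) ε δ β p) :
    (p.K / 2 + 1) * (14 * Real.log (2 * T / β) / p.epsHat + 1) ≤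
      2 ^ 60 * (listRate r D d T ε δ β * Real.log (2 + listRate r D d T ε δ β) ^ 2) := by
  have hT' : (1 : ℝ) ≤ T := by exact_mod_cast hT
  have hd' : (1 : ℝ) ≤ d := by exact_mod_cast hd
  have hr' : (1 : ℝ) ≤ r := by exact_mod_cast hr
  have hlam := half_lt_log_two_mul_div hT hβ hβ1
  have hs := half_lt_log_two_div hδ hδ1
  have hlog2 := half_lt_log_two
  have hlog2' : Real.log 2 ≤ 1 := by linarith [Real.log_two_lt_d9]
  have hRpos : 0 < (r : ℝ) ^ D := by positivity
  have hR1 : 1 ≤ (r : ℝ) ^ D := one_le_pow₀ hr'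
  have hK1 : 1 ≤ p.K := by linarith [h.le_K]
  have hLd : Real.log 2 ≤ Real.log (d + 1) := Real.log_le_log two_pos (by linarith)
  -- Smallness of `β` gives `T/β ≥ 4`; for `β` near `1` and `T = 1` this logarithm would be
  -- arbitrarily small.
  have hτ : 1 ≤ Real.log (T / β) := by
    have h1 : Real.log ((2 : ℝ) ^ 2) ≤ Real.log (T / β) := by
      refine Real.log_le_log (by positivity) ?_
      rw [le_div_iff₀ hβ]
      nlinarith
    rw [Real.log_pow] at h1
    push_cast at h1
    linarith
  have hlamτ : Real.log (2 * T / β) ≤ 2 * Real.log (T / β) := by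
    rw [mul_div_assoc, Real.log_mul (by positivity) (by positivity)]
    linarith
  have hlogn : Real.log ((d + 1 + (d + 1) : ℕ) : ℝ) ≤ 2 * Real.log (d + 1) := by
    have : ((d + 1 + (d + 1) : ℕ) : ℝ) = 2 * ((d : ℝ) + 1) := by push_cast; ring
    rw [this, Real.log_mul (by positivity) (by positivity)]
    linarith
  have hlogn0 : 0 ≤ Real.log ((d + 1 + (d + 1) : ℕ) : ℝ) := Real.log_natCast_nonneg _
  have hKle := h.K_le (by positivity) hε hδ hδ1
  have hℓ0 := one_lt_log_four_mul_div hK1 hδ hδ1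
  set R := (r : ℝ) ^ D with hR
  set Ld := Real.log (d + 1)
  set τ := Real.log (T / β)
  set s := Real.log (2 / δ) with hsdef
  set F := listRate r D d T ε δ β with hFdef
  have hLd0 : 1 / 2 < Ld := by linarith
  have hQ : 0 < R ^ 4 * Ld ^ 2 * τ / ε ^ 2 := by positivity
  have hKQ : p.K ≤ 2 ^ 26 * (R ^ 4 * Ld ^ 2 * τ / ε ^ 2) * Real.log (4 * p.K / δ) := by
    refine hKle.trans ?_
    calc _ ≤ 2 ^ 15 * (2 * Ld) ^ 2 * (2 * τ) * Real.log (4 * p.K / δ) /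
          ((1 / 4 / R) ^ 4 * ε ^ 2) := by gcongr
      _ = _ := by field_simp; norm_num
  have hFeq : F = R ^ 6 * Ld ^ 3 * τ ^ (5 / 2 : ℝ) * s ^ 2 / ε ^ 4 := by
    rw [hFdef, listRate, mul_comm 6 D, pow_mul]
  have hτsq : (τ ^ (5 / 2 : ℝ)) ^ 2 = τ ^ 5 := by
    rw [← Real.rpow_natCast, ← Real.rpow_mul (by linarith), ← Real.rpow_natCast]
    norm_num
  have hτge : τ ≤ τ ^ (5 / 2 : ℝ) := by
    nth_rewrite 1 [← Real.rpow_one τ]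
    exact Real.rpow_le_rpow_of_exponent_le hτ (by norm_num)
  have hFsq : F ^ 2 = R ^ 12 * Ld ^ 6 * τ ^ 5 * s ^ 4 / ε ^ 8 := by
    rw [hFeq, ← hτsq]
    ring
  have hQF : R ^ 4 * Ld ^ 2 * τ / ε ^ 2 * s ≤ 4 * F := by
    have e1 : R ^ 4 ≤ R ^ 6 := pow_le_pow_right₀ hR1 (by norm_num)
    have e2 : ε ^ 4 ≤ ε ^ 2 := pow_le_pow_of_le_one hε.le hε1.le (by norm_num)
    have e3 : Ld ^ 2 ≤ 2 * Ld ^ 3 := by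
      have : 0 ≤ Ld ^ 2 := by positivity
      nlinarith
    have e4 : s ≤ 2 * s ^ 2 := by nlinarith
    calc R ^ 4 * Ld ^ 2 * τ / ε ^ 2 * s ≤
        R ^ 6 * (2 * Ld ^ 3) * τ ^ (5 / 2 : ℝ) / ε ^ 4 * (2 * s ^ 2) := by gcongr
      _ = 4 * F := by rw [hFeq]; ring
  have hℓ := log_four_mul_div_le hδ hsdef hs hK1 hQ hKQ hQF
  have hF0 : 0 ≤ F := by
    rw [hFeq]
    positivity
  have hΛ : 1 / 2 ≤ Real.log (2 + F) :=
    hlog2.le.trans (Real.log_le_log two_pos (by linarith))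
  have hfin := (h.mistakes_le hε hε1 hlam hδ hδ1).trans (rate_arithmetic (by linarith)
    (by linarith) (by linarith) hε hΛ (by linarith) hlamτ hℓ hKQ hFsq)
  exact (le_abs_self _).trans (abs_le_of_sq_le_sq hfin (by positivity))

theorem mainTheorem7 :
    ∃ (cρ cm C : ℝ) (a : ℕ), 0 < cρ ∧ 0 < cm ∧ 0 < C ∧
      ∀ (r D d T : ℕ) (ε δ β : ℝ), 1 ≤ r → 1 ≤ d → 1 ≤ T →
        0 < ε → ε < 1 → 0 < δ → δ < 1 → 0 < β → β < 1 →
        (∃ p : WinnowParams,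
          IsWinnowTuning cm ((d + 1) + (d + 1)) T (cρ / (r : ℝ) ^ D) ε δ β p) ∧
        ∀ p : WinnowParams,
          IsWinnowTuning cm ((d + 1) + (d + 1)) T (cρ / (r : ℝ) ^ D) ε δ β p →
          IsDPLearner (coinMeasure p T)
              (listLearner p : (Fin T → (Fin d → Bool) × Bool) → _) ε δ ∧
          ∀ c : MonotoneDecisionList d, c.length = r → alternations c.bits ≤ D →
            ∀ x : Fin T → Fin d → Bool,
              ENNReal.ofReal (1 - C * β) ≤
                coinMeasure p T {ω |
                  (predictionErrors p (fun t => (x t, c.eval (x t))) ω : ℝ) ≤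
                    C * (listRate r D d T ε δ β *
                      Real.log (2 + listRate r D d T ε δ β) ^ a)} := by
  -- `ρ` is half of the margin `1/(2 r^D)`, and `8` makes the sampling failure small enough to
  -- absorb a union bound over `T²` events.
  refine ⟨1 / 4, 8, 2 ^ 60, 2, by norm_num, by norm_num, by norm_num, ?_⟩
  intro r D d T ε δ β hr hd hT hε hε1 hδ hδ1 hβ hβ1
  have hT' : (1 : ℝ) ≤ T := by exact_mod_cast hT
  have hR1 : 1 ≤ (r : ℝ) ^ D := one_le_pow₀ (by exact_mod_cast hr)
  have hρ : 0 < 1 / 4 / (r : ℝ) ^ D := by positivity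
  have hρ1 : 1 / 4 / (r : ℝ) ^ D ≤ 1 / 4 := div_le_self (by norm_num) hR1
  have hn : 4 ≤ (d + 1) + (d + 1) := by omega
  refine ⟨exists_isWinnowTuning hn hT hρ hρ1 hε hε1 hδ hδ1 hβ hβ1, fun p hp => ?_⟩
  have h := hp.facts hn hT hρ hρ1 hε hε1 hδ hδ1 hβ hβ1
  refine ⟨h.isDPLearner hε hε1 hδ hδ1, fun c hc hD x => ?_⟩
  -- For `β ≥ 2^{-60}` the claimed probability is nonpositive and nothing is to be shown.
  rcases le_or_gt 1 (2 ^ 60 * β) with hβ2 | hβ2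
  · rw [ENNReal.ofReal_of_nonpos (by linarith)]
    exact zero_le
  obtain ⟨w₀, h₀, h₀1, hmargin⟩ := exists_margin_weights c hc hD
  have hlam := half_lt_log_two_mul_div hT hβ hβ1
  have hη := h.η_pos
  have hη2 := h.η_le
  have key := dpWinnow_mistakes (p := p) h₀ h₀1 hρ.le (by linarith) hη.le (by linarith)
    (by nlinarith) (by omega) h.K_eq h.epsHat_pos (by linarith : 0 < Real.log (2 * T / β)) h.L_eq
    (fun t => (expand (x t), c.eval (x t))) fun t => hmargin (x t)
  refine le_trans (ENNReal.ofReal_le_ofReal ?_) (key.trans (measure_mono fun ω hω => ?_))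
  · have hexp : Real.exp (-Real.log (2 * T / β)) = β / (2 * T) := by
      rw [Real.exp_neg, Real.exp_log (by positivity), inv_div]
    have hm : 2 * Real.log (2 * T / β) ≤ p.m * (1 / 4 / (r : ℝ) ^ D) ^ 2 / 4 := by
      have h1 := (div_le_iff₀ (by positivity)).1 h.le_m
      linarith
    have h1 : Real.exp (-(p.m * (1 / 4 / (r : ℝ) ^ D) ^ 2 / 4)) ≤ (β / (2 * T)) ^ 2 := by
      rw [← hexp, ← Real.exp_nat_mul]
      refine Real.exp_le_exp.2 ?_
      push_cast
      linarith
    have h2 : (T : ℝ) ^ 2 * Real.exp (-(p.m * (1 / 4 / (r : ℝ) ^ D) ^ 2 / 4)) ≤ β := by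
      calc _ ≤ (T : ℝ) ^ 2 * (β / (2 * T)) ^ 2 := by gcongr
        _ = β * (β / 4) := by field_simp; norm_num
        _ ≤ β := by nlinarith
    have h3 : (2 * T + 1) * (β / (2 * T)) ≤ 2 * β := by
      rw [mul_div_assoc', div_le_iff₀ (by positivity)]
      nlinarith
    rw [hexp]
    linarith
  · refine le_trans ?_ (h.mistakes_le_listRate hr hd hT hε hε1 hδ hδ1 hβ hβ1 hβ2)
    exact hω
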